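/- Let $M$ be a smooth $n$-manifold without boundary ($n\ge 1$), $\Omega\subset M$ an open set whose boundary $\Sigma=\partial\Omega$ is a compact smooth embedded hypersurface, and let $\mathcal G=(g_-,g_+)$ be a metric admitting corners along $\Sigma$: $g_-$ is a Riemannian metric on $\overline\Omega$ and $g_+$ one on $M\setminus\Omega$, both of class $C^2$ up to the boundary, and they induce the same metric on $\Sigma$. Let $\Phi_-:\Sigma\times(-2\epsilon,0]\to\overline\Omega$ and $\Phi_+:\Sigma\times[0,2\epsilon)\to M\setminus\Omega$ be Gaussian coordinates of $\Sigma$: $C^3$ diffeomorphisms (up to the boundary) onto one-sided neighbourhoods of $\Sigma$, with $\Phi_\pm(x,0)=x$, such that $\Phi_\pm^*g_\pm=g_{\pm,ij}(x,t)\,dx^i\,dx^j+dt^2$. Let $\tilde M$ be the topological space $M$ with the differential structure (of class $C^3$) determined by the open sets $\Omega$, $M\setminus\overline\Omega$ and by the chart $\Phi=\Phi_-\cup\Phi_+$ identifying a neighbourhood $U$ of $\Sigma$ with $\Sigma\times(-2\epsilon,2\epsilon)$, and let $g$ be the metric on $\tilde M$ given by $g_-$ on $\overline\Omega$ and by $g_+$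 on $M\setminus\Omega$. Let $H(\Sigma,g_-)$ and $H(\Sigma,g_+)$ be the mean curvatures of $\Sigma$ in $(\overline\Omega,g_-)$ and in $(M\setminus\Omega,g_+)$ with respect to the unit normals pointing out of $\Omega$. If $H(\Sigma,g_-)=H(\Sigma,g_+)$ at every point of $\Sigma$, then there are $\delta_0\in(0,\epsilon]$ and a family $\{g_\delta\}_{0<\delta\le\delta_0}$ of $C^2$ Riemannian metrics on $\tilde M$ such that 1. $g_\delta$ is uniformly close to $g$: for every $\eta>0$ there is $\delta_1>0$ such that $|g_\delta(v,v)-g(v,v)|\le\eta\, g(v,v)$ for all $0<\delta\le\min(\delta_0,\delta_1)$ and all tangent vectors $v$ of $\tilde M$; 2. $g_\delta=g$ outside $\Sigma\times(-\frac\delta2,\frac\delta2)$; 3. the scalar curvature of $g_\delta$ on $\Sigma\times[-\frac\delta2,\frac\delta2]$ is bounded in absolute value by a constant that does not depend on $\delta\in(0,\delta_0]$. -/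

import Mathlib

open Set Bundle Manifold
open scoped Manifold ContDiff Topology

noncomputable section

namespace Corner

/-! ### Curvature in coordinates

`G : E → E →L[ℝ] E →L[ℝ] ℝ` is the coordinate expression of a metric on (a part of) a finite
dimensional real vector space `E`. -/

section Coordinates

variable {E : Type*} [NormedAddCommGroup E] [NormedSpace ℝ E] [FiniteDimensional ℝ E]

/-- The Christoffel symbols `Γ(u, v)` of `G` at `y`: the vector whose `G y`-product with every `w` is
`(D G(u)(v, w) + D G(v)(u, w) - D G(w)(u, v)) / 2`. The first derivative `D G` is taken within the
set `s` (one-sided derivatives, when `y` is a boundary point of `s`). -/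
def christoffelWithin (G : E → E →L[ℝ] E →L[ℝ] ℝ) (s : Set E) (y u v : E) : E :=
  let D := fderivWithin ℝ G s y
  (G y).inverse ((1 / 2 : ℝ) • (D u v + D v u - (D.flip u).flip v))

/-- The curvature tensor
`R(u, v) w = (D_u Γ)(v, w) - (D_v Γ)(u, w) + Γ(u, Γ(v, w)) - Γ(v, Γ(u, w))`. -/
def riemann (G : E → E →L[ℝ] E →L[ℝ] ℝ) (y u v w : E) : E :=
  let Γ := christoffelWithin G univ
  fderiv ℝ (fun z ↦ Γ z v w) y u - fderiv ℝ (fun z ↦ Γ z u w) y v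
    + Γ y u (Γ y v w) - Γ y v (Γ y u w)

/-- The Ricci curvature `Ric(v, w) = tr (u ↦ R(u, v) w)`. -/
def ricci (G : E → E →L[ℝ] E →L[ℝ] ℝ) (y v w : E) : ℝ :=
  ∑ i, (Module.finBasis ℝ E).coord i (riemann G y (Module.finBasis ℝ E i) v w)

/-- The trace `∑ hⁱʲ B(bᵢ, bⱼ)` of a bilinear form `B` with respect to an inner product `h`. -/
def traceWrt (h : E →L[ℝ] E →L[ℝ] ℝ) (B : E → E → ℝ) : ℝ :=
  ∑ i, B (Module.finBasis ℝ E i)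
    (h.inverse (LinearMap.toContinuousLinearMap ((Module.finBasis ℝ E).coord i)))

/-- The scalar curvature of `G` at `y`. -/
def coordScalar (G : E → E →L[ℝ] E →L[ℝ] ℝ) (y : E) : ℝ :=
  traceWrt (G y) (ricci G y)

end Coordinates

/-! ### Manifolds

Manifolds of dimension `k + 1` are modelled on `ℝᵏ × ℝ`, hypersurfaces on `ℝᵏ`. -/

/-- Euclidean `k`-space. -/
abbrev Euc (k : ℕ) : Type := EuclideanSpace ℝ (Fin k)

/-- The model (without boundary) of `(k + 1)`-manifolds: `ℝᵏ × ℝ`, with identity charts. -/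
abbrev mdl (k : ℕ) : ModelWithCorners ℝ (Euc k × ℝ) (ModelProd (Euc k) ℝ) :=
  𝓘(ℝ, Euc k).prod 𝓘(ℝ, ℝ)

section Manifold

variable {k : ℕ} {M : Type*} [TopologicalSpace M] [ChartedSpace (ModelProd (Euc k) ℝ) M]

variable (k M) in
/-- Fields of bilinear forms on the tangent spaces, with no regularity. -/
abbrev BilinField : Type _ :=
  ∀ p : M, TangentSpace (mdl k) p →L[ℝ] TangentSpace (mdl k) p →L[ℝ] ℝ

/-- The coordinate expression of `g` in the chart around `p`. -/
def coordMetric (g : BilinField k M) (p : M) (y : Euc k × ℝ) :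
    (Euc k × ℝ) →L[ℝ] (Euc k × ℝ) →L[ℝ] ℝ :=
  ContinuousLinearMap.bilinearComp
    (E := Euc k × ℝ) (F := Euc k × ℝ) (g ((extChartAt (mdl k) p).symm y))
    (mfderiv 𝓘(ℝ, Euc k × ℝ) (mdl k) (extChartAt (mdl k) p).symm y)
    (mfderiv 𝓘(ℝ, Euc k × ℝ) (mdl k) (extChartAt (mdl k) p).symm y)

/-- The scalar curvature of `g` at `p`, computed in the chart around `p`. -/
def scalarCurvature (g : BilinField k M) (p : M) : ℝ :=
  coordScalar (coordMetric g p) (extChartAt (mdl k) p p)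

/-- The part `N` of the manifold, seen in the chart around `p`. -/
def coordSet (k : ℕ) {M : Type*} [TopologicalSpace M] [ChartedSpace (ModelProd (Euc k) ℝ) M]
    (N : Set M) (p : M) : Set (Euc k × ℝ) :=
  (extChartAt (mdl k) p).target ∩ (extChartAt (mdl k) p).symm ⁻¹' N

/-- `g` restricts to a `C²` Riemannian metric on `N`; when `N` is a closed region with boundary,
this means that `g` is `C²` up to the boundary. -/
structure IsC2MetricOn [IsManifold (mdl k) 1 M] (g : BilinField k M) (N : Set M) : Prop where
  symm : ∀ p ∈ N, ∀ v w, g p v w = g p w v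
  pos : ∀ p ∈ N, ∀ v, v ≠ 0 → 0 < g p v v
  contMDiffOn : ContMDiffOn (mdl k)
    ((mdl k).prod 𝓘(ℝ, (Euc k × ℝ) →L[ℝ] (Euc k × ℝ) →L[ℝ] ℝ)) 2
    (fun p ↦ TotalSpace.mk' ((Euc k × ℝ) →L[ℝ] (Euc k × ℝ) →L[ℝ] ℝ)
      (E := fun p : M ↦ TangentSpace (mdl k) p →L[ℝ] TangentSpace (mdl k) p →L[ℝ] ℝ) p (g p)) N

variable {S : Type*} [TopologicalSpace S] [ChartedSpace (Euc k) S]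

/-- `ι : S → M` in the charts around `x` and `ι x`. -/
def coordMap (ι : S → M) (x : S) : Euc k → Euc k × ℝ :=
  writtenInExtChartAt 𝓘(ℝ, Euc k) (mdl k) x ι

/-- `ν` is a unit normal at `ι x` to the hypersurface `ι : S → M`, pointing into `N`. -/
def IsInwardUnitNormal (g : BilinField k M) (N : Set M) (ι : S → M) (x : S)
    (ν : TangentSpace (mdl k) (ι x)) : Prop :=
  g (ι x) ν ν = 1 ∧
  (∀ v : TangentSpace 𝓘(ℝ, Euc k) x, g (ι x) ν (mfderiv 𝓘(ℝ, Euc k) (mdl k) ι x v) = 0) ∧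
  (ν : Euc k × ℝ) ∈ posTangentConeAt (coordSet k N (ι x)) (extChartAt (mdl k) (ι x) (ι x))

/-- The unit normal at `ι x` pointing into `N`. -/
def inwardUnitNormal (g : BilinField k M) (N : Set M) (ι : S → M) (x : S) :
    TangentSpace (mdl k) (ι x) :=
  Classical.epsilon (IsInwardUnitNormal g N ι x)

/-- The second fundamental form `A(u, v) = -g(ν, ∇_u v) = g(∇_u ν, v)` at `ι x` of the hypersurface
`ι : S → M`, a part of the boundary of the region `N` on which `g` is defined. -/
def secondFundamentalForm (g : BilinField k M) (N : Set M) (ι : S → M) (x : S)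
    (ν : TangentSpace (mdl k) (ι x)) (u v : Euc k) : ℝ :=
  let x₀ := extChartAt 𝓘(ℝ, Euc k) x x
  let y₀ := extChartAt (mdl k) (ι x) (ι x)
  let f := coordMap ι x;
  -(coordMetric g (ι x) y₀ ν
    (fderiv ℝ (fderiv ℝ f) x₀ u v +
      christoffelWithin (coordMetric g (ι x)) (coordSet k N (ι x)) y₀
        (fderiv ℝ f x₀ u) (fderiv ℝ f x₀ v)))

/-- The mean curvature of `ι : S → M` at `ι x` with respect to `ν`: the trace of the second
fundamental form with respect to the induced metric. -/
def meanCurvature (g : BilinField k M) (N : Set M) (ι : S → M) (x : S)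
    (ν : TangentSpace (mdl k) (ι x)) : ℝ :=
  let df := fderiv ℝ (coordMap ι x) (extChartAt 𝓘(ℝ, Euc k) x x)
  traceWrt
    ((coordMetric g (ι x) (extChartAt (mdl k) (ι x) (ι x))).bilinearComp df df)
    (secondFundamentalForm g N ι x ν)

end Manifold

/-! ### Metrics with corners, Gaussian collars and the glued manifold -/

section Corners

variable {k : ℕ}
  {S : Type*} [TopologicalSpace S] [ChartedSpace (Euc k) S]
  {M : Type*} [TopologicalSpace M] [ChartedSpace (ModelProd (Euc k) ℝ) M]
  [IsManifold (mdl k) ∞ M]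

/-- `ι : S → M` is a smooth embedded hypersurface, and it is the boundary of the open set `Ω`. -/
structure IsSmoothBoundary (k : ℕ)
    {S : Type*} [TopologicalSpace S] [ChartedSpace (Euc k) S]
    {M : Type*} [TopologicalSpace M] [ChartedSpace (ModelProd (Euc k) ℝ) M]
    (Ω : Set M) (ι : S → M) : Prop where
  isOpen : IsOpen Ω
  isSmoothEmbedding : IsSmoothEmbedding 𝓘(ℝ, Euc k) (mdl k) ∞ ι
  frontier_eq : frontier Ω = range ι

/-- A metric admitting corners along the hypersurface `ι : S → M` bounding `Ω`: a metric `gm`,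
`C²` on `closure Ω`, and a metric `gp`, `C²` on `Ωᶜ`, which induce the same metric on `S`.
The values of `gm` outside `closure Ω` and of `gp` on `Ω` play no role. -/
structure CornerMetric (k : ℕ)
    {S : Type*} [TopologicalSpace S] [ChartedSpace (Euc k) S]
    {M : Type*} [TopologicalSpace M] [ChartedSpace (ModelProd (Euc k) ℝ) M]
    [IsManifold (mdl k) ∞ M] (Ω : Set M) (ι : S → M) where
  isSmoothBoundary : IsSmoothBoundary k Ω ι
  gm : BilinField k M
  gp : BilinField k M
  isMetric_gm : IsC2MetricOn gm (closure Ω)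
  isMetric_gp : IsC2MetricOn gp Ωᶜ
  induced_eq : ∀ (x : S) (v w : TangentSpace 𝓘(ℝ, Euc k) x),
    gm (ι x) (mfderiv 𝓘(ℝ, Euc k) (mdl k) ι x v) (mfderiv 𝓘(ℝ, Euc k) (mdl k) ι x w) =
    gp (ι x) (mfderiv 𝓘(ℝ, Euc k) (mdl k) ι x v) (mfderiv 𝓘(ℝ, Euc k) (mdl k) ι x w)

variable {Ω : Set M} {ι : S → M}

/-- The mean curvature `H(Σ, g₋)` with respect to the unit normal pointing out of `Ω`. -/
def CornerMetric.meanCurvatureMinus (G : CornerMetric k Ω ι) (x : S) : ℝ :=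
  meanCurvature G.gm (closure Ω) ι x (-inwardUnitNormal G.gm (closure Ω) ι x)

/-- The mean curvature `H(Σ, g₊)` with respect to the unit normal pointing out of `Ω`. -/
def CornerMetric.meanCurvaturePlus (G : CornerMetric k Ω ι) (x : S) : ℝ :=
  meanCurvature G.gp Ωᶜ ι x (inwardUnitNormal G.gp Ωᶜ ι x)

/-- Gaussian coordinates of `Σ` on both sides: a homeomorphism `Φ` of `Σ × (-2ε, 2ε)` onto an open
neighbourhood of `Σ`, which restricts to `C³` diffeomorphisms `Φ₋` of `Σ × (-2ε, 0]` into
`closure Ω` and `Φ₊` of `Σ × [0, 2ε)` into `Ωᶜ` such that the pull-backs of `g₋` and `g₊` are of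
the form `gᵢⱼ(x, t) dxⁱ dxʲ + dt²`. -/
structure GaussianCollar (G : CornerMetric k Ω ι) where
  ε : ℝ
  ε_pos : 0 < ε
  Φ : OpenPartialHomeomorph (S × ℝ) M
  source_eq : Φ.source = univ ×ˢ Ioo (-(2 * ε)) (2 * ε)
  apply_zero : ∀ x, Φ (x, 0) = ι x
  mem_of_neg : ∀ x, ∀ t ∈ Ioo (-(2 * ε)) 0, Φ (x, t) ∈ Ω
  mem_of_pos : ∀ x, ∀ t ∈ Ioo 0 (2 * ε), Φ (x, t) ∈ (closure Ω)ᶜ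
  contMDiffOn_neg : ContMDiffOn (mdl k) (mdl k) 3 Φ (univ ×ˢ Ioc (-(2 * ε)) 0)
  contMDiffOn_pos : ContMDiffOn (mdl k) (mdl k) 3 Φ (univ ×ˢ Ico 0 (2 * ε))
  contMDiffOn_symm_neg : ContMDiffOn (mdl k) (mdl k) 3 Φ.symm (Φ.target ∩ closure Ω)
  contMDiffOn_symm_pos : ContMDiffOn (mdl k) (mdl k) 3 Φ.symm (Φ.target ∩ Ωᶜ)
  gauss_neg : ∀ x, ∀ t ∈ Ioc (-(2 * ε)) 0, ∀ (v : Euc k) (a : ℝ),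
    G.gm (Φ (x, t))
      (mfderivWithin (mdl k) (mdl k) Φ (univ ×ˢ Ioc (-(2 * ε)) 0) (x, t) ((0, 1) : Euc k × ℝ))
      (mfderivWithin (mdl k) (mdl k) Φ (univ ×ˢ Ioc (-(2 * ε)) 0) (x, t) ((v, a) : Euc k × ℝ)) = a
  gauss_pos : ∀ x, ∀ t ∈ Ico 0 (2 * ε), ∀ (v : Euc k) (a : ℝ),
    G.gp (Φ (x, t))
      (mfderivWithin (mdl k) (mdl k) Φ (univ ×ˢ Ico 0 (2 * ε)) (x, t) ((0, 1) : Euc k × ℝ))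
      (mfderivWithin (mdl k) (mdl k) Φ (univ ×ˢ Ico 0 (2 * ε)) (x, t) ((v, a) : Euc k × ℝ)) = a

/-- The manifold `M̃`: the topological space `M`, with the differential structure determined by
the open sets `Ω` and `M ∖ closure Ω` of `M` and by `Φ : Σ × (-2ε, 2ε) → M`. -/
def Glued {G : CornerMetric k Ω ι} (_c : GaussianCollar G) : Type _ := M

namespace Glued

variable {G : CornerMetric k Ω ι} (c : GaussianCollar G)

instance : TopologicalSpace (Glued c) := inferInstanceAs (TopologicalSpace M)

/-- The identity map `M̃ → M`. -/
def toM (p : Glued c) : M := p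

/-- The identity map `M → M̃`. -/
def ofM (p : M) : Glued c := p

/-- A chart of `M`, restricted to `Ω ∪ (M ∖ closure Ω)`. -/
def offChart (e : OpenPartialHomeomorph M (ModelProd (Euc k) ℝ)) :
    OpenPartialHomeomorph (Glued c) (ModelProd (Euc k) ℝ) :=
  OpenPartialHomeomorph.restr (X := M) e (frontier Ω)ᶜ

/-- The chart of `Φ (Σ × (-2ε, 2ε))` given by a chart of `Σ` and the coordinate `t`. -/
def collarChart (e : OpenPartialHomeomorph S (Euc k)) :
    OpenPartialHomeomorph (Glued c) (ModelProd (Euc k) ℝ) :=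
  OpenPartialHomeomorph.trans (X := M) c.Φ.symm (e.prod (OpenPartialHomeomorph.refl ℝ))

theorem frontier_subset_target {p : M} (hp : p ∈ frontier Ω) : p ∈ c.Φ.target := by
  rw [G.isSmoothBoundary.frontier_eq] at hp
  obtain ⟨x, rfl⟩ := hp
  rw [← c.apply_zero x]
  apply c.Φ.map_source
  rw [c.source_eq]
  have := c.ε_pos
  exact ⟨mem_univ _, by constructor <;> simp <;> linarith⟩

open Classical in
instance : ChartedSpace (ModelProd (Euc k) ℝ) (Glued c) where
  atlas := offChart c '' atlas (ModelProd (Euc k) ℝ) M ∪ collarChart c '' atlas (Euc k) S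
  chartAt p := if toM c p ∈ c.Φ.target
    then collarChart c (chartAt (Euc k) (c.Φ.symm (toM c p)).1)
    else offChart c (chartAt (ModelProd (Euc k) ℝ) (toM c p))
  mem_chart_source p := by
    split_ifs with h
    · change p ∈ (OpenPartialHomeomorph.trans (X := M) c.Φ.symm _).source
      rw [OpenPartialHomeomorph.trans_source]
      refine ⟨h, ?_⟩
      simp only [OpenPartialHomeomorph.prod_source, OpenPartialHomeomorph.refl_source]
      exact ⟨mem_chart_source _ _, mem_univ _⟩
    · change p ∈ (OpenPartialHomeomorph.restr (X := M) _ _).source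
      rw [OpenPartialHomeomorph.restr_source, isClosed_frontier.isOpen_compl.interior_eq]
      exact ⟨mem_chart_source _ (toM c p), fun h' ↦ h (frontier_subset_target c h')⟩
  chart_mem_atlas p := by
    split_ifs with h
    · exact Or.inr (mem_image_of_mem _ (chart_mem_atlas _ _))
    · exact Or.inl (mem_image_of_mem _ (chart_mem_atlas _ _))

theorem contMDiffOn_symm_off :
    ContMDiffOn (mdl k) (mdl k) 3 c.Φ.symm (c.Φ.target ∩ (frontier Ω)ᶜ) := by
  intro p hp
  by_cases h : p ∈ closure Ω
  · have hΩ : p ∈ Ω := by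
      by_contra h'
      exact hp.2 (by rw [G.isSmoothBoundary.isOpen.frontier_eq]; exact ⟨h, h'⟩)
    have hn : c.Φ.target ∩ closure Ω ∈ 𝓝 p := Filter.inter_mem
      (c.Φ.open_target.mem_nhds hp.1)
      (Filter.mem_of_superset (G.isSmoothBoundary.isOpen.mem_nhds hΩ) subset_closure)
    exact ((c.contMDiffOn_symm_neg p ⟨hp.1, h⟩).contMDiffAt hn).contMDiffWithinAt
  · have hn : c.Φ.target ∩ Ωᶜ ∈ 𝓝 p := Filter.inter_mem
      (c.Φ.open_target.mem_nhds hp.1)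
      (Filter.mem_of_superset (isClosed_closure.isOpen_compl.mem_nhds h)
        (compl_subset_compl.2 subset_closure))
    exact ((c.contMDiffOn_symm_pos p ⟨hp.1, fun h' ↦ h (subset_closure h')⟩).contMDiffAt
      hn).contMDiffWithinAt

theorem contMDiffOn_off :
    ContMDiffOn (mdl k) (mdl k) 3 c.Φ (c.Φ.source ∩ c.Φ ⁻¹' (frontier Ω)ᶜ) := by
  rintro ⟨x, t⟩ ⟨h1, h2⟩
  have h1' := h1
  rw [c.source_eq] at h1
  have ht : t ≠ 0 := by
    rintro rfl
    apply h2
    rw [c.apply_zero, G.isSmoothBoundary.frontier_eq]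
    exact mem_range_self _
  have hn : c.Φ.source ∈ 𝓝 (x, t) := c.Φ.open_source.mem_nhds h1'
  rcases lt_or_gt_of_ne ht with h | h
  · have hn' : (univ : Set S) ×ˢ Ioc (-(2 * c.ε)) 0 ∈ 𝓝 (x, t) :=
      prod_mem_nhds Filter.univ_mem (Ioc_mem_nhds h1.2.1 h)
    exact ((c.contMDiffOn_neg (x, t) ⟨mem_univ _, h1.2.1, h.le⟩).contMDiffAt hn').contMDiffWithinAt
  · have hn' : (univ : Set S) ×ˢ Ico 0 (2 * c.ε) ∈ 𝓝 (x, t) :=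
      prod_mem_nhds Filter.univ_mem (Ico_mem_nhds h h1.2.2)
    exact ((c.contMDiffOn_pos (x, t) ⟨mem_univ _, h.le, h1.2.2⟩).contMDiffAt hn').contMDiffWithinAt

theorem mem_offChart_source {e : OpenPartialHomeomorph M (ModelProd (Euc k) ℝ)} {p : M}
    (h : ofM c p ∈ (offChart c e).source) : p ∈ e.source ∧ p ∈ (frontier Ω)ᶜ := by
  change p ∈ (OpenPartialHomeomorph.restr (X := M) _ _).source at h
  rwa [OpenPartialHomeomorph.restr_source, isClosed_frontier.isOpen_compl.interior_eq] at h

theorem mem_offChart_target {e : OpenPartialHomeomorph M (ModelProd (Euc k) ℝ)}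
    {y : ModelProd (Euc k) ℝ} (h : y ∈ (offChart c e).target) :
    y ∈ e.target ∧ e.symm y ∈ (frontier Ω)ᶜ := by
  have h1 := (offChart c e).map_target h
  exact ⟨h.1, (mem_offChart_source c h1).2⟩

theorem mem_collarChart_source {e : OpenPartialHomeomorph S (Euc k)} {p : M}
    (h : ofM c p ∈ (collarChart c e).source) :
    p ∈ c.Φ.target ∧ c.Φ.symm p ∈ (e.prod (OpenPartialHomeomorph.refl ℝ)).source := h

theorem mem_collarChart_target {e : OpenPartialHomeomorph S (Euc k)}
    {y : ModelProd (Euc k) ℝ} (h : y ∈ (collarChart c e).target) :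
    y ∈ (e.prod (OpenPartialHomeomorph.refl ℝ)).target ∧
      (e.prod (OpenPartialHomeomorph.refl ℝ)).symm y ∈ c.Φ.source := h

theorem contMDiffOn_transition [IsManifold 𝓘(ℝ, Euc k) ∞ S]
    {e e' : OpenPartialHomeomorph (Glued c) (ModelProd (Euc k) ℝ)}
    (he : e ∈ atlas (ModelProd (Euc k) ℝ) (Glued c))
    (he' : e' ∈ atlas (ModelProd (Euc k) ℝ) (Glued c)) :
    ContMDiffOn (mdl k) (mdl k) 3 (e.symm.trans e') (e.symm.trans e').source := by
  have i1 : IsManifold (mdl k) 3 M := inferInstance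
  have i2 : IsManifold 𝓘(ℝ, Euc k) 3 S := inferInstance
  have hprod : ∀ f ∈ atlas (Euc k) S, f.prod (OpenPartialHomeomorph.refl ℝ) ∈
      IsManifold.maximalAtlas (mdl k) 3 (S × ℝ) := fun f hf ↦
    IsManifold.subset_maximalAtlas ⟨f, hf, _, by simp, rfl⟩
  have hsrc : ∀ y ∈ (e.symm.trans e').source, y ∈ e.target ∧ e.symm y ∈ e'.source :=
    fun y hy ↦ hy
  rcases he with ⟨f, hf, rfl⟩ | ⟨f, hf, rfl⟩ <;> rcases he' with ⟨f', hf', rfl⟩ | ⟨f', hf', rfl⟩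
  · have A := contMDiffOn_symm_of_mem_maximalAtlas (I := mdl k) (n := 3)
      (IsManifold.subset_maximalAtlas hf)
    have B := contMDiffOn_of_mem_maximalAtlas (I := mdl k) (n := 3)
      (IsManifold.subset_maximalAtlas hf')
    exact B.comp (A.mono fun y hy ↦ (mem_offChart_target c (hsrc y hy).1).1)
      fun y hy ↦ (mem_offChart_source c (hsrc y hy).2).1
  · have A := contMDiffOn_symm_of_mem_maximalAtlas (I := mdl k) (n := 3)
      (IsManifold.subset_maximalAtlas hf)
    have B := contMDiffOn_of_mem_maximalAtlas (I := mdl k) (n := 3) (hprod f' hf')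
    have C := (contMDiffOn_symm_off c).comp
      (A.mono fun y hy ↦ (mem_offChart_target c (hsrc y hy).1).1)
      fun y hy ↦ ⟨(mem_collarChart_source c (hsrc y hy).2).1,
        (mem_offChart_target c (hsrc y hy).1).2⟩
    exact B.comp C fun y hy ↦ (mem_collarChart_source c (hsrc y hy).2).2
  · have A := contMDiffOn_symm_of_mem_maximalAtlas (I := mdl k) (n := 3) (hprod f hf)
    have B := contMDiffOn_of_mem_maximalAtlas (I := mdl k) (n := 3)
      (IsManifold.subset_maximalAtlas hf')
    have C := (contMDiffOn_off c).comp
      (A.mono fun y hy ↦ (mem_collarChart_target c (hsrc y hy).1).1)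
      fun y hy ↦ ⟨(mem_collarChart_target c (hsrc y hy).1).2,
        (mem_offChart_source c (hsrc y hy).2).2⟩
    exact B.comp C fun y hy ↦ (mem_offChart_source c (hsrc y hy).2).1
  · have A := contMDiffOn_symm_of_mem_maximalAtlas (I := mdl k) (n := 3) (hprod f hf)
    have B := contMDiffOn_of_mem_maximalAtlas (I := mdl k) (n := 3) (hprod f' hf')
    have key : ∀ y ∈ ((collarChart c f).symm.trans (collarChart c f')).source,
        c.Φ.symm (c.Φ ((f.prod (OpenPartialHomeomorph.refl ℝ)).symm y)) =
          (f.prod (OpenPartialHomeomorph.refl ℝ)).symm y :=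
      fun y hy ↦ c.Φ.left_inv (mem_collarChart_target c (hsrc y hy).1).2
    have C := B.comp (A.mono fun y hy ↦ (mem_collarChart_target c (hsrc y hy).1).1)
      fun y hy ↦ by
        have h := (mem_collarChart_source c (hsrc y hy).2).2
        have h' := key y hy
        change (f.prod (OpenPartialHomeomorph.refl ℝ)).symm y ∈
          (f'.prod (OpenPartialHomeomorph.refl ℝ)).source
        rw [← h']
        exact h
    exact C.congr fun y hy ↦ congrArg (f'.prod (OpenPartialHomeomorph.refl ℝ)) (key y hy)

instance [IsManifold 𝓘(ℝ, Euc k) ∞ S] : IsManifold (mdl k) 3 (Glued c) where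
  compatible {e e'} he he' := by
    have h := contMDiffOn_transition c he he'
    have h' := contMDiffOn_transition c he' he
    simp only [contDiffGroupoid, mem_groupoid_of_pregroupoid, contDiffPregroupoid,
      ← contMDiffOn_iff_contDiffOn]
    constructor
    · exact (mdl k).contMDiff.comp_contMDiffOn
        (h.comp ((mdl k).contMDiffOn_symm.mono (by simp)) (fun y hy ↦ hy.1))
    · exact (mdl k).contMDiff.comp_contMDiffOn
        (h'.comp ((mdl k).contMDiffOn_symm.mono (by simp)) (fun y hy ↦ hy.1))

instance [IsManifold 𝓘(ℝ, Euc k) ∞ S] : IsManifold (mdl k) 1 (Glued c) :=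
  IsManifold.of_le (n := 3) (by norm_num)

/-- The metric `g` on `M̃` given by `g₋` and `g₊`: the pull-back of `g₋` by the identity map
`M̃ → M`, which is differentiable within `closure Ω`, and likewise of `g₊` on `M ∖ closure Ω`. -/
def metric (p : Glued c) :
    TangentSpace (mdl k) p →L[ℝ] TangentSpace (mdl k) p →L[ℝ] ℝ :=
  open Classical in
  if toM c p ∈ closure Ω then
    ContinuousLinearMap.bilinearComp (E := Euc k × ℝ) (F := Euc k × ℝ)
      (E' := Euc k × ℝ) (F' := Euc k × ℝ) (G.gm (toM c p))
      (mfderivWithin (mdl k) (mdl k) (toM c) (toM c ⁻¹' closure Ω) p)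
      (mfderivWithin (mdl k) (mdl k) (toM c) (toM c ⁻¹' closure Ω) p)
  else
    ContinuousLinearMap.bilinearComp (E := Euc k × ℝ) (F := Euc k × ℝ)
      (E' := Euc k × ℝ) (F' := Euc k × ℝ) (G.gp (toM c p))
      (mfderivWithin (mdl k) (mdl k) (toM c) (toM c ⁻¹' Ωᶜ) p)
      (mfderivWithin (mdl k) (mdl k) (toM c) (toM c ⁻¹' Ωᶜ) p)

/-- The strip `Σ × I` in `M̃`. -/
def strip (I : Set ℝ) : Set (Glued c) := toM c ⁻¹' (c.Φ '' (univ ×ˢ I))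

/-- `C²` Riemannian metrics on `M̃`. -/
abbrev C2Metric [IsManifold 𝓘(ℝ, Euc k) ∞ S] : Type _ :=
  ContMDiffRiemannianMetric (mdl k) 2 (Euc k × ℝ)
    (fun p : Glued c ↦ TangentSpace (mdl k) p)

end Glued

end Corners

end Corner

end

/-! In collar coordinates the metric of $\tilde M$ is $g=\gamma(x,t)+dt^2$. It is continuous across
$t=0$ and $C^2$ on each closed side; only $\partial_t\gamma$ jumps. By the Koszul formula the second
fundamental form of $\Sigma$, seen from either side, is $\frac12\partial_t\gamma$. Equality of the
mean curvatures therefore says that the jump $J_0=\partial_t\gamma_+-\partial_t\gamma_-$ is trace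
free along $\Sigma$ (`trace_jump_eq_zero`).

Let $r$ be a $C^2$ version of $\max(t,0)$: $r=0$ for $t\le-h$, $r=t$ for $t\ge h$, $0\le r'\le1$ and
$|r''|\le 1/h$ (in fact $r''$ is a tent of height $1/h$ on $[-h,h]$). Put
$g_h(x,t)=g(x,t-r(t))+g(x,r(t))-g(x,0)$. Since $t-r\le0\le r$, each term sees one side only, so
$g_h$ is $C^2$. It equals $g$ for $|t|\ge h$, it is within $O(h)$ of $g$ on the strip, and it still
has the form $\gamma_h+dt^2$.

The only second derivative of $g_h$ without a bound uniform in $h$ is $r''\,dt^2\otimes J$ with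
$J=\partial_tg(x,r)-\partial_tg(x,t-r)$ (`smoothed_jet`). The scalar curvature is affine in the
second derivatives, and this term contributes exactly $-r''\,\mathrm{tr}_{g_h}J$
(`scalJet_add_smul`). Now $J=J_0+O(h)$ and $g_h=g(x,0)+O(h)$, while $J_0$ has trace zero with
respect to $g(x,0)$. So the trace is $O(h)$, which compensates $|r''|\le1/h$
(`exists_abs_scalJet_perturb_le`).

The rest is globalization. Two collar charts differ by a diffeomorphism of $\Sigma$ times the
identity in $t$ (`coordMetric_pt`), so the formula for $g_h$ means the same in all of them and no
partition of unity is needed. The scalar curvature is invariant under $C^3$ changes of coordinates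
(`coordScalar_pullback`), and by compactness of $\Sigma$ finitely many charts give uniform
constants. The scale is $h=\delta/2$. -/

noncomputable section

set_option linter.unusedSectionVars false
set_option maxSynthPendingDepth 3

namespace Corner

/-! ### Inner products, index raising and metric traces. -/

section LinearAlgebra

variable {E : Type*} [NormedAddCommGroup E] [NormedSpace ℝ E] [FiniteDimensional ℝ E]

/-- `A` is an inner product: symmetric and positive definite. -/
structure IsInner (A : E →L[ℝ] E →L[ℝ] ℝ) : Prop where
  symm : ∀ v w, A v w = A w v
  pos : ∀ v, v ≠ 0 → 0 < A v v

/-- A bilinear form without kernel on a finite dimensional space is invertible. -/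
theorem isInvertible_of_apply_self_ne_zero {A : E →L[ℝ] E →L[ℝ] ℝ}
    (hA : ∀ v, v ≠ 0 → A v v ≠ 0) : A.IsInvertible := by
  have hinj : Function.Injective A := by
    rw [injective_iff_map_eq_zero]
    intro v hv
    by_contra h
    exact hA v h (by rw [hv]; rfl)
  have hfr : Module.finrank ℝ E = Module.finrank ℝ (E →L[ℝ] ℝ) := by
    rw [← LinearEquiv.finrank_eq (LinearMap.toContinuousLinearMap (𝕜 := ℝ) (E := E) (F' := ℝ))]
    exact (Subspace.dual_finrank_eq (K := ℝ) (V := E)).symm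
  let e := LinearEquiv.ofInjectiveOfFinrankEq (A : E →ₗ[ℝ] E →L[ℝ] ℝ) hinj hfr
  refine ⟨e.toContinuousLinearEquiv, ?_⟩
  ext v w
  rfl

theorem IsInner.isInvertible {A : E →L[ℝ] E →L[ℝ] ℝ} (hA : IsInner A) : A.IsInvertible :=
  isInvertible_of_apply_self_ne_zero fun v hv ↦ (hA.pos v hv).ne'

theorem IsInner.inverse_symm {A : E →L[ℝ] E →L[ℝ] ℝ} (hA : IsInner A) (l m : E →L[ℝ] ℝ) :
    l (A.inverse m) = m (A.inverse l) := by
  conv_lhs => rw [← hA.isInvertible.self_apply_inverse l]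
  rw [hA.symm, hA.isInvertible.self_apply_inverse]

theorem IsInner.comp {A : E →L[ℝ] E →L[ℝ] ℝ} (hA : IsInner A) {F : Type*} [NormedAddCommGroup F]
    [NormedSpace ℝ F] {T : F →L[ℝ] E} (hT : Function.Injective T) :
    IsInner (A.bilinearComp T T) where
  symm _ _ := hA.symm _ _
  pos _ hv := hA.pos _ fun h ↦ hv (hT (h.trans (map_zero T).symm))

theorem sum_coord_eq_trace (f : E →ₗ[ℝ] E) :
    ∑ i, (Module.finBasis ℝ E).coord i (f (Module.finBasis ℝ E i)) = LinearMap.trace ℝ E f := by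
  rw [LinearMap.trace_eq_matrix_trace ℝ (Module.finBasis ℝ E), Matrix.trace]
  simp [LinearMap.toMatrix_apply]

/-- Symmetry of the inverse of `A` moves the coordinate functional to the outside, which leaves the
diagonal coefficients of the endomorphism $A^{-1}B$. The value is thus independent of the basis, and
later facts about traces reduce to `LinearMap.trace`. -/
theorem traceWrt_eq_trace {A : E →L[ℝ] E →L[ℝ] ℝ} (hA : IsInner A) (B : E →L[ℝ] E →L[ℝ] ℝ) :
    traceWrt A (fun u v ↦ B u v) = LinearMap.trace ℝ E (A.inverse ∘L B : E →L[ℝ] E) := by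
  rw [← sum_coord_eq_trace]
  unfold traceWrt
  refine Finset.sum_congr rfl fun i _ ↦ ?_
  exact hA.inverse_symm _ _

/-- Raising an index commutes with isomorphisms; consequently $A^{-1}B$ is only conjugated when both
forms are pulled back. -/
theorem inverse_bilinearComp {F : Type*} [NormedAddCommGroup F] [NormedSpace ℝ F]
    {A : E →L[ℝ] E →L[ℝ] ℝ} (hA : A.IsInvertible) (T : F ≃L[ℝ] E) (l : E →L[ℝ] ℝ) :
    (A.bilinearComp (T : F →L[ℝ] E) (T : F →L[ℝ] E)).inverse (l ∘L (T : F →L[ℝ] E)) =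
      T.symm (A.inverse l) := by
  have h1 : (A.bilinearComp (T : F →L[ℝ] E) (T : F →L[ℝ] E)).IsInvertible := by
    obtain ⟨e, rfl⟩ := hA
    refine ⟨(T.trans e).trans (T.symm.arrowCongr (ContinuousLinearEquiv.refl ℝ ℝ)), ?_⟩
    ext v w
    simp
  rw [h1.inverse_apply_eq]
  ext v
  simp [hA.self_apply_inverse]

/-- The trace of a bilinear form with respect to an inner product is natural. -/
theorem traceWrt_comp {F : Type*} [NormedAddCommGroup F] [NormedSpace ℝ F] [FiniteDimensional ℝ F]
    {A : E →L[ℝ] E →L[ℝ] ℝ} (hA : IsInner A)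
    (T : F ≃L[ℝ] E) (B : E →L[ℝ] E →L[ℝ] ℝ) :
    traceWrt (A.bilinearComp (T : F →L[ℝ] E) (T : F →L[ℝ] E)) (fun u v ↦ B (T u) (T v)) =
      traceWrt A (fun u v ↦ B u v) := by
  have h2 := traceWrt_eq_trace (hA.comp (T := (T : F →L[ℝ] E)) T.injective)
    (B.bilinearComp (T : F →L[ℝ] E) (T : F →L[ℝ] E))
  simp only [ContinuousLinearMap.bilinearComp_apply] at h2
  rw [traceWrt_eq_trace hA]
  refine Eq.trans h2 ?_
  rw [← LinearMap.trace_conj' _ (T.symm : E ≃L[ℝ] F).toLinearEquiv]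
  congr 1
  ext u
  have := inverse_bilinearComp hA.isInvertible T (B (T u))
  simp only [LinearEquiv.conj_apply]
  refine Eq.trans ?_ (this.trans ?_)
  · rfl
  · rfl

/-- The trace over a product, for a form and an inner product without mixed terms. -/
theorem traceWrt_prod {F : Type*} [NormedAddCommGroup F] [NormedSpace ℝ F] [FiniteDimensional ℝ F]
    {A : (F × ℝ) →L[ℝ] (F × ℝ) →L[ℝ] ℝ} (hA : IsInner A)
    {B : (F × ℝ) →L[ℝ] (F × ℝ) →L[ℝ] ℝ}
    (hAe : ∀ v, A (0, 1) v = v.2) (hB : ∀ v, B (0, 1) v = 0) (hB' : ∀ v, B v (0, 1) = 0) :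
    traceWrt A (fun u v ↦ B u v) =
      traceWrt (A.bilinearComp (ContinuousLinearMap.inl ℝ F ℝ) (ContinuousLinearMap.inl ℝ F ℝ))
        (fun u v ↦ B (u, 0) (v, 0)) := by
  set J := ContinuousLinearMap.inl ℝ F ℝ
  have hJ : Function.Injective J := fun a b h ↦ by simpa [J] using congrArg Prod.fst h
  have h2 := traceWrt_eq_trace (hA.comp hJ) (B.bilinearComp J J)
  simp only [ContinuousLinearMap.bilinearComp_apply] at h2
  rw [traceWrt_eq_trace hA]
  refine Eq.trans ?_ h2.symm
  -- The endomorphism $A^{-1}B$ is block diagonal and vanishes on the normal line, because the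
  -- splitting is orthogonal for `A` and `(0, 1)` is in the kernel of `B`.
  have key : ((A.inverse ∘L B : (F × ℝ) →L[ℝ] (F × ℝ)) : (F × ℝ) →ₗ[ℝ] (F × ℝ)) =
      LinearMap.prodMap ((((A.bilinearComp J J).inverse ∘L (B.bilinearComp J J) : F →L[ℝ] F)) :
        F →ₗ[ℝ] F) (0 : ℝ →ₗ[ℝ] ℝ) := by
    apply LinearMap.ext
    rintro ⟨u, a⟩
    have hBu : B (u, a) = B (u, 0) := by
      have : (u, a) = (u, 0) + a • ((0 : F), (1 : ℝ)) := by simp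
      rw [this, map_add, map_smul]
      ext v <;> simp [hB]
    change A.inverse (B (u, a)) = (((A.bilinearComp J J).inverse ((B.bilinearComp J J) u)), 0)
    rw [hA.isInvertible.inverse_apply_eq, hBu]
    set x := (A.bilinearComp J J).inverse ((B.bilinearComp J J) u) with hx
    have hx' := (hA.comp hJ).isInvertible.self_apply_inverse ((B.bilinearComp J J) u)
    rw [← hx] at hx'
    ext v
    · simpa [J] using (congrArg (fun l ↦ l v) hx').symm
    · simp only [ContinuousLinearMap.comp_apply, ContinuousLinearMap.inr_apply]
      rw [hB', hA.symm, hAe]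
  rw [key, LinearMap.trace_prodMap']
  simp

end LinearAlgebra

/-! ### Curvature as an algebraic function of the 2-jet of the metric. -/

section Jets

variable {E : Type*} [NormedAddCommGroup E] [NormedSpace ℝ E] [FiniteDimensional ℝ E]

/-- The right hand side of the Koszul formula, as a function of the first derivative of a metric. -/
def koszul (B : E →L[ℝ] E →L[ℝ] E →L[ℝ] ℝ) (u v : E) : E →L[ℝ] ℝ :=
  (1 / 2 : ℝ) • (B u v + B v u - (B.flip u).flip v)

theorem koszul_apply (B : E →L[ℝ] E →L[ℝ] E →L[ℝ] ℝ) (u v w : E) :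
    koszul B u v w = (1 / 2 : ℝ) * (B u v w + B v u w - B w u v) := by
  simp [koszul]

/-- The Christoffel symbols, as a function of the 1-jet of a metric. -/
def gammaJet (A : E →L[ℝ] E →L[ℝ] ℝ) (B : E →L[ℝ] E →L[ℝ] E →L[ℝ] ℝ) (u v : E) : E :=
  A.inverse (koszul B u v)

/-- The derivative of the Christoffel symbols, as a function of the 2-jet of a metric. -/
def dgammaJet (A : E →L[ℝ] E →L[ℝ] ℝ) (B : E →L[ℝ] E →L[ℝ] E →L[ℝ] ℝ)
    (C : E →L[ℝ] E →L[ℝ] E →L[ℝ] E →L[ℝ] ℝ) (a u v : E) : E :=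
  A.inverse (koszul (C a) u v - B a (gammaJet A B u v))

/-- The curvature tensor, as a function of the 2-jet of a metric. -/
def riemJet (A : E →L[ℝ] E →L[ℝ] ℝ) (B : E →L[ℝ] E →L[ℝ] E →L[ℝ] ℝ)
    (C : E →L[ℝ] E →L[ℝ] E →L[ℝ] E →L[ℝ] ℝ) (u v w : E) : E :=
  dgammaJet A B C u v w - dgammaJet A B C v u w
    + gammaJet A B u (gammaJet A B v w) - gammaJet A B v (gammaJet A B u w)

/-- The Ricci curvature, as a function of the 2-jet of a metric. -/
def ricJet (A : E →L[ℝ] E →L[ℝ] ℝ) (B : E →L[ℝ] E →L[ℝ] E →L[ℝ] ℝ)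
    (C : E →L[ℝ] E →L[ℝ] E →L[ℝ] E →L[ℝ] ℝ) (v w : E) : ℝ :=
  ∑ i, (Module.finBasis ℝ E).coord i (riemJet A B C (Module.finBasis ℝ E i) v w)

/-- The scalar curvature, as a function of the 2-jet of a metric. -/
def scalJet (A : E →L[ℝ] E →L[ℝ] ℝ) (B : E →L[ℝ] E →L[ℝ] E →L[ℝ] ℝ)
    (C : E →L[ℝ] E →L[ℝ] E →L[ℝ] E →L[ℝ] ℝ) : ℝ :=
  traceWrt A (ricJet A B C)

variable {A : E →L[ℝ] E →L[ℝ] ℝ} {B : E →L[ℝ] E →L[ℝ] E →L[ℝ] ℝ}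
  {C : E →L[ℝ] E →L[ℝ] E →L[ℝ] E →L[ℝ] ℝ}

theorem koszul_add_left (u u' v : E) : koszul B (u + u') v = koszul B u v + koszul B u' v := by
  ext w; simp only [koszul_apply, map_add, add_apply]; ring

theorem koszul_add_right (u v v' : E) : koszul B u (v + v') = koszul B u v + koszul B u v' := by
  ext w; simp only [koszul_apply, map_add, add_apply]; ring

theorem koszul_smul_left (c : ℝ) (u v : E) : koszul B (c • u) v = c • koszul B u v := by
  ext w
  simp only [koszul_apply, map_smul, smul_apply, smul_eq_mul]; ring

theorem koszul_smul_right (c : ℝ) (u v : E) : koszul B u (c • v) = c • koszul B u v := by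
  ext w
  simp only [koszul_apply, map_smul, smul_apply, smul_eq_mul]; ring

theorem koszul_add (B B' : E →L[ℝ] E →L[ℝ] E →L[ℝ] ℝ) (u v : E) :
    koszul (B + B') u v = koszul B u v + koszul B' u v := by
  ext w; simp only [koszul_apply, add_apply]; ring

theorem koszul_smul (c : ℝ) (B : E →L[ℝ] E →L[ℝ] E →L[ℝ] ℝ) (u v : E) :
    koszul (c • B) u v = c • koszul B u v := by
  ext w
  simp only [koszul_apply, smul_apply, smul_eq_mul]; ring

theorem gammaJet_add_left (u u' v : E) :
    gammaJet A B (u + u') v = gammaJet A B u v + gammaJet A B u' v := by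
  simp [gammaJet, koszul_add_left]

theorem gammaJet_add_right (u v v' : E) :
    gammaJet A B u (v + v') = gammaJet A B u v + gammaJet A B u v' := by
  simp [gammaJet, koszul_add_right]

theorem gammaJet_smul_left (c : ℝ) (u v : E) : gammaJet A B (c • u) v = c • gammaJet A B u v := by
  simp [gammaJet, koszul_smul_left]

theorem gammaJet_smul_right (c : ℝ) (u v : E) : gammaJet A B u (c • v) = c • gammaJet A B u v := by
  simp [gammaJet, koszul_smul_right]

/-- The curvature tensor as a trilinear map. -/
theorem riemJet_add_smul₁ (c : ℝ) (u u' v w : E) :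
    riemJet A B C (u + c • u') v w = riemJet A B C u v w + c • riemJet A B C u' v w := by
  simp only [riemJet, dgammaJet, map_add, map_smul, koszul_add, koszul_smul, koszul_add_left,
    koszul_smul_left, gammaJet_add_left, gammaJet_smul_left, gammaJet_add_right,
    gammaJet_smul_right, map_sub, add_apply, smul_apply]
  module

theorem riemJet_swap (u v w : E) : riemJet A B C u v w = -riemJet A B C v u w := by
  simp only [riemJet]; abel

theorem riemJet_add_smul₂ (c : ℝ) (u v v' w : E) :
    riemJet A B C u (v + c • v') w = riemJet A B C u v w + c • riemJet A B C u v' w := by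
  rw [riemJet_swap, riemJet_add_smul₁, riemJet_swap v, riemJet_swap v']; module

theorem riemJet_add_smul₃ (c : ℝ) (u v w w' : E) :
    riemJet A B C u v (w + c • w') = riemJet A B C u v w + c • riemJet A B C u v w' := by
  simp only [riemJet, dgammaJet, map_add, map_smul, koszul_add_right,
    koszul_smul_right, gammaJet_add_right, gammaJet_smul_right, map_sub]
  module

variable (A B C) in
/-- `u ↦ R(u, v) w` as a linear map. -/
def riemJetLin (v w : E) : E →ₗ[ℝ] E where
  toFun u := riemJet A B C u v w
  map_add' u u' := by simpa using riemJet_add_smul₁ (A := A) (B := B) (C := C) 1 u u' v w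
  map_smul' c u := by
    have h0 : riemJet A B C 0 v w = 0 := by
      simpa using riemJet_add_smul₁ (A := A) (B := B) (C := C) (-1) 0 0 v w
    simpa [h0] using riemJet_add_smul₁ (A := A) (B := B) (C := C) c 0 u v w

theorem ricJet_eq_trace (v w : E) :
    ricJet A B C v w = LinearMap.trace ℝ E (riemJetLin A B C v w) := by
  rw [← sum_coord_eq_trace]; rfl

variable (A B C) in
/-- The Ricci curvature as a bilinear form. -/
def ricJetBilin : E →L[ℝ] E →L[ℝ] ℝ :=
  LinearMap.toContinuousLinearMap
    (LinearMap.toContinuousLinearMap.toLinearMap ∘ₗ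
      { toFun := fun v ↦
          { toFun := fun w ↦ ricJet A B C v w
            map_add' := fun w w' ↦ by
              have := fun u ↦ riemJet_add_smul₃ (A := A) (B := B) (C := C) 1 u v w w'
              simp only [one_smul] at this
              simp only [ricJet, this, map_add, Finset.sum_add_distrib]
            map_smul' := fun c w ↦ by
              have h0 := fun u ↦ riemJet_add_smul₃ (A := A) (B := B) (C := C) (-1) u v 0 0
              have := fun u ↦ riemJet_add_smul₃ (A := A) (B := B) (C := C) c u v 0 w
              simp only [zero_add, smul_zero, neg_smul, one_smul, add_neg_cancel] at h0 this
              simp only [ricJet, this, h0, zero_add, map_smul, Finset.mul_sum, smul_eq_mul,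
                RingHom.id_apply] }
        map_add' := fun v v' ↦ by
          ext w
          have := fun u ↦ riemJet_add_smul₂ (A := A) (B := B) (C := C) 1 u v v' w
          simp only [one_smul] at this
          change ricJet A B C _ w = ricJet A B C _ w + ricJet A B C _ w
          simp only [ricJet, this, map_add, Finset.sum_add_distrib]
        map_smul' := fun c v ↦ by
          ext w
          have h0 := fun u ↦ riemJet_add_smul₂ (A := A) (B := B) (C := C) (-1) u 0 0 w
          have := fun u ↦ riemJet_add_smul₂ (A := A) (B := B) (C := C) c u 0 v w
          simp only [zero_add, smul_zero, neg_smul, one_smul, add_neg_cancel] at h0 this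
          change ricJet A B C _ w = c • ricJet A B C _ w
          simp only [ricJet, this, h0, zero_add, map_smul, Finset.mul_sum, smul_eq_mul] })

theorem ricJetBilin_apply (v w : E) : ricJetBilin A B C v w = ricJet A B C v w := rfl

/-! ### The curvature of a metric in terms of its 2-jet -/

variable {G : E → E →L[ℝ] E →L[ℝ] ℝ} {y : E}

theorem christoffelWithin_eq (s : Set E) (u v : E) :
    christoffelWithin G s y u v = gammaJet (G y) (fderivWithin ℝ G s y) u v := rfl

theorem christoffelWithin_univ (u v : E) :
    christoffelWithin G univ y u v = gammaJet (G y) (fderiv ℝ G y) u v := by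
  rw [christoffelWithin_eq, fderivWithin_univ]

/-- The map `B ↦ koszul B u v`. -/
def koszulL (u v : E) : (E →L[ℝ] E →L[ℝ] E →L[ℝ] ℝ) →L[ℝ] (E →L[ℝ] ℝ) :=
  LinearMap.toContinuousLinearMap
    { toFun := fun B ↦ koszul B u v
      map_add' := fun B B' ↦ koszul_add B B' u v
      map_smul' := fun c B ↦ koszul_smul c B u v }

/-- Differentiate the identity $A(A^{-1}l)=l$ by the product rule and solve for the unknown
derivative. Smoothness of inversion is used only for the existence of that derivative. -/
theorem hasFDerivAt_inverse_apply {A : E → E →L[ℝ] E →L[ℝ] ℝ} {A' : E →L[ℝ] E →L[ℝ] E →L[ℝ] ℝ}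
    {l : E → E →L[ℝ] ℝ} {l' : E →L[ℝ] E →L[ℝ] ℝ}
    (hA : HasFDerivAt A A' y) (hl : HasFDerivAt l l' y) (hinv : ∀ᶠ z in 𝓝 y, (A z).IsInvertible) :
    HasFDerivAt (fun z ↦ (A z).inverse (l z))
      ((A y).inverse ∘L (l' - A'.flip ((A y).inverse (l y)))) y := by
  have hy := hinv.self_of_nhds
  have h1 : DifferentiableAt ℝ (fun z ↦ (A z).inverse) y :=
    ((hy.contDiffAt_map_inverse (n := 1)).differentiableAt one_ne_zero).comp y hA.differentiableAt
  have h2 : DifferentiableAt ℝ (fun z ↦ (A z).inverse (l z)) y :=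
    h1.clm_apply hl.differentiableAt
  have h3 := hA.clm_apply h2.hasFDerivAt
  have h4 : (fun z ↦ A z ((A z).inverse (l z))) =ᶠ[𝓝 y] l :=
    hinv.mono fun z hz ↦ hz.self_apply_inverse _
  have h5 := (h3.congr_of_eventuallyEq h4.symm).unique hl
  convert h2.hasFDerivAt using 1
  ext a
  simp only [ContinuousLinearMap.comp_apply]
  rw [hy.inverse_apply_eq, ← h5]
  ext w
  simp

theorem hasFDerivAt_gamma (hG : ContDiffAt ℝ 2 G y) (hinv : ∀ᶠ z in 𝓝 y, (G z).IsInvertible)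
    (v w : E) : HasFDerivAt (fun z ↦ christoffelWithin G univ z v w)
      ((G y).inverse ∘L (koszulL v w ∘L fderiv ℝ (fderiv ℝ G) y -
        (fderiv ℝ G y).flip (gammaJet (G y) (fderiv ℝ G y) v w))) y := by
  simp only [christoffelWithin_univ]
  have h1 : HasFDerivAt G (fderiv ℝ G y) y := (hG.differentiableAt (by norm_num)).hasFDerivAt
  have h2 : HasFDerivAt (fderiv ℝ G) (fderiv ℝ (fderiv ℝ G) y) y :=
    ((hG.fderiv_right (m := 1) (by norm_num)).differentiableAt one_ne_zero).hasFDerivAt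
  exact hasFDerivAt_inverse_apply h1 ((koszulL v w).hasFDerivAt.comp y h2) hinv

theorem fderiv_gamma (hG : ContDiffAt ℝ 2 G y) (hinv : ∀ᶠ z in 𝓝 y, (G z).IsInvertible)
    (u v w : E) : fderiv ℝ (fun z ↦ christoffelWithin G univ z v w) y u =
      dgammaJet (G y) (fderiv ℝ G y) (fderiv ℝ (fderiv ℝ G) y) u v w := by
  rw [(hasFDerivAt_gamma hG hinv v w).fderiv]
  rfl

theorem riemann_eq_riemJet (hG : ContDiffAt ℝ 2 G y) (hinv : ∀ᶠ z in 𝓝 y, (G z).IsInvertible)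
    (u v w : E) : riemann G y u v w =
      riemJet (G y) (fderiv ℝ G y) (fderiv ℝ (fderiv ℝ G) y) u v w := by
  simp only [riemann]
  rw [fderiv_gamma hG hinv, fderiv_gamma hG hinv]
  simp only [riemJet, christoffelWithin_univ]

theorem ricci_eq_ricJet (hG : ContDiffAt ℝ 2 G y) (hinv : ∀ᶠ z in 𝓝 y, (G z).IsInvertible)
    (v w : E) : ricci G y v w =
      ricJet (G y) (fderiv ℝ G y) (fderiv ℝ (fderiv ℝ G) y) v w := by
  simp only [ricci, riemann_eq_riemJet hG hinv, ricJet]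

theorem coordScalar_eq_scalJet (hG : ContDiffAt ℝ 2 G y)
    (hinv : ∀ᶠ z in 𝓝 y, (G z).IsInvertible) :
    coordScalar G y = scalJet (G y) (fderiv ℝ G y) (fderiv ℝ (fderiv ℝ G) y) := by
  simp only [coordScalar, scalJet]
  congr 1
  ext v w
  exact ricci_eq_ricJet hG hinv v w

end Jets

/-! ### Invariance of the scalar curvature under changes of coordinates. -/

section Invariance

variable {E : Type*} [NormedAddCommGroup E] [NormedSpace ℝ E] [FiniteDimensional ℝ E]

section ChangeOfVariables

variable {G G' : E → E →L[ℝ] E →L[ℝ] ℝ} {ψ : E → E} {z : E}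

/-- The derivative of a pulled back metric. -/
theorem fderiv_pullback_apply (hψ : ContDiffAt ℝ 2 ψ z) (hG : DifferentiableAt ℝ G (ψ z))
    (h : G' =ᶠ[𝓝 z] fun x ↦ (G (ψ x)).bilinearComp (fderiv ℝ ψ x) (fderiv ℝ ψ x))
    (hd : DifferentiableAt ℝ G' z) (u v w : E) :
    fderiv ℝ G' z u v w =
      fderiv ℝ G (ψ z) (fderiv ℝ ψ z u) (fderiv ℝ ψ z v) (fderiv ℝ ψ z w) +
      G (ψ z) (fderiv ℝ (fderiv ℝ ψ) z u v) (fderiv ℝ ψ z w) +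
      G (ψ z) (fderiv ℝ ψ z v) (fderiv ℝ (fderiv ℝ ψ) z u w) := by
  have hP : HasFDerivAt (fderiv ℝ ψ) (fderiv ℝ (fderiv ℝ ψ) z) z :=
    ((hψ.fderiv_right (m := 1) (by norm_num)).differentiableAt one_ne_zero).hasFDerivAt
  have hGψ : HasFDerivAt (fun x ↦ G (ψ x)) (fderiv ℝ G (ψ z) ∘L fderiv ℝ ψ z) z :=
    hG.hasFDerivAt.comp z (hψ.differentiableAt (by norm_num)).hasFDerivAt
  have hPv := fun v : E ↦ hP.clm_apply (hasFDerivAt_const v z)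
  have h1 := (hGψ.clm_apply (hPv v)).clm_apply (hPv w)
  have h2 := (hd.hasFDerivAt.clm_apply (hasFDerivAt_const v z)).clm_apply (hasFDerivAt_const w z)
  have h3 : (fun x ↦ G' x v w) =ᶠ[𝓝 z] fun x ↦ G (ψ x) (fderiv ℝ ψ x v) (fderiv ℝ ψ x w) :=
    h.mono fun x hx ↦ congrArg (fun A ↦ A v w) hx
  have h4 := congrArg (fun l ↦ l u) ((h1.congr_of_eventuallyEq h3).unique h2)
  simp at h4
  linarith

/-- The transformation law of the Christoffel symbols. -/
theorem fderiv_christoffel_eq (hψ : ContDiffAt ℝ 2 ψ z) (hG : DifferentiableAt ℝ G (ψ z))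
    (hP : (fderiv ℝ ψ z).IsInvertible) (hGi : IsInner (G (ψ z)))
    (h : G' =ᶠ[𝓝 z] fun x ↦ (G (ψ x)).bilinearComp (fderiv ℝ ψ x) (fderiv ℝ ψ x))
    (hd : DifferentiableAt ℝ G' z) (v w : E) :
    fderiv ℝ ψ z (christoffelWithin G' univ z v w) =
      christoffelWithin G univ (ψ z) (fderiv ℝ ψ z v) (fderiv ℝ ψ z w) +
        fderiv ℝ (fderiv ℝ ψ) z v w := by
  have hQ : IsSymmSndFDerivAt ℝ ψ z := hψ.isSymmSndFDerivAt (by simp)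
  have hG'z : G' z = (G (ψ z)).bilinearComp (fderiv ℝ ψ z) (fderiv ℝ ψ z) := h.self_of_nhds
  have hG'i : IsInner (G' z) := hG'z ▸ hGi.comp hP.injective
  rw [christoffelWithin_univ, christoffelWithin_univ]
  -- Lower the index with `G` and test on vectors in the image of the derivative of `ψ`: both
  -- Christoffel terms become Koszul expressions and no inverse is left.
  apply hGi.isInvertible.injective
  ext a
  obtain ⟨a, rfl⟩ := hP.surjective a
  have h1 := congrArg (fun l ↦ l a)
    (hG'i.isInvertible.self_apply_inverse (koszul (fderiv ℝ G' z) v w))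
  have h2 := congrArg (fun l ↦ l (fderiv ℝ ψ z a))
    (hGi.isInvertible.self_apply_inverse
      (koszul (fderiv ℝ G (ψ z)) (fderiv ℝ ψ z v) (fderiv ℝ ψ z w)))
  rw [map_add, add_apply]
  simp only [koszul_apply, fderiv_pullback_apply hψ hG h hd] at h1 h2
  have h3 : G' z (gammaJet (G' z) (fderiv ℝ G' z) v w) a = G (ψ z)
      (fderiv ℝ ψ z (gammaJet (G' z) (fderiv ℝ G' z) v w)) (fderiv ℝ ψ z a) :=
    congrArg (fun A ↦ A (gammaJet (G' z) (fderiv ℝ G' z) v w) a) hG'z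
  rw [← h3]
  simp only [gammaJet]
  rw [h1, h2, hQ.eq w v, hQ.eq a v, hQ.eq a w,
    hGi.symm (fderiv ℝ ψ z w) (fderiv ℝ (fderiv ℝ ψ) z v a)]
  ring

/-- The transformation law of the derivatives of the Christoffel symbols. -/
theorem fderiv_dgamma_eq (hψ : ContDiffAt ℝ 3 ψ z) (hG : ContDiffAt ℝ 2 G (ψ z))
    (hP : (fderiv ℝ ψ z).IsInvertible) (hGi : ∀ᶠ y in 𝓝 (ψ z), IsInner (G y))
    (h : G' =ᶠ[𝓝 z] fun x ↦ (G (ψ x)).bilinearComp (fderiv ℝ ψ x) (fderiv ℝ ψ x))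
    (hd : ContDiffAt ℝ 2 G' z) (u v w : E) :
    fderiv ℝ ψ z (fderiv ℝ (fun x ↦ christoffelWithin G' univ x v w) z u) +
      fderiv ℝ (fderiv ℝ ψ) z u (christoffelWithin G' univ z v w) =
    dgammaJet (G (ψ z)) (fderiv ℝ G (ψ z)) (fderiv ℝ (fderiv ℝ G) (ψ z))
        (fderiv ℝ ψ z u) (fderiv ℝ ψ z v) (fderiv ℝ ψ z w) +
      christoffelWithin G univ (ψ z) (fderiv ℝ (fderiv ℝ ψ) z u v) (fderiv ℝ ψ z w) +
      christoffelWithin G univ (ψ z) (fderiv ℝ ψ z v) (fderiv ℝ (fderiv ℝ ψ) z u w) +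
      fderiv ℝ (fderiv ℝ (fderiv ℝ ψ)) z u v w := by
  have hψc : ContinuousAt ψ z := hψ.continuousAt
  have hP2 : ContDiffAt ℝ 2 (fderiv ℝ ψ) z := hψ.fderiv_right (by norm_num)
  have hPd : HasFDerivAt (fderiv ℝ ψ) (fderiv ℝ (fderiv ℝ ψ) z) z :=
    (hP2.differentiableAt (by norm_num)).hasFDerivAt
  have hQd : HasFDerivAt (fderiv ℝ (fderiv ℝ ψ)) (fderiv ℝ (fderiv ℝ (fderiv ℝ ψ)) z) z :=
    ((hP2.fderiv_right (m := 1) (by norm_num)).differentiableAt one_ne_zero).hasFDerivAt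
  have hPinv : ∀ᶠ x in 𝓝 z, (fderiv ℝ ψ x).IsInvertible := by
    obtain ⟨e, he⟩ := hP
    have := e.nhds
    rw [he] at this
    exact (hP2.continuousAt.eventually_mem this)
  have hψe : ∀ᶠ x in 𝓝 z, ContDiffAt ℝ 3 ψ x := hψ.eventually (by simp)
  have hGe : ∀ᶠ y in 𝓝 (ψ z), ContDiffAt ℝ 2 G y := hG.eventually (by simp)
  have hde : ∀ᶠ x in 𝓝 z, ContDiffAt ℝ 2 G' x := hd.eventually (by simp)
  have hΓ' : ∀ᶠ x in 𝓝 z, (G' x).IsInvertible := by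
    filter_upwards [h, hψc.eventually hGi, hPinv] with x hx hi hp
    rw [hx]
    exact (hi.comp hp.injective).isInvertible
  have hev : ∀ᶠ x in 𝓝 z, fderiv ℝ ψ x (christoffelWithin G' univ x v w) =
      christoffelWithin G univ (ψ x) (fderiv ℝ ψ x v) (fderiv ℝ ψ x w) +
        fderiv ℝ (fderiv ℝ ψ) x v w := by
    filter_upwards [h.eventuallyEq_nhds, hψc.eventually hGi, hPinv, hψe, hψc.eventually hGe, hde]
      with x hx hi hp hψx hGx hdx
    exact fderiv_christoffel_eq (hψx.of_le (by norm_num)) (hGx.differentiableAt (by norm_num))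
      hp hi hx (hdx.differentiableAt (by norm_num)) v w
  have hz := hev.self_of_nhds
  have hiz : IsInner (G (ψ z)) := hGi.self_of_nhds
  set Γ' := fun x ↦ christoffelWithin G' univ x v w with hΓ'def
  have hΓd : HasFDerivAt Γ' (fderiv ℝ Γ' z) z :=
    (hasFDerivAt_gamma hd hΓ' v w).differentiableAt.hasFDerivAt
  have hψd : HasFDerivAt ψ (fderiv ℝ ψ z) z := (hψ.differentiableAt (by norm_num)).hasFDerivAt
  have hGψ : HasFDerivAt (fun x ↦ G (ψ x)) (fderiv ℝ G (ψ z) ∘L fderiv ℝ ψ z) z :=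
    (hG.differentiableAt (by norm_num)).hasFDerivAt.comp z hψd
  have hDGψ : HasFDerivAt (fun x ↦ fderiv ℝ G (ψ x))
      (fderiv ℝ (fderiv ℝ G) (ψ z) ∘L fderiv ℝ ψ z) z :=
    ((hG.fderiv_right (m := 1) (by norm_num)).differentiableAt one_ne_zero).hasFDerivAt.comp z hψd
  have hPv := fun v : E ↦ hPd.clm_apply (hasFDerivAt_const v z)
  have hL := (hPd.clm_apply hΓd).sub
    ((hQd.clm_apply (hasFDerivAt_const v z)).clm_apply (hasFDerivAt_const w z))
  -- The term with the third derivative of `ψ` is moved to the left, where it belongs to the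
  -- derivative of $D\psi(\Gamma')-D^2\psi(v,w)$.
  suffices hs : fderiv ℝ ψ z (fderiv ℝ Γ' z u) + fderiv ℝ (fderiv ℝ ψ) z u (Γ' z) -
      fderiv ℝ (fderiv ℝ (fderiv ℝ ψ)) z u v w =
      dgammaJet (G (ψ z)) (fderiv ℝ G (ψ z)) (fderiv ℝ (fderiv ℝ G) (ψ z))
        (fderiv ℝ ψ z u) (fderiv ℝ ψ z v) (fderiv ℝ ψ z w) +
      christoffelWithin G univ (ψ z) (fderiv ℝ (fderiv ℝ ψ) z u v) (fderiv ℝ ψ z w) +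
      christoffelWithin G univ (ψ z) (fderiv ℝ ψ z v) (fderiv ℝ (fderiv ℝ ψ) z u w) from
    sub_eq_iff_eq_add.1 hs
  rw [christoffelWithin_univ, christoffelWithin_univ, dgammaJet, gammaJet, gammaJet, gammaJet, ← map_add,
    ← map_add, eq_comm, hiz.isInvertible.inverse_apply_eq]
  ext a
  have hR := ((hDGψ.clm_apply (hPv v)).clm_apply (hPv w)).clm_apply (hasFDerivAt_const a z)
  have hR2 := ((hDGψ.clm_apply (hPv w)).clm_apply (hPv v)).clm_apply (hasFDerivAt_const a z)
  have hR3 := ((hDGψ.clm_apply (hasFDerivAt_const a z)).clm_apply (hPv v)).clm_apply (hPv w)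
  have hRR := ((hR.add hR2).sub hR3).const_mul (1 / 2 : ℝ)
  have hLL := (hGψ.clm_apply hL).clm_apply (hasFDerivAt_const a z)
  -- The transformation law for the Christoffel symbols near `z`, with the inverse of `G` cleared.
  -- Both sides are polynomial in the jets, so the product rule alone computes their derivatives.
  have hee : (fun x ↦ G (ψ x) (fderiv ℝ ψ x (Γ' x) - fderiv ℝ (fderiv ℝ ψ) x v w) a) =ᶠ[𝓝 z]
      fun x ↦ (1 / 2 : ℝ) * (fderiv ℝ G (ψ x) (fderiv ℝ ψ x v) (fderiv ℝ ψ x w) a +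
        fderiv ℝ G (ψ x) (fderiv ℝ ψ x w) (fderiv ℝ ψ x v) a -
        fderiv ℝ G (ψ x) a (fderiv ℝ ψ x v) (fderiv ℝ ψ x w)) := by
    filter_upwards [hev, hψc.eventually hGi] with x hx hi
    rw [hx, add_sub_cancel_right, christoffelWithin_univ, gammaJet,
      hi.isInvertible.self_apply_inverse, koszul_apply]
  have hfin := congrArg (fun l ↦ l u) ((hRR.congr_of_eventuallyEq hee).unique hLL)
  have hY : fderiv ℝ ψ z (Γ' z) - fderiv ℝ (fderiv ℝ ψ) z v w =
      (G (ψ z)).inverse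
        (koszul (fderiv ℝ G (ψ z)) (fderiv ℝ ψ z v) (fderiv ℝ ψ z w)) := by
    rw [hz, add_sub_cancel_right, christoffelWithin_univ, gammaJet]
  simp [hY] at hfin
  simp only [add_apply, sub_apply, koszul_apply, map_add, map_sub]
  linarith

/-- Antisymmetrize the previous law in `u` and `v`. The third derivative of `ψ` drops out by its
symmetry, which is where class $C^3$ enters, and the terms with second derivatives cancel against
those coming from the products of Christoffel symbols. -/
theorem fderiv_riemann_eq (hψ : ContDiffAt ℝ 3 ψ z) (hG : ContDiffAt ℝ 2 G (ψ z))
    (hP : (fderiv ℝ ψ z).IsInvertible) (hGi : ∀ᶠ y in 𝓝 (ψ z), IsInner (G y))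
    (h : G' =ᶠ[𝓝 z] fun x ↦ (G (ψ x)).bilinearComp (fderiv ℝ ψ x) (fderiv ℝ ψ x))
    (hd : ContDiffAt ℝ 2 G' z) (u v w : E) :
    fderiv ℝ ψ z (riemann G' z u v w) =
      riemann G (ψ z) (fderiv ℝ ψ z u) (fderiv ℝ ψ z v) (fderiv ℝ ψ z w) := by
  have hQ : IsSymmSndFDerivAt ℝ ψ z :=
    (hψ.of_le (by norm_num : (2 : WithTop ℕ∞) ≤ 3)).isSymmSndFDerivAt (by simp)
  have hR : IsSymmSndFDerivAt ℝ (fderiv ℝ ψ) z :=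
    (hψ.fderiv_right (m := 2) (by norm_num)).isSymmSndFDerivAt (by simp)
  have hR' : fderiv ℝ (fderiv ℝ (fderiv ℝ ψ)) z u v w = fderiv ℝ (fderiv ℝ (fderiv ℝ ψ)) z v u w :=
    congrArg (fun l ↦ l w) (hR.eq u v)
  have h1 := fderiv_dgamma_eq hψ hG hP hGi h hd u v w
  have h2 := fderiv_dgamma_eq hψ hG hP hGi h hd v u w
  have hg := fderiv_christoffel_eq (hψ.of_le (by norm_num)) (hG.differentiableAt (by norm_num))
      hP hGi.self_of_nhds h (hd.differentiableAt (by norm_num))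
  rw [riemann_eq_riemJet hG (hGi.mono fun _ h ↦ h.isInvertible)]
  simp only [riemann, map_add, map_sub, riemJet]
  rw [hg u (christoffelWithin G' univ z v w), hg v (christoffelWithin G' univ z u w), hg v w,
    hg u w]
  rw [hQ.eq v u, hR'.symm] at h2
  simp only [christoffelWithin_univ, gammaJet_add_right] at h1 h2 ⊢
  rw [← sub_eq_zero] at h1 h2 ⊢
  refine Eq.trans ?_ ((congrArg₂ (· - ·) h1 h2).trans (sub_zero 0))
  abel

/-- The scalar curvature does not depend on the coordinates. -/
theorem coordScalar_pullback (hψ : ContDiffAt ℝ 3 ψ z) (hG : ContDiffAt ℝ 2 G (ψ z))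
    (hP : (fderiv ℝ ψ z).IsInvertible) (hGi : ∀ᶠ y in 𝓝 (ψ z), IsInner (G y))
    (h : G' =ᶠ[𝓝 z] fun x ↦ (G (ψ x)).bilinearComp (fderiv ℝ ψ x) (fderiv ℝ ψ x))
    (hd : ContDiffAt ℝ 2 G' z) : coordScalar G' z = coordScalar G (ψ z) := by
  obtain ⟨T, hT⟩ := id hP
  have hTv : ∀ v, fderiv ℝ ψ z v = T v := fun v ↦ by rw [← hT]; rfl
  have hinv := hGi.mono fun _ h ↦ h.isInvertible
  have hG'z : G' z = (G (ψ z)).bilinearComp (fderiv ℝ ψ z) (fderiv ℝ ψ z) := h.self_of_nhds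
  -- By covariance of the curvature tensor, the endomorphisms $u\mapsto R(u,v)w$ of the two metrics
  -- are conjugate by `T`, so their traces agree.
  have hricci : ∀ v w, ricci G' z v w = ricci G (ψ z) (T v) (T w) := by
    intro v w
    rw [ricci_eq_ricJet hG hinv, ricJet_eq_trace,
      ← LinearMap.trace_conj' _ T.symm.toLinearEquiv, ← sum_coord_eq_trace]
    unfold ricci
    refine Finset.sum_congr rfl fun i _ ↦ congrArg _ ?_
    apply T.injective
    rw [← hTv, fderiv_riemann_eq hψ hG hP hGi h hd, riemann_eq_riemJet hG hinv,
      LinearEquiv.conj_apply]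
    simp only [hTv]
    exact (T.apply_symm_apply _).symm
  have h1 := traceWrt_comp hGi.self_of_nhds T
    (ricJetBilin (G (ψ z)) (fderiv ℝ G (ψ z)) (fderiv ℝ (fderiv ℝ G) (ψ z)))
  simp only [ricJetBilin_apply, ← ricci_eq_ricJet hG hinv, ← hricci, hT, ← hG'z] at h1
  exact h1

end ChangeOfVariables

end Invariance

/-! ### Quantitative dependence of the scalar curvature on the 2-jet. -/

section JetEstimates

variable {E : Type*} [NormedAddCommGroup E] [NormedSpace ℝ E] [FiniteDimensional ℝ E]

/-! ### Coercive forms -/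

/-- Evaluate $Ax=l$ on $x$ itself: $c\|x\|^2\le l(x)\le\|l\|\,\|x\|$. -/
theorem norm_inverse_apply_le {A : E →L[ℝ] E →L[ℝ] ℝ} {c : ℝ} (hc : 0 < c)
    (hA : ∀ v, c * ‖v‖ ^ 2 ≤ A v v) (l : E →L[ℝ] ℝ) : ‖A.inverse l‖ ≤ ‖l‖ / c := by
  have hinv : A.IsInvertible := isInvertible_of_apply_self_ne_zero fun v hv ↦
    (lt_of_lt_of_le (by positivity) (hA v)).ne'
  set x := A.inverse l with hx
  have h1 : A x x = l x := by rw [hx, hinv.self_apply_inverse]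
  have h2 : l x ≤ ‖l‖ * ‖x‖ := (le_abs_self _).trans (l.le_opNorm x)
  have h3 := hA x
  rw [le_div_iff₀ hc]
  by_cases h0 : ‖x‖ = 0
  · rw [h0]; simp
  · have : 0 < ‖x‖ := lt_of_le_of_ne (norm_nonneg _) (Ne.symm h0)
    nlinarith

/-- Resolvent identity $A^{-1}-A_0^{-1}=A^{-1}(A_0-A)A_0^{-1}$. -/
theorem norm_inverse_sub_inverse_le {A A₀ : E →L[ℝ] E →L[ℝ] ℝ} {c : ℝ} (hc : 0 < c)
    (hA : ∀ v, c * ‖v‖ ^ 2 ≤ A v v) (hA₀ : ∀ v, c * ‖v‖ ^ 2 ≤ A₀ v v) (l : E →L[ℝ] ℝ) :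
    ‖A.inverse l - A₀.inverse l‖ ≤ ‖A - A₀‖ * (‖l‖ / c) / c := by
  have hinv : A.IsInvertible := isInvertible_of_apply_self_ne_zero fun v hv ↦
    (lt_of_lt_of_le (by positivity) (hA v)).ne'
  have hinv₀ : A₀.IsInvertible := isInvertible_of_apply_self_ne_zero fun v hv ↦
    (lt_of_lt_of_le (by positivity) (hA₀ v)).ne'
  have h1 : A.inverse l - A₀.inverse l = A.inverse ((A₀ - A) (A₀.inverse l)) := by
    rw [sub_apply, hinv₀.self_apply_inverse, map_sub, hinv.inverse_apply_self]
  rw [h1]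
  refine (norm_inverse_apply_le hc hA _).trans ?_
  gcongr
  refine ((A₀ - A).le_opNorm _).trans ?_
  rw [norm_sub_rev]
  gcongr
  exact norm_inverse_apply_le hc hA₀ l

variable (E) in
/-- The sum of the norms of a basis and of the dual basis, a bound for traces. -/
def traceConst : ℝ := ∑ i, ‖Module.finBasis ℝ E i‖ *
  ‖LinearMap.toContinuousLinearMap ((Module.finBasis ℝ E).coord i)‖

/-- The trace is Lipschitz in the pair (inner product, form) on uniformly coercive inner products,
so near a pair with vanishing trace it is small of first order. This is what beats the factor $1/h$
later. -/
theorem abs_traceWrt_le {A A₀ h h₀ : E →L[ℝ] E →L[ℝ] ℝ} {c : ℝ} (hc : 0 < c)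
    (hA : ∀ v, c * ‖v‖ ^ 2 ≤ A v v) (hA₀ : ∀ v, c * ‖v‖ ^ 2 ≤ A₀ v v)
    (h0 : traceWrt A₀ (fun u v ↦ h₀ u v) = 0) :
    |traceWrt A (fun u v ↦ h u v)| ≤
      traceConst E * (‖h - h₀‖ / c + ‖h₀‖ * (‖A - A₀‖ / c / c)) := by
  rw [← sub_zero (traceWrt A _), ← h0]
  unfold traceWrt traceConst
  rw [← Finset.sum_sub_distrib, Finset.sum_mul]
  refine (Finset.abs_sum_le_sum_abs _ _).trans (Finset.sum_le_sum fun i _ ↦ ?_)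
  set b := Module.finBasis ℝ E i
  set l := LinearMap.toContinuousLinearMap ((Module.finBasis ℝ E).coord i)
  have h1 : h b (A.inverse l) - h₀ b (A₀.inverse l) =
      (h - h₀) b (A.inverse l) + h₀ b (A.inverse l - A₀.inverse l) := by
    simp
  rw [h1]
  refine (abs_add_le _ _).trans ?_
  have h2 := ((h - h₀).le_opNorm₂ b (A.inverse l)).trans
    (mul_le_mul_of_nonneg_left (norm_inverse_apply_le hc hA l) (by positivity))
  have h3 := (h₀.le_opNorm₂ b (A.inverse l - A₀.inverse l)).trans
    (mul_le_mul_of_nonneg_left (norm_inverse_sub_inverse_le hc hA hA₀ l) (by positivity))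
  rw [Real.norm_eq_abs] at h2 h3
  refine (add_le_add h2 h3).trans (le_of_eq ?_)
  ring

/-! ### The dependence of the scalar curvature on the 2-jet -/

theorem norm_koszul_le (B : E →L[ℝ] E →L[ℝ] E →L[ℝ] ℝ) (u v : E) :
    ‖koszul B u v‖ ≤ 2 * (‖B‖ * ‖u‖ * ‖v‖) := by
  refine ContinuousLinearMap.opNorm_le_bound _ (by positivity) fun w ↦ ?_
  have hB : ∀ a b c, |B a b c| ≤ ‖B‖ * ‖a‖ * ‖b‖ * ‖c‖ := fun a b c ↦
    ((B a b).le_opNorm c).trans (by gcongr; exact B.le_opNorm₂ a b)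
  rw [koszul_apply, Real.norm_eq_abs, abs_le]
  have h1 := abs_le.1 (hB u v w)
  have h2 := abs_le.1 (hB v u w)
  have h3 := abs_le.1 (hB w u v)
  have h4 : 0 ≤ ‖B‖ * ‖u‖ * ‖v‖ * ‖w‖ := by positivity
  have e2 : ‖B‖ * ‖v‖ * ‖u‖ * ‖w‖ = ‖B‖ * ‖u‖ * ‖v‖ * ‖w‖ := by ring
  have e3 : ‖B‖ * ‖w‖ * ‖u‖ * ‖v‖ = ‖B‖ * ‖u‖ * ‖v‖ * ‖w‖ := by ring
  rw [e2] at h2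
  rw [e3] at h3
  constructor <;> linarith [h1.1, h1.2, h2.1, h2.2, h3.1, h3.2]

/-- The scalar curvature is bounded in terms of bounds for the 2-jet of the metric. -/
theorem exists_abs_scalJet_le {c : ℝ} (hc : 0 < c) (R : ℝ) : ∃ K : ℝ,
    ∀ (A : E →L[ℝ] E →L[ℝ] ℝ) (B : E →L[ℝ] E →L[ℝ] E →L[ℝ] ℝ)
      (C : E →L[ℝ] E →L[ℝ] E →L[ℝ] E →L[ℝ] ℝ), (∀ v, c * ‖v‖ ^ 2 ≤ A v v) →
      ‖B‖ ≤ R → ‖C‖ ≤ R → |scalJet A B C| ≤ K := by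
  -- The constants `q`, `r`, `m` bound the Christoffel symbols, their derivative and the curvature
  -- tensor as multilinear maps; the four summands of `m` match the four terms of `riemJet`.
  set q := 2 * R / c with hq
  set r := (2 * R + R * q) / c with hr
  set m := r + r + q * q + q * q with hm
  refine ⟨∑ i, (∑ i', ‖LinearMap.toContinuousLinearMap ((Module.finBasis ℝ E).coord i')‖ *
    (m * ‖Module.finBasis ℝ E i'‖ * ‖Module.finBasis ℝ E i‖ *
      (‖LinearMap.toContinuousLinearMap ((Module.finBasis ℝ E).coord i)‖ / c))),
    fun A B C hA hB hC ↦ ?_⟩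
  have hR : 0 ≤ R := (norm_nonneg B).trans hB
  have hq0 : 0 ≤ q := by positivity
  have hr0 : 0 ≤ r := by positivity
  have hg : ∀ u v, ‖gammaJet A B u v‖ ≤ q * ‖u‖ * ‖v‖ := fun u v ↦ by
    refine (norm_inverse_apply_le hc hA _).trans ?_
    have : q * ‖u‖ * ‖v‖ = 2 * (R * ‖u‖ * ‖v‖) / c := by rw [hq]; ring
    rw [this]
    gcongr
    exact (norm_koszul_le B u v).trans (by gcongr)
  have hdg : ∀ a u v, ‖dgammaJet A B C a u v‖ ≤ r * ‖a‖ * ‖u‖ * ‖v‖ := fun a u v ↦ by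
    refine (norm_inverse_apply_le hc hA _).trans ?_
    have : r * ‖a‖ * ‖u‖ * ‖v‖ =
      (2 * (R * ‖a‖ * ‖u‖ * ‖v‖) + R * ‖a‖ * (q * ‖u‖ * ‖v‖)) / c := by rw [hr]; ring
    rw [this]
    gcongr
    refine (norm_sub_le _ _).trans (add_le_add ?_ ?_)
    · refine (norm_koszul_le _ u v).trans ?_
      gcongr
      exact (C.le_opNorm a).trans (by gcongr)
    · refine (B.le_opNorm₂ a _).trans ?_
      gcongr
      exact hg u v
  have hgg : ∀ u v w, ‖gammaJet A B u (gammaJet A B v w)‖ ≤ q * q * ‖u‖ * ‖v‖ * ‖w‖ :=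
    fun u v w ↦ by
      refine (hg _ _).trans ?_
      have : q * q * ‖u‖ * ‖v‖ * ‖w‖ = q * ‖u‖ * (q * ‖v‖ * ‖w‖) := by ring
      rw [this]
      gcongr
      exact hg v w
  have hriem : ∀ u v w, ‖riemJet A B C u v w‖ ≤ m * ‖u‖ * ‖v‖ * ‖w‖ := fun u v w ↦ by
    refine (norm_sub_le _ _).trans ((add_le_add ((norm_add_le _ _).trans
      (add_le_add ((norm_sub_le _ _).trans (add_le_add (hdg u v w) (hdg v u w))) (hgg u v w)))
      (hgg v u w)).trans (le_of_eq ?_))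
    rw [hm]
    ring
  simp only [scalJet, traceWrt, ricJet]
  refine (Finset.abs_sum_le_sum_abs _ _).trans (Finset.sum_le_sum fun i _ ↦ ?_)
  refine (Finset.abs_sum_le_sum_abs _ _).trans (Finset.sum_le_sum fun i' _ ↦ ?_)
  refine ((LinearMap.toContinuousLinearMap ((Module.finBasis ℝ E).coord i')).le_opNorm _).trans ?_
  gcongr
  refine (hriem _ _ _).trans ?_
  have hm0 : 0 ≤ m := by positivity
  gcongr
  exact norm_inverse_apply_le hc hA _

/-- `D²G = dt² ⊗ h` contributes `-tr h` to the scalar curvature of a metric for which `dt` is dual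
to a unit vector in the kernel of `h`. -/
theorem scalJet_add_smul {A : E →L[ℝ] E →L[ℝ] ℝ} (hA : IsInner A)
    (B : E →L[ℝ] E →L[ℝ] E →L[ℝ] ℝ) (C : E →L[ℝ] E →L[ℝ] E →L[ℝ] E →L[ℝ] ℝ)
    {τ : E →L[ℝ] ℝ} {e : E} (he : A e = τ) (hτ : τ e = 1) {h : E →L[ℝ] E →L[ℝ] ℝ}
    (hh : ∀ v w, h v w = h w v) (hhe : h e = 0) {C' : E →L[ℝ] E →L[ℝ] E →L[ℝ] E →L[ℝ] ℝ} (b : ℝ)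
    (hC' : ∀ u v w z, C' u v w z = C u v w z + b * (τ u * τ v * h w z)) :
    scalJet A B C' = scalJet A B C - b * traceWrt A (fun u v ↦ h u v) := by
  have hinve : A.inverse τ = e := hA.isInvertible.inverse_apply_eq.2 he.symm
  have hve : ∀ v, h v e = 0 := fun v ↦ by rw [hh, hhe]; rfl
  have hdg : ∀ u v w, dgammaJet A B C' u v w = dgammaJet A B C u v w + (b * (1 / 2)) •
      ((τ u * τ v) • A.inverse (h w) + (τ u * τ w) • A.inverse (h v) - (τ u * h v w) • e) := by
    intro u v w
    have h1 : koszul (C' u) v w = koszul (C u) v w + (b * (1 / 2)) •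
        ((τ u * τ v) • h w + (τ u * τ w) • h v - (τ u * h v w) • τ) := by
      ext z
      simp only [koszul_apply, hC', add_apply, sub_apply, smul_apply, smul_eq_mul]
      ring
    simp only [dgammaJet]
    rw [h1]
    simp only [map_add, map_sub, map_smul, hinve]
    abel
  have hriem : ∀ u v w, riemJet A B C' u v w = riemJet A B C u v w + (b * (1 / 2)) •
      ((τ u * τ w) • A.inverse (h v) - (τ u * h v w) • e - (τ v * τ w) • A.inverse (h u)
        + (τ v * h u w) • e) := by
    intro u v w
    simp only [riemJet, hdg]
    module
  set t := traceWrt A (fun u v ↦ h u v) with ht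
  rw [traceWrt_eq_trace hA] at ht
  have hτA : ∀ v, τ (A.inverse (h v)) = 0 := fun v ↦ by
    rw [hA.inverse_symm, hinve, hve]
  have hric : ∀ v w, ricJet A B C' v w =
      ricJet A B C v w + (b * (1 / 2)) * (-h v w - τ v * τ w * t) := by
    intro v w
    -- As an endomorphism in `u`, the change of the curvature is a sum of rank-one maps and a
    -- multiple of $A^{-1}h$. The rank-one traces are $\tau(A^{-1}h(v))=0$, $\tau(e)=1$ and
    -- $h(w,e)=0$; the last endomorphism has trace `t`.
    have h2 : riemJetLin A B C' v w = riemJetLin A B C v w + (b * (1 / 2)) •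
        (τ w • (τ : E →ₗ[ℝ] ℝ).smulRight (A.inverse (h v)) -
          (h v w) • (τ : E →ₗ[ℝ] ℝ).smulRight e -
          (τ v * τ w) • ((A.inverse ∘L h : E →L[ℝ] E) : E →ₗ[ℝ] E)
          + τ v • ((h w : E →L[ℝ] ℝ) : E →ₗ[ℝ] ℝ).smulRight e) := by
      ext u
      have := hriem u v w
      rw [hh u w] at this
      refine Eq.trans this ?_
      simp only [LinearMap.add_apply, LinearMap.sub_apply, LinearMap.smul_apply,
        LinearMap.smulRight_apply, ContinuousLinearMap.coe_coe, ContinuousLinearMap.comp_apply]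
      change riemJet A B C u v w + _ = riemJet A B C u v w + _
      module
    rw [ricJet_eq_trace, ricJet_eq_trace, h2]
    simp only [map_add, map_smul, map_sub, LinearMap.trace_smulRight, ContinuousLinearMap.coe_coe,
      hτA, hτ, hve, smul_eq_mul, ← ht]
    ring
  -- The form $\tau\otimes\tau$ has trace $\tau(e)=1$. The two parts $-h$ and $-t\,\tau\otimes\tau$
  -- of the change of the Ricci form thus contribute $-t$ each, which absorbs the factor one half.
  have h3 : traceWrt A (fun u v ↦ (τ.smulRight τ : E →L[ℝ] E →L[ℝ] ℝ) u v) = 1 := by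
    rw [traceWrt_eq_trace hA]
    have : ((A.inverse ∘L (τ.smulRight τ : E →L[ℝ] E →L[ℝ] ℝ) : E →L[ℝ] E) : E →ₗ[ℝ] E) =
        (τ : E →ₗ[ℝ] ℝ).smulRight e := by
      ext u
      simp [hinve]
    rw [this, LinearMap.trace_smulRight]
    exact hτ
  have h4 : t = ∑ i, h (Module.finBasis ℝ E i)
    (A.inverse (LinearMap.toContinuousLinearMap ((Module.finBasis ℝ E).coord i))) := by
    rw [ht, ← traceWrt_eq_trace hA]; rfl
  unfold scalJet
  simp only [traceWrt, hric, Finset.sum_add_distrib, ← Finset.mul_sum, Finset.sum_sub_distrib,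
    Finset.sum_neg_distrib, ← Finset.sum_mul] at h3 ⊢
  rw [← h4]
  simp only [ContinuousLinearMap.smulRight_apply, smul_apply, smul_eq_mul] at h3
  rw [h3]
  ring

end JetEstimates

/-! ### A `C²` approximation of the positive part -/

section Ramp

/-- Only the origin needs an argument: there the function is $O(|x|^{n+2})$ with exponent at least
two, so its derivative vanishes. -/
theorem hasDerivAt_max_zero_pow (n : ℕ) (x : ℝ) :
    HasDerivAt (fun x : ℝ ↦ (max x 0) ^ (n + 2)) ((n + 2 : ℝ) * (max x 0) ^ (n + 1)) x := by
  rcases lt_trichotomy x 0 with h | rfl | h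
  · rw [max_eq_right h.le]
    simp only [ne_eq, Nat.add_eq_zero_iff, one_ne_zero, and_false, not_false_eq_true, zero_pow,
      mul_zero]
    refine (hasDerivAt_const x (0 : ℝ)).congr_of_eventuallyEq ?_
    filter_upwards [Iio_mem_nhds h] with y hy
    rw [max_eq_right (le_of_lt hy)]
    simp
  · simp only [max_self, ne_eq, Nat.add_eq_zero_iff, one_ne_zero, and_false, not_false_eq_true,
      zero_pow, mul_zero]
    have : (fun x : ℝ ↦ (max x 0) ^ (n + 2)) =O[𝓝 0] fun x ↦ ‖x - 0‖ ^ (n + 2) := by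
      refine Asymptotics.isBigO_of_le _ fun y ↦ ?_
      rw [norm_pow, norm_pow, norm_norm, sub_zero]
      gcongr
      rw [Real.norm_eq_abs, Real.norm_eq_abs, abs_of_nonneg (le_max_right _ _)]
      exact max_le (le_abs_self y) (abs_nonneg y)
    have h := this.hasFDerivAt (𝕜 := ℝ) (by omega)
    exact h.hasDerivAt.congr_deriv rfl
  · rw [max_eq_left h.le]
    have h1 := hasDerivAt_pow (n + 2) x
    push_cast at h1
    refine HasDerivAt.congr_of_eventuallyEq h1 ?_
    filter_upwards [Ioi_mem_nhds h] with y hy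
    rw [max_eq_left (le_of_lt hy)]

/-- A `C²` function which is `0` on `(-∞, -h]` and the identity on `[h, ∞)`. -/
def ramp (h t : ℝ) : ℝ :=
  ((max (t + h) 0) ^ 3 - 2 * (max t 0) ^ 3 + (max (t - h) 0) ^ 3) / (6 * h ^ 2)

/-- The first derivative of `ramp`. -/
def ramp' (h t : ℝ) : ℝ :=
  ((max (t + h) 0) ^ 2 - 2 * (max t 0) ^ 2 + (max (t - h) 0) ^ 2) / (2 * h ^ 2)

/-- The second derivative of `ramp`. -/
def ramp'' (h t : ℝ) : ℝ :=
  (max (t + h) 0 - 2 * max t 0 + max (t - h) 0) / h ^ 2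

variable {h : ℝ}

theorem hasDerivAt_ramp (h t : ℝ) : HasDerivAt (ramp h) (ramp' h t) t := by
  have hp := hasDerivAt_max_zero_pow 1
  have h1 := (hp (t + h)).comp_add_const t h
  have h2 := (hp (t - h)).comp_sub_const t h
  have := ((h1.sub ((hp t).const_mul 2)).add h2).div_const (6 * h ^ 2)
  refine this.congr_deriv ?_
  unfold ramp'
  rcases eq_or_ne h 0 with rfl | hh
  · simp
  · field_simp
    norm_num
    ring

theorem hasDerivAt_ramp' (h t : ℝ) : HasDerivAt (ramp' h) (ramp'' h t) t := by
  have hp := hasDerivAt_max_zero_pow 0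
  have h1 := (hp (t + h)).comp_add_const t h
  have h2 := (hp (t - h)).comp_sub_const t h
  have := ((h1.sub ((hp t).const_mul 2)).add h2).div_const (2 * h ^ 2)
  refine this.congr_deriv ?_
  unfold ramp''
  rcases eq_or_ne h 0 with rfl | hh
  · simp
  · field_simp
    norm_num

theorem continuous_ramp'' (h : ℝ) : Continuous (ramp'' h) := by
  unfold ramp''; fun_prop

theorem contDiff_ramp (h : ℝ) : ContDiff ℝ 2 (ramp h) := by
  have e1 : deriv (ramp h) = ramp' h := funext fun t ↦ (hasDerivAt_ramp h t).deriv
  have e2 : deriv (ramp' h) = ramp'' h := funext fun t ↦ (hasDerivAt_ramp' h t).deriv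
  rw [show (2 : WithTop ℕ∞) = 1 + 1 by norm_num, contDiff_succ_iff_deriv]
  refine ⟨fun t ↦ (hasDerivAt_ramp h t).differentiableAt, by simp, ?_⟩
  rw [e1, contDiff_one_iff_deriv, e2]
  exact ⟨fun t ↦ (hasDerivAt_ramp' h t).differentiableAt, continuous_ramp'' h⟩

theorem ramp_of_le (hh : 0 < h) {t : ℝ} (ht : t ≤ -h) : ramp h t = 0 := by
  unfold ramp
  rw [max_eq_right (by linarith), max_eq_right (by linarith), max_eq_right (by linarith)]
  simp

theorem ramp_of_ge (hh : 0 < h) {t : ℝ} (ht : h ≤ t) : ramp h t = t := by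
  unfold ramp
  rw [max_eq_left (by linarith), max_eq_left (by linarith), max_eq_left (by linarith)]
  field_simp
  ring

theorem ramp'_nonneg (h t : ℝ) (hh : 0 < h) : 0 ≤ ramp' h t := by
  unfold ramp'
  apply div_nonneg _ (by positivity)
  rcases le_total 0 (t + h) with h1 | h1 <;> rcases le_total 0 t with h2 | h2 <;>
    rcases le_total 0 (t - h) with h3 | h3 <;>
    simp only [max_eq_left, max_eq_right, h1, h2, h3] <;> nlinarith

theorem ramp'_le_one (h t : ℝ) (hh : 0 < h) : ramp' h t ≤ 1 := by
  unfold ramp'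
  rw [div_le_one (by positivity)]
  rcases le_total 0 (t + h) with h1 | h1 <;> rcases le_total 0 t with h2 | h2 <;>
    rcases le_total 0 (t - h) with h3 | h3 <;>
    simp only [max_eq_left, max_eq_right, h1, h2, h3] <;> nlinarith

theorem abs_ramp''_le (h t : ℝ) (hh : 0 < h) : |ramp'' h t| ≤ 1 / h := by
  have h0 : |max (t + h) 0 - 2 * max t 0 + max (t - h) 0| ≤ h := by
    rw [abs_le]
    rcases le_total 0 (t + h) with h1 | h1 <;> rcases le_total 0 t with h2 | h2 <;>
      rcases le_total 0 (t - h) with h3 | h3 <;>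
      simp only [max_eq_left, max_eq_right, h1, h2, h3] <;> constructor <;> linarith
  unfold ramp''
  rw [abs_div, abs_of_pos (by positivity : 0 < h ^ 2)]
  calc _ ≤ h / h ^ 2 := by gcongr
    _ = 1 / h := by field_simp

theorem monotone_ramp (hh : 0 < h) : Monotone (ramp h) :=
  monotone_of_deriv_nonneg (fun t ↦ (hasDerivAt_ramp h t).differentiableAt) fun t ↦ by
    rw [(hasDerivAt_ramp h t).deriv]; exact ramp'_nonneg h t hh

/-- Monotonicity of `ramp` and of its difference with the identity, combined with the exact values
at $\pm h$, yields all the order relations below. They place $t-r(t)$ on the negative and $r(t)$ on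
the positive side. -/
theorem monotone_sub_ramp (hh : 0 < h) : Monotone fun t ↦ t - ramp h t := by
  have hd : ∀ t, HasDerivAt (fun t ↦ t - ramp h t) (1 - ramp' h t) t := fun t ↦
    (hasDerivAt_id t).sub (hasDerivAt_ramp h t)
  exact monotone_of_deriv_nonneg (fun t ↦ (hd t).differentiableAt) fun t ↦ by
    rw [(hd t).deriv]; linarith [ramp'_le_one h t hh]

theorem ramp_nonneg (hh : 0 < h) (t : ℝ) : 0 ≤ ramp h t := by
  rcases le_total t (-h) with ht | ht
  · rw [ramp_of_le hh ht]
  · rw [← ramp_of_le hh le_rfl]; exact monotone_ramp hh ht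

theorem sub_ramp_nonpos (hh : 0 < h) (t : ℝ) : t - ramp h t ≤ 0 := by
  rcases le_total t h with ht | ht
  · have := monotone_sub_ramp hh ht
    simp only [ramp_of_ge hh le_rfl, sub_self] at this
    exact this
  · rw [ramp_of_ge hh ht, sub_self]

theorem ramp_le (hh : 0 < h) {t : ℝ} (ht : t ≤ h) : ramp h t ≤ h := by
  have := monotone_ramp hh ht
  rwa [ramp_of_ge hh le_rfl] at this

theorem neg_le_sub_ramp (hh : 0 < h) {t : ℝ} (ht : -h ≤ t) : -h ≤ t - ramp h t := by
  have := monotone_sub_ramp hh ht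
  simpa [ramp_of_le hh le_rfl] using this

/-- With `lt_sub_ramp`, this keeps both reparametrized times inside the collar when
$h<2\varepsilon$. -/
theorem ramp_lt {r t : ℝ} (hh : 0 < h) (hr : h < r) (ht : t < r) : ramp h t < r := by
  rcases le_total t h with h1 | h1
  · exact (ramp_le hh h1).trans_lt hr
  · rwa [ramp_of_ge hh h1]

theorem lt_sub_ramp {r t : ℝ} (hh : 0 < h) (hr : h < r) (ht : -r < t) : -r < t - ramp h t := by
  rcases le_total (-h) t with h1 | h1
  · exact lt_of_lt_of_le (by linarith) (neg_le_sub_ramp hh h1)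
  · rwa [ramp_of_le hh h1, sub_zero]

end Ramp

/-! ### Reparametrization of the last variable -/

section Reparametrization

variable {F : Type*} [NormedAddCommGroup F] [NormedSpace ℝ F]
  {W : Type*} [NormedAddCommGroup W] [NormedSpace ℝ W]

/-- The map `(y, t) ↦ (y, s t)`, linear. -/
def scaleSnd (F : Type*) [NormedAddCommGroup F] [NormedSpace ℝ F] (s : ℝ) :
    (F × ℝ) →L[ℝ] (F × ℝ) :=
  (ContinuousLinearMap.fst ℝ F ℝ).prod (s • ContinuousLinearMap.snd ℝ F ℝ)

theorem scaleSnd_apply (s : ℝ) (v : F × ℝ) : scaleSnd F s v = (v.1, s * v.2) := rfl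

theorem norm_scaleSnd_le {s : ℝ} (hs : |s| ≤ 1) : ‖scaleSnd F s‖ ≤ 1 := by
  refine ContinuousLinearMap.opNorm_le_bound _ zero_le_one fun v ↦ ?_
  rw [scaleSnd_apply, one_mul, Prod.norm_def, Prod.norm_def, norm_mul]
  refine max_le_max le_rfl ?_
  rw [Real.norm_eq_abs s]
  exact mul_le_of_le_one_left (norm_nonneg _) hs

variable {f : F × ℝ → W} {V : Set F} {I : Set ℝ} {a a' : ℝ → ℝ} {y : F} {t a'' : ℝ}

/-- Differentiability of `f` within one side suffices: the reparametrized point stays on that side,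
so the chain rule produces a genuine two-sided derivative. -/
theorem hasFDerivAt_reparam (hV : IsOpen V) (hf : ContDiffOn ℝ 2 f (V ×ˢ I)) (hy : y ∈ V)
    (ha : HasDerivAt a (a' t) t) (haI : ∀ᶠ s in 𝓝 t, a s ∈ I) :
    HasFDerivAt (fun z : F × ℝ ↦ f (z.1, a z.2))
      (fderivWithin ℝ f (V ×ˢ I) (y, a t) ∘L scaleSnd F (a' t)) (y, t) := by
  have h1 : HasFDerivWithinAt f (fderivWithin ℝ f (V ×ˢ I) (y, a t)) (V ×ˢ I) (y, a t) :=
    ((hf (y, a t) ⟨hy, haI.self_of_nhds⟩).differentiableWithinAt (by norm_num)).hasFDerivWithinAt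
  have h2 : HasFDerivAt (fun z : F × ℝ ↦ (z.1, a z.2)) (scaleSnd F (a' t)) (y, t) := by
    refine hasFDerivAt_fst.prodMk ?_
    exact ha.comp_hasFDerivAt (y, t) hasFDerivAt_snd
  refine HasFDerivWithinAt.comp_hasFDerivAt (y, t) h1 h2 ?_
  filter_upwards [prod_mem_nhds (hV.mem_nhds hy) haI] with z hz
  exact ⟨hz.1, hz.2⟩

/-- The second derivative of `f (y, a t)`. -/
theorem fderiv_fderiv_reparam (hV : IsOpen V) (hI : UniqueDiffOn ℝ I)
    (hf : ContDiffOn ℝ 2 f (V ×ˢ I)) (hy : y ∈ V)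
    (ha : ∀ s, HasDerivAt a (a' s) s) (ha' : HasDerivAt a' a'' t)
    (haI : ∀ᶠ s in 𝓝 t, a s ∈ I) :
    HasFDerivAt (fderiv ℝ (fun z : F × ℝ ↦ f (z.1, a z.2)))
      (fderiv ℝ (fderiv ℝ (fun z : F × ℝ ↦ f (z.1, a z.2))) (y, t)) (y, t) ∧
    ∀ u v, fderiv ℝ (fderiv ℝ (fun z : F × ℝ ↦ f (z.1, a z.2))) (y, t) u v =
      fderivWithin ℝ (fderivWithin ℝ f (V ×ˢ I)) (V ×ˢ I) (y, a t)
        (scaleSnd F (a' t) u) (scaleSnd F (a' t) v) +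
      (a'' * (u.2 * v.2)) • fderivWithin ℝ f (V ×ˢ I) (y, a t) (0, 1) := by
  have hVI : UniqueDiffOn ℝ (V ×ˢ I) := hV.uniqueDiffOn.prod hI
  have hf' : ContDiffOn ℝ 1 (fderivWithin ℝ f (V ×ˢ I)) (V ×ˢ I) :=
    hf.fderivWithin hVI (by norm_num)
  have h1 : HasFDerivWithinAt (fderivWithin ℝ f (V ×ˢ I))
      (fderivWithin ℝ (fderivWithin ℝ f (V ×ˢ I)) (V ×ˢ I) (y, a t)) (V ×ˢ I) (y, a t) :=
    ((hf' (y, a t) ⟨hy, haI.self_of_nhds⟩).differentiableWithinAt one_ne_zero).hasFDerivWithinAt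
  have h2 : HasFDerivAt (fun z : F × ℝ ↦ (z.1, a z.2)) (scaleSnd F (a' t)) (y, t) :=
    hasFDerivAt_fst.prodMk ((ha t).comp_hasFDerivAt (y, t) hasFDerivAt_snd)
  have h3 : HasFDerivAt (fun z : F × ℝ ↦ fderivWithin ℝ f (V ×ˢ I) (z.1, a z.2))
      (fderivWithin ℝ (fderivWithin ℝ f (V ×ˢ I)) (V ×ˢ I) (y, a t) ∘L scaleSnd F (a' t))
      (y, t) := by
    refine HasFDerivWithinAt.comp_hasFDerivAt (y, t) h1 h2 ?_
    filter_upwards [prod_mem_nhds (hV.mem_nhds hy) haI] with z hz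
    exact ⟨hz.1, hz.2⟩
  have hs : HasFDerivAt (fun z : F × ℝ ↦ a' z.2) (a'' • ContinuousLinearMap.snd ℝ F ℝ) (y, t) :=
    ha'.comp_hasFDerivAt (y, t) hasFDerivAt_snd
  have h4 : HasFDerivAt (fun z : F × ℝ ↦ scaleSnd F (a' z.2))
      ((a'' • ContinuousLinearMap.snd ℝ F ℝ).smulRight
        ((ContinuousLinearMap.inr ℝ F ℝ) ∘L ContinuousLinearMap.snd ℝ F ℝ)) (y, t) := by
    -- The map `scaleSnd F s` is affine in `s`, with value `scaleSnd F 0` at zero and slope the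
    -- projection to the last variable.
    have h5 := (hs.smul_const ((ContinuousLinearMap.inr ℝ F ℝ) ∘L
      ContinuousLinearMap.snd ℝ F ℝ)).add_const (scaleSnd F 0)
    refine h5.congr_of_eventuallyEq (Filter.Eventually.of_forall fun z ↦ ?_)
    ext v <;> simp [scaleSnd]
  have h6 := h3.clm_comp h4
  have h7 : fderiv ℝ (fun z : F × ℝ ↦ f (z.1, a z.2)) =ᶠ[𝓝 (y, t)]
      fun z ↦ fderivWithin ℝ f (V ×ˢ I) (z.1, a z.2) ∘L scaleSnd F (a' z.2) := by
    filter_upwards [prod_mem_nhds (hV.mem_nhds hy) haI.eventually_nhds] with z hz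
    exact (hasFDerivAt_reparam hV hf hz.1 (ha z.2) hz.2).fderiv
  have h8 := h6.congr_of_eventuallyEq h7
  refine ⟨h8.differentiableAt.hasFDerivAt, fun u v ↦ ?_⟩
  rw [h8.fderiv]
  simp only [add_apply, ContinuousLinearMap.comp_apply, ContinuousLinearMap.compL_apply,
    ContinuousLinearMap.flip_apply, ContinuousLinearMap.smulRight_apply, smul_apply]
  rw [add_comm]
  congr 1
  have : ((ContinuousLinearMap.inr ℝ F ℝ) ((ContinuousLinearMap.snd ℝ F ℝ) v) : F × ℝ) =
    v.2 • ((0 : F), (1 : ℝ)) := by simp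
  rw [map_smul, this, map_smul, smul_smul]
  congr 1
  simp
  ring

end Reparametrization

/-! ### Bounds on compact sets -/

section Bounds

variable {F : Type*} [NormedAddCommGroup F] [NormedSpace ℝ F] [FiniteDimensional ℝ F]
  {W : Type*} [NormedAddCommGroup W] [NormedSpace ℝ W]

/-- Bounds for the derivatives of a `C²` function on a compact convex set. -/
theorem exists_bounds {E : Type*} [NormedAddCommGroup E] [NormedSpace ℝ E]
    {f : E → W} {s K : Set E} (hs : UniqueDiffOn ℝ s) (hf : ContDiffOn ℝ 2 f s)
    (hK : IsCompact K) (hKc : Convex ℝ K) (hKs : K ⊆ s) :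
    ∃ R : ℝ, 0 ≤ R ∧ (∀ z ∈ K, ‖fderivWithin ℝ f s z‖ ≤ R) ∧
      (∀ z ∈ K, ‖fderivWithin ℝ (fderivWithin ℝ f s) s z‖ ≤ R) ∧
      (∀ z ∈ K, ∀ z' ∈ K, ‖f z - f z'‖ ≤ R * ‖z - z'‖) ∧
      (∀ z ∈ K, ∀ z' ∈ K, ‖fderivWithin ℝ f s z - fderivWithin ℝ f s z'‖ ≤ R * ‖z - z'‖) := by
  have hf' : ContDiffOn ℝ 1 (fderivWithin ℝ f s) s := hf.fderivWithin hs (by norm_num)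
  have hf'' : ContDiffOn ℝ 0 (fderivWithin ℝ (fderivWithin ℝ f s) s) s :=
    hf'.fderivWithin hs (by norm_num)
  obtain ⟨R₁, h1⟩ := hK.exists_bound_of_continuousOn (hf'.continuousOn.mono hKs)
  obtain ⟨R₂, h2⟩ := hK.exists_bound_of_continuousOn (hf''.continuousOn.mono hKs)
  have h1' : ∀ z ∈ K, ‖fderivWithin ℝ f s z‖ ≤ max 0 (max R₁ R₂) := fun z hz ↦
    (h1 z hz).trans ((le_max_left _ _).trans (le_max_right _ _))
  have h2' : ∀ z ∈ K, ‖fderivWithin ℝ (fderivWithin ℝ f s) s z‖ ≤ max 0 (max R₁ R₂) :=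
    fun z hz ↦ (h2 z hz).trans ((le_max_right _ _).trans (le_max_right _ _))
  -- The maximum with zero keeps the constant nonnegative even for empty `K`; convexity turns the
  -- derivative bounds into Lipschitz bounds.
  refine ⟨max 0 (max R₁ R₂), le_max_left _ _, h1', h2', fun z hz z' hz' ↦ ?_, fun z hz z' hz' ↦ ?_⟩
  · exact hKc.norm_image_sub_le_of_norm_hasFDerivWithin_le (fun x hx ↦
      ((hf x (hKs hx)).differentiableWithinAt (by norm_num)).hasFDerivWithinAt.mono hKs) h1' hz' hz
  · exact hKc.norm_image_sub_le_of_norm_hasFDerivWithin_le (fun x hx ↦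
      ((hf' x (hKs hx)).differentiableWithinAt one_ne_zero).hasFDerivWithinAt.mono hKs) h2' hz' hz

/-- A continuous family of inner products is uniformly coercive on compact sets. -/
theorem exists_coercive {X E : Type*} [TopologicalSpace X] [NormedAddCommGroup E] [NormedSpace ℝ E]
    [FiniteDimensional ℝ E] {A : X → E →L[ℝ] E →L[ℝ] ℝ} {K : Set X} (hK : IsCompact K)
    (hA : ContinuousOn A K) (hpos : ∀ x ∈ K, IsInner (A x)) :
    ∃ c : ℝ, 0 < c ∧ ∀ x ∈ K, ∀ v, c * ‖v‖ ^ 2 ≤ A x v v := by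
  have := FiniteDimensional.proper ℝ E
  have hc : ContinuousOn (fun p : X × E ↦ A p.1 p.2 p.2) (K ×ˢ Metric.sphere 0 1) :=
    ((hA.comp continuousOn_fst fun p hp ↦ hp.1).clm_apply continuousOn_snd).clm_apply
      continuousOn_snd
  have hcp := hK.prod (isCompact_sphere (0 : E) 1)
  -- The coercivity constant is the minimum of the quadratic form on `K` times the unit sphere; if
  -- this set is empty, any positive number will do.
  obtain ⟨c, hc0, hcb⟩ : ∃ c : ℝ, 0 < c ∧ ∀ p ∈ K ×ˢ Metric.sphere (0 : E) 1, c ≤ A p.1 p.2 p.2 := by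
    rcases (K ×ˢ Metric.sphere (0 : E) 1).eq_empty_or_nonempty with he | hne
    · exact ⟨1, one_pos, by simp [he]⟩
    · obtain ⟨p, hp, hmin⟩ := hcp.exists_isMinOn hne hc
      refine ⟨A p.1 p.2 p.2, (hpos p.1 hp.1).pos _ ?_, fun q hq ↦ hmin hq⟩
      intro h0
      have h1 := hp.2
      simp [h0] at h1
  refine ⟨c, hc0, fun x hx v ↦ ?_⟩
  rcases eq_or_ne v 0 with rfl | hv
  · simp
  · have hv' : ‖v‖ ≠ 0 := norm_ne_zero_iff.2 hv
    have h1 := hcb (x, ‖v‖⁻¹ • v) ⟨hx, by simp [norm_smul, hv']⟩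
    simp only [map_smul, smul_apply, smul_eq_mul] at h1
    calc c * ‖v‖ ^ 2 ≤ (‖v‖⁻¹ * (‖v‖⁻¹ * A x v v)) * ‖v‖ ^ 2 := by gcongr
      _ = A x v v := by field_simp

end Bounds

/-! ### Smoothing a metric with a corner in coordinates -/

section Smoothing

variable {F : Type*} [NormedAddCommGroup F] [NormedSpace ℝ F] [FiniteDimensional ℝ F]

/-- A metric `γ(y, t) + dt²` on `V × (-2ε, 2ε)` with a corner along `V × {0}`, in coordinates; the
two mean curvatures of `V × {0}` agree. -/
structure IsCollarMetric (ε : ℝ) (V : Set F) (G : F × ℝ → (F × ℝ) →L[ℝ] (F × ℝ) →L[ℝ] ℝ) :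
    Prop where
  ε_pos : 0 < ε
  isOpen : IsOpen V
  contDiffOn_neg : ContDiffOn ℝ 2 G (V ×ˢ Ioc (-(2 * ε)) 0)
  contDiffOn_pos : ContDiffOn ℝ 2 G (V ×ˢ Ico 0 (2 * ε))
  isInner : ∀ y ∈ V, ∀ t ∈ Ioo (-(2 * ε)) (2 * ε), IsInner (G (y, t))
  apply_normal : ∀ y ∈ V, ∀ t ∈ Ioo (-(2 * ε)) (2 * ε), ∀ v, G (y, t) (0, 1) v = v.2
  trace_eq : ∀ y ∈ V, traceWrt (G (y, 0)) (fun u v ↦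
    (fderivWithin ℝ G (V ×ˢ Ico 0 (2 * ε)) (y, 0) (0, 1) -
      fderivWithin ℝ G (V ×ˢ Ioc (-(2 * ε)) 0) (y, 0) (0, 1)) u v) = 0

/-- The smoothing of `G` at scale `h`. -/
def smoothed (h : ℝ) (G : F × ℝ → (F × ℝ) →L[ℝ] (F × ℝ) →L[ℝ] ℝ) (z : F × ℝ) :
    (F × ℝ) →L[ℝ] (F × ℝ) →L[ℝ] ℝ :=
  G (z.1, z.2 - ramp h z.2) + G (z.1, ramp h z.2) - G (z.1, 0)

namespace IsCollarMetric

variable {ε h : ℝ} {V : Set F} {G : F × ℝ → (F × ℝ) →L[ℝ] (F × ℝ) →L[ℝ] ℝ}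

/-- Each term is a one-sided $C^2$ function composed with a $C^2$ map into that side. The term at
time zero may be taken from either side. -/
theorem contDiffOn_smoothed (hG : IsCollarMetric ε V G) (hh : 0 < h) (hε : h < 2 * ε) :
    ContDiffOn ℝ 2 (smoothed h G) (V ×ˢ Ioo (-(2 * ε)) (2 * ε)) := by
  have hε0 := hG.ε_pos
  have hr : ContDiffOn ℝ 2 (fun z : F × ℝ ↦ ramp h z.2) (V ×ˢ Ioo (-(2 * ε)) (2 * ε)) :=
    ((contDiff_ramp h).comp contDiff_snd).contDiffOn
  refine ((hG.contDiffOn_neg.comp (contDiffOn_fst.prodMk (contDiffOn_snd.sub hr))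
    fun z hz ↦ ⟨hz.1, lt_sub_ramp hh hε hz.2.1, sub_ramp_nonpos hh _⟩).add
    (hG.contDiffOn_pos.comp (contDiffOn_fst.prodMk hr)
    fun z hz ↦ ⟨hz.1, ramp_nonneg hh _, ramp_lt hh hε hz.2.2⟩)).sub
    (hG.contDiffOn_neg.comp (contDiffOn_fst.prodMk contDiffOn_const)
    fun z hz ↦ ⟨hz.1, by simpa using hε0, le_rfl⟩)

/-- Halving the collar to $[-\varepsilon,\varepsilon]$ makes both time intervals compact; one pair
of constants is then chosen for the two sides together. -/
theorem exists_bounds (hG : IsCollarMetric ε V G) {K : Set F} (hK : IsCompact K)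
    (hKc : Convex ℝ K) (hKV : K ⊆ V) :
    ∃ R c : ℝ, 0 ≤ R ∧ 0 < c ∧
      (∀ y ∈ K, ∀ t ∈ Icc (-ε) 0,
        ‖fderivWithin ℝ G (V ×ˢ Ioc (-(2 * ε)) 0) (y, t)‖ ≤ R ∧
        ‖fderivWithin ℝ (fderivWithin ℝ G (V ×ˢ Ioc (-(2 * ε)) 0)) (V ×ˢ Ioc (-(2 * ε)) 0)
          (y, t)‖ ≤ R ∧ (∀ v, c * ‖v‖ ^ 2 ≤ G (y, t) v v) ∧
        ∀ t' ∈ Icc (-ε) 0, ‖G (y, t) - G (y, t')‖ ≤ R * |t - t'| ∧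
          ‖fderivWithin ℝ G (V ×ˢ Ioc (-(2 * ε)) 0) (y, t) -
            fderivWithin ℝ G (V ×ˢ Ioc (-(2 * ε)) 0) (y, t')‖ ≤ R * |t - t'|) ∧
      (∀ y ∈ K, ∀ t ∈ Icc 0 ε,
        ‖fderivWithin ℝ G (V ×ˢ Ico 0 (2 * ε)) (y, t)‖ ≤ R ∧
        ‖fderivWithin ℝ (fderivWithin ℝ G (V ×ˢ Ico 0 (2 * ε))) (V ×ˢ Ico 0 (2 * ε))
          (y, t)‖ ≤ R ∧ (∀ v, c * ‖v‖ ^ 2 ≤ G (y, t) v v) ∧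
        ∀ t' ∈ Icc 0 ε, ‖G (y, t) - G (y, t')‖ ≤ R * |t - t'| ∧
          ‖fderivWithin ℝ G (V ×ˢ Ico 0 (2 * ε)) (y, t) -
            fderivWithin ℝ G (V ×ˢ Ico 0 (2 * ε)) (y, t')‖ ≤ R * |t - t'|) := by
  have hε0 := hG.ε_pos
  have key : ∀ I J : Set ℝ, UniqueDiffOn ℝ I → IsCompact J → Convex ℝ J → J ⊆ I →
      I ⊆ Ioo (-(2 * ε)) (2 * ε) → ContDiffOn ℝ 2 G (V ×ˢ I) →
      ∃ R c : ℝ, 0 ≤ R ∧ 0 < c ∧ ∀ y ∈ K, ∀ t ∈ J,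
        ‖fderivWithin ℝ G (V ×ˢ I) (y, t)‖ ≤ R ∧
        ‖fderivWithin ℝ (fderivWithin ℝ G (V ×ˢ I)) (V ×ˢ I) (y, t)‖ ≤ R ∧
        (∀ v, c * ‖v‖ ^ 2 ≤ G (y, t) v v) ∧
        ∀ t' ∈ J, ‖G (y, t) - G (y, t')‖ ≤ R * |t - t'| ∧
          ‖fderivWithin ℝ G (V ×ˢ I) (y, t) - fderivWithin ℝ G (V ×ˢ I) (y, t')‖ ≤
            R * |t - t'| := by
    intro I J hI hJ hJc hJI hIo hd
    have hsub : K ×ˢ J ⊆ V ×ˢ I := prod_mono hKV hJI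
    obtain ⟨R, hR, h1, h2, h3, h4⟩ := Corner.exists_bounds (hG.isOpen.uniqueDiffOn.prod hI) hd
      (hK.prod hJ) (hKc.prod hJc) hsub
    obtain ⟨c, hc, h5⟩ := exists_coercive (hK.prod hJ) (hd.continuousOn.mono hsub)
      fun z hz ↦ hG.isInner z.1 (hKV hz.1) z.2 (hIo (hJI hz.2))
    refine ⟨R, c, hR, hc, fun y hy t ht ↦ ⟨h1 _ ⟨hy, ht⟩, h2 _ ⟨hy, ht⟩, h5 _ ⟨hy, ht⟩,
      fun t' ht' ↦ ?_⟩⟩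
    have hn : ‖((y, t) : F × ℝ) - (y, t')‖ = |t - t'| := by simp [Prod.norm_def]
    rw [← hn]
    exact ⟨h3 _ ⟨hy, ht⟩ _ ⟨hy, ht'⟩, h4 _ ⟨hy, ht⟩ _ ⟨hy, ht'⟩⟩
  obtain ⟨R, c, hR, hc, hm⟩ := key (Ioc (-(2 * ε)) 0) (Icc (-ε) 0) (uniqueDiffOn_Ioc _ _)
    isCompact_Icc (convex_Icc _ _) (fun t ht ↦ ⟨by linarith [ht.1], ht.2⟩)
    (fun t ht ↦ ⟨ht.1, by linarith [ht.2]⟩) hG.contDiffOn_neg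
  obtain ⟨R', c', hR', hc', hp⟩ := key (Ico 0 (2 * ε)) (Icc 0 ε) (uniqueDiffOn_Ico _ _)
    isCompact_Icc (convex_Icc _ _) (fun t ht ↦ ⟨ht.1, by linarith [ht.2]⟩)
    (fun t ht ↦ ⟨by linarith [ht.1], ht.2⟩) hG.contDiffOn_pos
  refine ⟨max R R', min c c', le_max_of_le_left hR, lt_min hc hc', fun y hy t ht ↦ ?_,
    fun y hy t ht ↦ ?_⟩
  · obtain ⟨h1, h2, h3, h4⟩ := hm y hy t ht
    exact ⟨h1.trans (le_max_left _ _), h2.trans (le_max_left _ _), fun v ↦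
      (mul_le_mul_of_nonneg_right (min_le_left _ _) (by positivity)).trans (h3 v), fun t' ht' ↦
      ⟨(h4 t' ht').1.trans (mul_le_mul_of_nonneg_right (le_max_left _ _) (abs_nonneg _)),
      (h4 t' ht').2.trans (mul_le_mul_of_nonneg_right (le_max_left _ _) (abs_nonneg _))⟩⟩
  · obtain ⟨h1, h2, h3, h4⟩ := hp y hy t ht
    exact ⟨h1.trans (le_max_right _ _), h2.trans (le_max_right _ _), fun v ↦
      (mul_le_mul_of_nonneg_right (min_le_right _ _) (by positivity)).trans (h3 v), fun t' ht' ↦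
      ⟨(h4 t' ht').1.trans (mul_le_mul_of_nonneg_right (le_max_right _ _) (abs_nonneg _)),
      (h4 t' ht').2.trans (mul_le_mul_of_nonneg_right (le_max_right _ _) (abs_nonneg _))⟩⟩

/-- The smoothing is uniformly close to the original metric. -/
theorem exists_smoothed_close (hG : IsCollarMetric ε V G) {K : Set F} (hK : IsCompact K)
    (hKc : Convex ℝ K) (hKV : K ⊆ V) {η : ℝ} (hη : 0 < η) :
    ∃ h₁ : ℝ, 0 < h₁ ∧ ∀ h : ℝ, 0 < h → h ≤ ε / 2 → h ≤ h₁ → ∀ y ∈ K, ∀ t ∈ Icc (-h) h,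
      ∀ v, |smoothed h G (y, t) v v - G (y, t) v v| ≤ η * G (y, t) v v := by
  obtain ⟨R, c, hR, hc, hm, hp⟩ := hG.exists_bounds hK hKc hKV
  have hε0 := hG.ε_pos
  -- The difference of the metrics is at most $2Rh$ in norm and the metric is at least $c\|v\|^2$,
  -- so $2Rh\le\eta c$ is wanted; the summand 1 avoids a zero denominator.
  refine ⟨η * c / (2 * R + 1), by positivity, fun h hh hhε hh1 y hy t ht v ↦ ?_⟩
  have hα1 := neg_le_sub_ramp hh ht.1
  have hα2 := sub_ramp_nonpos hh t
  have hβ1 := ramp_nonneg hh t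
  have hβ2 := ramp_le hh ht.2
  have hαm : t - ramp h t ∈ Icc (-ε) 0 := ⟨by linarith, hα2⟩
  have hβm : ramp h t ∈ Icc 0 ε := ⟨hβ1, by linarith⟩
  have hmain : ‖smoothed h G (y, t) - G (y, t)‖ ≤ 2 * R * h ∧ c * ‖v‖ ^ 2 ≤ G (y, t) v v := by
    rcases le_total t 0 with h0 | h0
    · have htm : t ∈ Icc (-ε) 0 := ⟨by linarith [ht.1], h0⟩
      refine ⟨?_, (hm y hy t htm).2.2.1 v⟩
      -- The grouping compares only points on the same side of the corner, where the Lipschitz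
      -- bounds apply; for $t\ge0$ the roles of $t$ and $0$ are exchanged.
      have e : smoothed h G (y, t) - G (y, t) = (G (y, t - ramp h t) - G (y, t)) +
          (G (y, ramp h t) - G (y, 0)) := by simp only [smoothed]; abel
      have b1 := ((hm y hy _ hαm).2.2.2 t htm).1
      have b2 := ((hp y hy _ hβm).2.2.2 0 ⟨le_rfl, hε0.le⟩).1
      rw [sub_sub_cancel_left, abs_neg, abs_of_nonneg hβ1] at b1
      rw [sub_zero, abs_of_nonneg hβ1] at b2
      rw [e]
      refine (norm_add_le _ _).trans ?_
      nlinarith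
    · have htp : t ∈ Icc 0 ε := ⟨h0, by linarith [ht.2]⟩
      refine ⟨?_, (hp y hy t htp).2.2.1 v⟩
      have e : smoothed h G (y, t) - G (y, t) = (G (y, t - ramp h t) - G (y, 0)) +
          (G (y, ramp h t) - G (y, t)) := by simp only [smoothed]; abel
      have b1 := ((hm y hy _ hαm).2.2.2 0 ⟨by linarith, le_rfl⟩).1
      have b2 := ((hp y hy _ hβm).2.2.2 t htp).1
      rw [sub_zero, abs_of_nonpos hα2] at b1
      rw [abs_of_nonneg (by linarith)] at b2
      rw [e]
      refine (norm_add_le _ _).trans ?_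
      nlinarith
  rw [← sub_apply, ← sub_apply]
  refine ((smoothed h G (y, t) - G (y, t)).le_opNorm₂ v v).trans ?_
  have h5 : (2 * R + 1) * h ≤ η * c := by
    rw [le_div_iff₀ (by positivity)] at hh1
    linarith
  calc ‖smoothed h G (y, t) - G (y, t)‖ * ‖v‖ * ‖v‖ ≤ (2 * R * h) * ‖v‖ * ‖v‖ := by
        gcongr; exact hmain.1
    _ ≤ (η * c) * ‖v‖ * ‖v‖ := mul_le_mul_of_nonneg_right (mul_le_mul_of_nonneg_right
        (by linarith) (norm_nonneg v)) (norm_nonneg v)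
    _ = η * (c * ‖v‖ ^ 2) := by ring
    _ ≤ η * G (y, t) v v := by gcongr; exact hmain.2

/-- If a linear function of `G` is constant, it vanishes on the derivatives of `G`. -/
theorem _root_.Corner.fderivWithin_apply_eq_of_eqOn {E W W' : Type*} [NormedAddCommGroup E]
    [NormedSpace ℝ E] [NormedAddCommGroup W] [NormedSpace ℝ W] [NormedAddCommGroup W']
    [NormedSpace ℝ W'] {f : E → W} {s : Set E} {z : E} (hs : UniqueDiffWithinAt ℝ s z) (hz : z ∈ s)
    (hf : DifferentiableWithinAt ℝ f s z) (L : W →L[ℝ] W') {w : W'} (h : ∀ x ∈ s, L (f x) = w)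
    (u : E) : L (fderivWithin ℝ f s z u) = 0 := by
  have h1 : HasFDerivWithinAt (fun x ↦ L (f x)) (L ∘L fderivWithin ℝ f s z) s z :=
    L.hasFDerivAt.comp_hasFDerivWithinAt z hf.hasFDerivWithinAt
  have h2 : HasFDerivWithinAt (fun x ↦ L (f x)) (0 : E →L[ℝ] W') s z :=
    (hasFDerivWithinAt_const w z s).congr h (h z hz)
  exact congrArg (fun l ↦ l u) (hs.eq h1 h2)

theorem fderivWithin_apply_symm {I : Set ℝ} (hG : IsCollarMetric ε V G) (hI : UniqueDiffOn ℝ I)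
    (hIo : I ⊆ Ioo (-(2 * ε)) (2 * ε)) (hd : ContDiffOn ℝ 2 G (V ×ˢ I)) {z : F × ℝ}
    (hz : z ∈ V ×ˢ I) (u v w : F × ℝ) :
    fderivWithin ℝ G (V ×ˢ I) z u v w = fderivWithin ℝ G (V ×ˢ I) z u w v := by
  let L : ((F × ℝ) →L[ℝ] (F × ℝ) →L[ℝ] ℝ) →L[ℝ] ℝ :=
    (ContinuousLinearMap.apply ℝ ℝ w) ∘L (ContinuousLinearMap.apply ℝ ((F × ℝ) →L[ℝ] ℝ) v) -
    (ContinuousLinearMap.apply ℝ ℝ v) ∘L (ContinuousLinearMap.apply ℝ ((F × ℝ) →L[ℝ] ℝ) w)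
  have := fderivWithin_apply_eq_of_eqOn ((hG.isOpen.uniqueDiffOn.prod hI) z hz) hz
    ((hd z hz).differentiableWithinAt (by norm_num)) L (w := 0) (fun x hx ↦ by
      change G x v w - G x w v = 0
      rw [(hG.isInner x.1 hx.1 x.2 (hIo hx.2)).symm, sub_self]) u
  exact sub_eq_zero.1 this

/-- The form $G(\partial_t,\cdot)=dt$ is constant, so $\partial_t$ lies in the kernel of the first
derivatives of `G`. This provides the kernel hypothesis of `scalJet_add_smul` for the jump. -/
theorem fderivWithin_apply_normal {I : Set ℝ} (hG : IsCollarMetric ε V G) (hI : UniqueDiffOn ℝ I)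
    (hIo : I ⊆ Ioo (-(2 * ε)) (2 * ε)) (hd : ContDiffOn ℝ 2 G (V ×ˢ I)) {z : F × ℝ}
    (hz : z ∈ V ×ˢ I) (u : F × ℝ) : fderivWithin ℝ G (V ×ˢ I) z u (0, 1) = 0 :=
  fderivWithin_apply_eq_of_eqOn ((hG.isOpen.uniqueDiffOn.prod hI) z hz) hz
    ((hd z hz).differentiableWithinAt (by norm_num))
    (ContinuousLinearMap.apply ℝ ((F × ℝ) →L[ℝ] ℝ) ((0, 1) : F × ℝ))
    (w := ContinuousLinearMap.snd ℝ F ℝ) (fun x hx ↦ by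
      apply ContinuousLinearMap.ext
      intro v
      exact hG.apply_normal x.1 hx.1 x.2 (hIo hx.2) v) u

end IsCollarMetric

end Smoothing

/-! ### Scalar curvature of the smoothing: cancellation of the singular term. -/

section SmoothingScalar

variable {F : Type*} [NormedAddCommGroup F] [NormedSpace ℝ F] [FiniteDimensional ℝ F]

theorem norm_bilinearComp_le {E W : Type*} [NormedAddCommGroup E] [NormedSpace ℝ E]
    [NormedAddCommGroup W] [NormedSpace ℝ W] (M : E →L[ℝ] E →L[ℝ] W) {L : E →L[ℝ] E}
    (hL : ‖L‖ ≤ 1) {R : ℝ} (hM : ‖M‖ ≤ R) : ‖M.bilinearComp L L‖ ≤ R := by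
  refine ContinuousLinearMap.opNorm_le_bound₂ _ ((norm_nonneg M).trans hM) fun u v ↦ ?_
  rw [ContinuousLinearMap.bilinearComp_apply]
  have hL' : ∀ u, ‖L u‖ ≤ ‖u‖ := fun u ↦ by simpa using L.le_of_opNorm_le hL u
  have hR := (norm_nonneg M).trans hM
  exact (M.le_opNorm₂ _ _).trans (by gcongr <;> exact hL' _)

theorem norm_comp_le {E W : Type*} [NormedAddCommGroup E] [NormedSpace ℝ E]
    [NormedAddCommGroup W] [NormedSpace ℝ W] (D : E →L[ℝ] W) {L : E →L[ℝ] E}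
    (hL : ‖L‖ ≤ 1) {R : ℝ} (hD : ‖D‖ ≤ R) : ‖D ∘L L‖ ≤ R :=
  (D.opNorm_comp_le L).trans
    ((mul_le_mul hD hL (norm_nonneg _) ((norm_nonneg D).trans hD)).trans_eq (mul_one R))

theorem norm_add_sub_le {W : Type*} [NormedAddCommGroup W] {a b c : W} {R : ℝ} (ha : ‖a‖ ≤ R)
    (hb : ‖b‖ ≤ R) (hc : ‖c‖ ≤ R) : ‖a + b - c‖ ≤ R + R + R :=
  (norm_sub_le _ _).trans (add_le_add ((norm_add_le _ _).trans (add_le_add ha hb)) hc)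

theorem norm_apply_zero_one_le {W : Type*} [NormedAddCommGroup W] [NormedSpace ℝ W]
    {D : (F × ℝ) →L[ℝ] W} {r : ℝ} (hD : ‖D‖ ≤ r) : ‖D (0, 1)‖ ≤ r := by
  have hone : ‖((0 : F), (1 : ℝ))‖ = 1 := by simp [Prod.norm_def]
  simpa only [hone, mul_one] using D.le_of_opNorm_le hD (0, 1)

theorem norm_sub_sub_sub_le {W : Type*} [NormedAddCommGroup W] {a b a' b' : W} {R x y h : ℝ}
    (hR : 0 ≤ R) (ha : ‖a - a'‖ ≤ R * x) (hb : ‖b - b'‖ ≤ R * y) (hx : x ≤ h) (hy : y ≤ h) :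
    ‖a - b - (a' - b')‖ ≤ 2 * R * h := by
  have e : a - b - (a' - b') = (a - a') - (b - b') := by abel
  rw [e]
  refine (norm_sub_le _ _).trans ((add_le_add ha hb).trans ?_)
  nlinarith

theorem norm_jump_sub_le {W : Type*} [NormedAddCommGroup W] [NormedSpace ℝ W]
    {D₁ D₂ D₁' D₂' : (F × ℝ) →L[ℝ] W} {R x y h : ℝ} (hR : 0 ≤ R) (h1 : ‖D₁ - D₁'‖ ≤ R * x)
    (h2 : ‖D₂ - D₂'‖ ≤ R * y) (hx : x ≤ h) (hy : y ≤ h) :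
    ‖D₁ (0, 1) - D₂ (0, 1) - (D₁' (0, 1) - D₂' (0, 1))‖ ≤ 2 * R * h :=
  norm_sub_sub_sub_le hR (norm_apply_zero_one_le h1) (norm_apply_zero_one_le h2) hx hy

theorem norm_jump_le {W : Type*} [NormedAddCommGroup W] [NormedSpace ℝ W]
    {D₁ D₂ : (F × ℝ) →L[ℝ] W} {R : ℝ} (h1 : ‖D₁‖ ≤ R) (h2 : ‖D₂‖ ≤ R) :
    ‖D₁ (0, 1) - D₂ (0, 1)‖ ≤ 2 * R :=
  (norm_sub_le _ _).trans ((add_le_add (norm_apply_zero_one_le h1)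
    (norm_apply_zero_one_le h2)).trans_eq (two_mul R).symm)

theorem norm_add_sub_sub_le {W : Type*} [NormedAddCommGroup W] {a b a' : W} {R x y h : ℝ}
    (hR : 0 ≤ R) (ha : ‖a - a'‖ ≤ R * x) (hb : ‖b - a'‖ ≤ R * y) (hx : x ≤ h) (hy : y ≤ h) :
    ‖a + b - a' - a'‖ ≤ 2 * R * h := by
  have e : a + b - a' - a' = (a - a') + (b - a') := by abel
  rw [e]
  refine (norm_add_le _ _).trans ((add_le_add ha hb).trans ?_)
  nlinarith

theorem norm_bilinearComp_add_sub_le {E W : Type*} [NormedAddCommGroup E] [NormedSpace ℝ E]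
    [NormedAddCommGroup W] [NormedSpace ℝ W] (C₁ C₂ C₃ : E →L[ℝ] E →L[ℝ] W) {L₁ L₂ L₃ : E →L[ℝ] E}
    {R : ℝ} (h1 : ‖C₁‖ ≤ R) (h2 : ‖C₂‖ ≤ R) (h3 : ‖C₃‖ ≤ R) (hL1 : ‖L₁‖ ≤ 1) (hL2 : ‖L₂‖ ≤ 1)
    (hL3 : ‖L₃‖ ≤ 1) : ‖C₁.bilinearComp L₁ L₁ + C₂.bilinearComp L₂ L₂ - C₃.bilinearComp L₃ L₃‖ ≤
      R + R + R :=
  norm_add_sub_le (norm_bilinearComp_le C₁ hL1 h1) (norm_bilinearComp_le C₂ hL2 h2)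
    (norm_bilinearComp_le C₃ hL3 h3)

theorem norm_comp_add_sub_le {E W : Type*} [NormedAddCommGroup E] [NormedSpace ℝ E]
    [NormedAddCommGroup W] [NormedSpace ℝ W] (D₁ D₂ D₃ : E →L[ℝ] W) {L₁ L₂ L₃ : E →L[ℝ] E}
    {R : ℝ} (h1 : ‖D₁‖ ≤ R) (h2 : ‖D₂‖ ≤ R) (h3 : ‖D₃‖ ≤ R) (hL1 : ‖L₁‖ ≤ 1) (hL2 : ‖L₂‖ ≤ 1)
    (hL3 : ‖L₃‖ ≤ 1) : ‖D₁ ∘L L₁ + D₂ ∘L L₂ - D₃ ∘L L₃‖ ≤ R + R + R :=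
  norm_add_sub_le (norm_comp_le D₁ hL1 h1) (norm_comp_le D₂ hL2 h2) (norm_comp_le D₃ hL3 h3)

/-- The scalar curvature of a 2-jet of the form `C + b dt² ⊗ J` is bounded when `J` is within
`O(1 / b)` of a form whose trace vanishes. -/
theorem exists_abs_scalJet_perturb_le {E : Type*} [NormedAddCommGroup E] [NormedSpace ℝ E]
    [FiniteDimensional ℝ E] {c R : ℝ} (hc : 0 < c) (hR : 0 ≤ R) : ∃ K : ℝ,
    ∀ (A A₀ J J₀ : E →L[ℝ] E →L[ℝ] ℝ) (B : E →L[ℝ] E →L[ℝ] E →L[ℝ] ℝ)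
      (C₁ C₂ C₃ C : E →L[ℝ] E →L[ℝ] E →L[ℝ] E →L[ℝ] ℝ) (L₁ L₂ L₃ : E →L[ℝ] E) (τ : E →L[ℝ] ℝ)
      (e : E) (b h : ℝ), IsInner A → A e = τ → τ e = 1 → (∀ v w, J v w = J w v) → J e = 0 →
      (∀ v, c * ‖v‖ ^ 2 ≤ A v v) → (∀ v, c * ‖v‖ ^ 2 ≤ A₀ v v) → ‖B‖ ≤ R + R + R →
      ‖C₁‖ ≤ R → ‖C₂‖ ≤ R → ‖C₃‖ ≤ R → ‖L₁‖ ≤ 1 → ‖L₂‖ ≤ 1 → ‖L₃‖ ≤ 1 →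
      (∀ u v, C u v = C₁.bilinearComp L₁ L₁ u v + C₂.bilinearComp L₂ L₂ u v -
        C₃.bilinearComp L₃ L₃ u v + (b * (τ u * τ v)) • J) →
      0 < h → |b| ≤ 1 / h → ‖J - J₀‖ ≤ 2 * R * h → ‖J₀‖ ≤ 2 * R → ‖A - A₀‖ ≤ 2 * R * h →
      traceWrt A₀ (fun u v ↦ J₀ u v) = 0 → |scalJet A B C| ≤ K := by
  obtain ⟨K₀, hK₀⟩ := exists_abs_scalJet_le (E := E) hc (R + R + R)
  refine ⟨K₀ + traceConst E * (2 * R / c + 2 * R * (2 * R / c / c)), ?_⟩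
  intro A A₀ J J₀ B C₁ C₂ C₃ C L₁ L₂ L₃ τ e b h hA he hτ hJs hJe hcA hcA₀ hB h1 h2 h3 hL1 hL2 hL3
    hC hh hb hJJ hJ0 hAA htr0
  have hscal := scalJet_add_smul hA B (C₁.bilinearComp L₁ L₁ + C₂.bilinearComp L₂ L₂ -
    C₃.bilinearComp L₃ L₃) he hτ hJs hJe (C' := C) b (fun u v w z ↦ by
      rw [hC]
      simp only [add_apply, sub_apply, smul_apply, smul_eq_mul]
      ring)
  rw [hscal]
  have hbound := hK₀ A B _ hcA hB 
    (norm_bilinearComp_add_sub_le (W := E →L[ℝ] E →L[ℝ] ℝ) C₁ C₂ C₃ h1 h2 h3 hL1 hL2 hL3)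
  have htr := abs_traceWrt_le (h := J) hc hcA hcA₀ htr0
  have htc : 0 ≤ traceConst E := Finset.sum_nonneg fun i _ ↦ by positivity
  -- The factor $1/h$ bounding `b` cancels the factor $h$ in the bounds for $J-J_0$ and $A-A_0$.
  have htr' : |b * traceWrt A fun u v ↦ J u v| ≤
      traceConst E * (2 * R / c + 2 * R * (2 * R / c / c)) := by
    rw [abs_mul]
    calc _ ≤ 1 / h * (traceConst E * ((2 * R * h) / c + 2 * R * ((2 * R * h) / c / c))) := by
          refine mul_le_mul hb (htr.trans ?_) (abs_nonneg _) (by positivity)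
          gcongr
      _ = _ := by field_simp
  exact (abs_sub _ _).trans (add_le_add hbound htr')

namespace IsCollarMetric

variable {ε : ℝ} {V : Set F} {G : F × ℝ → (F × ℝ) →L[ℝ] (F × ℝ) →L[ℝ] ℝ}

/-- The 2-jet of the smoothing. -/
theorem smoothed_jet (hG : IsCollarMetric ε V G) {h : ℝ} (hh : 0 < h) (hhε : h < 2 * ε) {y : F}
    (hy : y ∈ V) {t : ℝ} (ht : t ∈ Ioo (-(2 * ε)) (2 * ε)) :
    fderiv ℝ (smoothed h G) (y, t) =
      fderivWithin ℝ G (V ×ˢ Ioc (-(2 * ε)) 0) (y, t - ramp h t) ∘L scaleSnd F (1 - ramp' h t) +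
      fderivWithin ℝ G (V ×ˢ Ico 0 (2 * ε)) (y, ramp h t) ∘L scaleSnd F (ramp' h t) -
      fderivWithin ℝ G (V ×ˢ Ioc (-(2 * ε)) 0) (y, 0) ∘L scaleSnd F 0 ∧
    ∀ u v, fderiv ℝ (fderiv ℝ (smoothed h G)) (y, t) u v =
      (fderivWithin ℝ (fderivWithin ℝ G (V ×ˢ Ioc (-(2 * ε)) 0)) (V ×ˢ Ioc (-(2 * ε)) 0)
        (y, t - ramp h t)).bilinearComp (scaleSnd F (1 - ramp' h t)) (scaleSnd F (1 - ramp' h t))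
          u v +
      (fderivWithin ℝ (fderivWithin ℝ G (V ×ˢ Ico 0 (2 * ε))) (V ×ˢ Ico 0 (2 * ε))
        (y, ramp h t)).bilinearComp (scaleSnd F (ramp' h t)) (scaleSnd F (ramp' h t)) u v -
      (fderivWithin ℝ (fderivWithin ℝ G (V ×ˢ Ioc (-(2 * ε)) 0)) (V ×ˢ Ioc (-(2 * ε)) 0)
        (y, 0)).bilinearComp (scaleSnd F 0) (scaleSnd F 0) u v +
      (ramp'' h t * (u.2 * v.2)) •
        (fderivWithin ℝ G (V ×ˢ Ico 0 (2 * ε)) (y, ramp h t) (0, 1) -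
          fderivWithin ℝ G (V ×ˢ Ioc (-(2 * ε)) 0) (y, t - ramp h t) (0, 1)) := by
  have hε0 := hG.ε_pos
  have hnhds : ∀ {t}, t ∈ Ioo (-(2 * ε)) (2 * ε) → ∀ᶠ s in 𝓝 t, s ∈ Ioo (-(2 * ε)) (2 * ε) :=
    fun ht ↦ isOpen_Ioo.mem_nhds ht
  have hα : ∀ {t}, t ∈ Ioo (-(2 * ε)) (2 * ε) →
      ∀ᶠ s in 𝓝 t, s - ramp h s ∈ Ioc (-(2 * ε)) 0 := fun ht ↦ (hnhds ht).mono fun s hs ↦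
    ⟨lt_sub_ramp hh hhε hs.1, sub_ramp_nonpos hh s⟩
  have hβ : ∀ {t}, t ∈ Ioo (-(2 * ε)) (2 * ε) →
      ∀ᶠ s in 𝓝 t, ramp h s ∈ Ico 0 (2 * ε) := fun ht ↦ (hnhds ht).mono fun s hs ↦
    ⟨ramp_nonneg hh s, ramp_lt hh hhε hs.2⟩
  have h0 : ∀ {t : ℝ}, ∀ᶠ _ in 𝓝 t, (0 : ℝ) ∈ Ioc (-(2 * ε)) 0 :=
    Filter.Eventually.of_forall fun _ ↦ ⟨by linarith, le_rfl⟩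
  have dα : ∀ t, HasDerivAt (fun t ↦ t - ramp h t) (1 - ramp' h t) t := fun t ↦
    (hasDerivAt_id t).sub (hasDerivAt_ramp h t)
  -- The two reparametrizations have opposite second derivatives, so the `ramp''` terms assemble
  -- into a difference of one-sided normal derivatives. The constant reparametrization contributes
  -- none.
  have dα' : HasDerivAt (fun t ↦ 1 - ramp' h t) (-ramp'' h t) t :=
    (hasDerivAt_ramp' h t).const_sub 1
  have d0 : ∀ t : ℝ, HasDerivAt (fun _ : ℝ ↦ (0 : ℝ)) ((fun _ ↦ 0) t) t := fun t ↦
    hasDerivAt_const t 0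
  have hfirst : ∀ {y t}, y ∈ V → t ∈ Ioo (-(2 * ε)) (2 * ε) →
      HasFDerivAt (fun z : F × ℝ ↦ G (z.1, z.2 - ramp h z.2))
        (fderivWithin ℝ G (V ×ˢ Ioc (-(2 * ε)) 0) (y, t - ramp h t) ∘L
          scaleSnd F (1 - ramp' h t)) (y, t) ∧
      HasFDerivAt (fun z : F × ℝ ↦ G (z.1, ramp h z.2))
        (fderivWithin ℝ G (V ×ˢ Ico 0 (2 * ε)) (y, ramp h t) ∘L scaleSnd F (ramp' h t)) (y, t) ∧
      HasFDerivAt (fun z : F × ℝ ↦ G (z.1, 0))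
        (fderivWithin ℝ G (V ×ˢ Ioc (-(2 * ε)) 0) (y, 0) ∘L scaleSnd F 0) (y, t) :=
    fun {y t} hy ht ↦
    ⟨hasFDerivAt_reparam (a' := fun t ↦ 1 - ramp' h t) hG.isOpen hG.contDiffOn_neg hy (dα t) (hα ht),
      hasFDerivAt_reparam hG.isOpen hG.contDiffOn_pos hy (hasDerivAt_ramp h t) (hβ ht),
      hasFDerivAt_reparam (a := fun _ ↦ 0) (a' := fun _ ↦ 0) hG.isOpen hG.contDiffOn_neg hy (d0 t)
        h0⟩
  have hs : ∀ {y t}, y ∈ V → t ∈ Ioo (-(2 * ε)) (2 * ε) → fderiv ℝ (smoothed h G) (y, t) =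
      fderiv ℝ (fun z : F × ℝ ↦ G (z.1, z.2 - ramp h z.2)) (y, t) +
      fderiv ℝ (fun z : F × ℝ ↦ G (z.1, ramp h z.2)) (y, t) -
      fderiv ℝ (fun z : F × ℝ ↦ G (z.1, 0)) (y, t) := fun hy ht ↦ by
    obtain ⟨a1, a2, a3⟩ := hfirst hy ht
    rw [a1.fderiv, a2.fderiv, a3.fderiv]
    exact ((a1.add a2).sub a3).fderiv
  refine ⟨?_, fun u v ↦ ?_⟩
  · obtain ⟨a1, a2, a3⟩ := hfirst hy ht
    rw [hs hy ht, a1.fderiv, a2.fderiv, a3.fderiv]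
  · have hev : fderiv ℝ (smoothed h G) =ᶠ[𝓝 (y, t)] fun z ↦
        fderiv ℝ (fun z : F × ℝ ↦ G (z.1, z.2 - ramp h z.2)) z +
        fderiv ℝ (fun z : F × ℝ ↦ G (z.1, ramp h z.2)) z -
        fderiv ℝ (fun z : F × ℝ ↦ G (z.1, 0)) z := by
      filter_upwards [prod_mem_nhds (hG.isOpen.mem_nhds hy) (hnhds ht)] with z hz
      exact hs hz.1 hz.2
    obtain ⟨b1, c1⟩ := fderiv_fderiv_reparam (a' := fun t ↦ 1 - ramp' h t) hG.isOpen
      (uniqueDiffOn_Ioc _ _) hG.contDiffOn_neg hy dα dα' (hα ht)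
    obtain ⟨b2, c2⟩ := fderiv_fderiv_reparam hG.isOpen (uniqueDiffOn_Ico _ _) hG.contDiffOn_pos hy
      (hasDerivAt_ramp h) (hasDerivAt_ramp' h t) (hβ ht)
    obtain ⟨b3, c3⟩ := fderiv_fderiv_reparam (a := fun _ ↦ 0) (a' := fun _ ↦ 0) hG.isOpen
      (uniqueDiffOn_Ioc _ _) hG.contDiffOn_neg hy d0 (d0 t) h0
    rw [(((b1.add b2).sub b3).congr_of_eventuallyEq hev).fderiv]
    rw [sub_apply, add_apply, sub_apply, add_apply, c1, c2, c3]
    simp only [ContinuousLinearMap.bilinearComp_apply]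
    module

/-- The scalar curvature of the smoothings is bounded, uniformly in the scale. -/
theorem exists_abs_coordScalar_smoothed_le (hG : IsCollarMetric ε V G) {K : Set F}
    (hK : IsCompact K) (hKc : Convex ℝ K) (hKV : K ⊆ V) {h₀ : ℝ} (hh₀ : h₀ ≤ ε / 2)
    (hlow : ∀ h, 0 < h → h ≤ h₀ → ∀ y ∈ K, ∀ t ∈ Icc (-h) h, ∀ v,
      1 / 2 * G (y, t) v v ≤ smoothed h G (y, t) v v) :
    ∃ C : ℝ, ∀ h, 0 < h → h ≤ h₀ → ∀ y ∈ K, ∀ t ∈ Icc (-h) h,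
      |coordScalar (smoothed h G) (y, t)| ≤ C := by
  obtain ⟨R, c, hR, hc, hm, hp⟩ := hG.exists_bounds hK hKc hKV
  have hε0 := hG.ε_pos
  -- Half of `c` is what remains of the coercivity: the smoothing is assumed to be at least half of
  -- `G` on the strip.
  obtain ⟨K₀, hK₀⟩ := exists_abs_scalJet_perturb_le (E := F × ℝ) (half_pos hc) hR
  refine ⟨K₀, fun h hh hh1 y hy t ht ↦ ?_⟩
  have hyV := hKV hy
  have hhε : h < 2 * ε := by linarith
  have hα1 := neg_le_sub_ramp hh ht.1
  have hα2 := sub_ramp_nonpos hh t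
  have hβ1 := ramp_nonneg hh t
  have hβ2 := ramp_le hh ht.2
  have hαm : t - ramp h t ∈ Icc (-ε) 0 := ⟨by linarith, hα2⟩
  have hβm : ramp h t ∈ Icc 0 ε := ⟨hβ1, by linarith⟩
  have h0m : (0 : ℝ) ∈ Icc (-ε) 0 := ⟨by linarith, le_rfl⟩
  have h0p : (0 : ℝ) ∈ Icc 0 ε := ⟨le_rfl, hε0.le⟩
  have hto : t ∈ Ioo (-(2 * ε)) (2 * ε) := ⟨by linarith [ht.1], by linarith [ht.2]⟩
  have hαo : t - ramp h t ∈ Ioo (-(2 * ε)) (2 * ε) := ⟨by linarith, by linarith⟩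
  have hβo : ramp h t ∈ Ioo (-(2 * ε)) (2 * ε) := ⟨by linarith, by linarith⟩
  have h0o : (0 : ℝ) ∈ Ioo (-(2 * ε)) (2 * ε) := ⟨by linarith, by linarith⟩
  have hcoer0 := (hm y hy 0 h0m).2.2.1
  have hcoer : ∀ v, c / 2 * ‖v‖ ^ 2 ≤ smoothed h G (y, t) v v := fun v ↦ by
    have h1 : c * ‖v‖ ^ 2 ≤ G (y, t) v v := by
      rcases le_total t 0 with h0 | h0
      · exact (hm y hy t ⟨by linarith [ht.1], h0⟩).2.2.1 v
      · exact (hp y hy t ⟨h0, by linarith [ht.2]⟩).2.2.1 v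
    linarith [hlow h hh hh1 y hy t ht v]
  have hinner : IsInner (smoothed h G (y, t)) := by
    refine ⟨fun v w ↦ ?_, fun v hv ↦ lt_of_lt_of_le (by positivity) (hcoer v)⟩
    simp only [smoothed, add_apply, sub_apply]
    rw [(hG.isInner y hyV _ hαo).symm, (hG.isInner y hyV _ hβo).symm, (hG.isInner y hyV 0 h0o).symm]
  have hC2 : ContDiffAt ℝ 2 (smoothed h G) (y, t) :=
    (hG.contDiffOn_smoothed hh hhε).contDiffAt
      ((hG.isOpen.prod isOpen_Ioo).mem_nhds ⟨hyV, hto⟩)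
  have hinv : ∀ᶠ z in 𝓝 (y, t), (smoothed h G z).IsInvertible := by
    obtain ⟨e, he⟩ := hinner.isInvertible
    have := e.nhds
    rw [he] at this
    exact hC2.continuousAt.eventually_mem this
  obtain ⟨hj1, hj2⟩ := hG.smoothed_jet hh hhε hyV hto
  have hr1 : |ramp' h t| ≤ 1 := abs_le.2 ⟨by linarith [ramp'_nonneg h t hh], ramp'_le_one h t hh⟩
  have hr2 : |1 - ramp' h t| ≤ 1 :=
    abs_le.2 ⟨by linarith [ramp'_le_one h t hh], by linarith [ramp'_nonneg h t hh]⟩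
  have hr0 : |(0 : ℝ)| ≤ 1 := by simp
  rw [coordScalar_eq_scalJet hC2 hinv]
  have hIm : Ioc (-(2 * ε)) 0 ⊆ Ioo (-(2 * ε)) (2 * ε) := fun s hs ↦ ⟨hs.1, by linarith [hs.2]⟩
  have hIp : Ico 0 (2 * ε) ⊆ Ioo (-(2 * ε)) (2 * ε) := fun s hs ↦ ⟨by linarith [hs.1], hs.2⟩
  have hzm : (y, t - ramp h t) ∈ V ×ˢ Ioc (-(2 * ε)) 0 := ⟨hyV, hαo.1, hα2⟩
  have hzp : (y, ramp h t) ∈ V ×ˢ Ico 0 (2 * ε) := ⟨hyV, hβ1, hβo.2⟩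
  -- The three terms all pair $\partial_t$ to $dt$, and $1+1-1=1$; the smoothing is again in normal
  -- form.
  have he : smoothed h G (y, t) (0, 1) = ContinuousLinearMap.snd ℝ F ℝ := by
    apply ContinuousLinearMap.ext
    intro v
    simp only [smoothed, add_apply, sub_apply, hG.apply_normal y hyV _ hαo,
      hG.apply_normal y hyV _ hβo, hG.apply_normal y hyV 0 h0o]
    simp
  have hα3 : |t - ramp h t - 0| ≤ h := by rw [sub_zero, abs_le]; constructor <;> linarith
  have hβ3 : |ramp h t - 0| ≤ h := by rw [sub_zero, abs_le]; constructor <;> linarith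
  -- The reference pair is the metric at $t=0$ and the jump there, whose trace vanishes by
  -- `trace_eq`; further $\tau=dt$, $e=\partial_t$ and `b` is the second derivative of the ramp.
  refine hK₀ (smoothed h G (y, t)) (G (y, 0))
    (fderivWithin ℝ G (V ×ˢ Ico 0 (2 * ε)) (y, ramp h t) (0, 1) -
      fderivWithin ℝ G (V ×ˢ Ioc (-(2 * ε)) 0) (y, t - ramp h t) (0, 1))
    (fderivWithin ℝ G (V ×ˢ Ico 0 (2 * ε)) (y, 0) (0, 1) -
      fderivWithin ℝ G (V ×ˢ Ioc (-(2 * ε)) 0) (y, 0) (0, 1)) _ _ _ _ _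
    (scaleSnd F (1 - ramp' h t)) (scaleSnd F (ramp' h t)) (scaleSnd F 0)
    (ContinuousLinearMap.snd ℝ F ℝ) (0, 1) (ramp'' h t) h hinner he rfl ?_ ?_ hcoer
    (fun v ↦ le_trans (by nlinarith [sq_nonneg ‖v‖]) (hcoer0 v)) ?_
    (hm y hy _ hαm).2.1 (hp y hy _ hβm).2.1 (hm y hy _ h0m).2.1 (norm_scaleSnd_le hr2)
    (norm_scaleSnd_le hr1) (norm_scaleSnd_le hr0) hj2 hh (abs_ramp''_le h t hh) ?_ ?_ ?_
    (hG.trace_eq y hyV)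
  · intro v w
    rw [sub_apply, sub_apply, sub_apply, sub_apply,
      hG.fderivWithin_apply_symm (uniqueDiffOn_Ico _ _) hIp hG.contDiffOn_pos hzp,
      hG.fderivWithin_apply_symm (uniqueDiffOn_Ioc _ _) hIm hG.contDiffOn_neg hzm]
  · rw [sub_apply, hG.fderivWithin_apply_normal (uniqueDiffOn_Ico _ _) hIp hG.contDiffOn_pos hzp,
      hG.fderivWithin_apply_normal (uniqueDiffOn_Ioc _ _) hIm hG.contDiffOn_neg hzm, sub_zero]
  · rw [hj1]
    exact norm_comp_add_sub_le (W := (F × ℝ) →L[ℝ] (F × ℝ) →L[ℝ] ℝ) _ _ _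
      (hm y hy _ hαm).1 (hp y hy _ hβm).1 (hm y hy _ h0m).1
      (norm_scaleSnd_le hr2) (norm_scaleSnd_le hr1) (norm_scaleSnd_le hr0)
  · exact norm_jump_sub_le (W := (F × ℝ) →L[ℝ] (F × ℝ) →L[ℝ] ℝ) hR
      ((hp y hy _ hβm).2.2.2 0 h0p).2 ((hm y hy _ hαm).2.2.2 0 h0m).2 hβ3 hα3
  · exact norm_jump_le (W := (F × ℝ) →L[ℝ] (F × ℝ) →L[ℝ] ℝ) (hp y hy _ h0p).1 (hm y hy _ h0m).1
  · exact norm_add_sub_sub_le hR ((hm y hy _ hαm).2.2.2 0 h0m).1 ((hp y hy _ hβm).2.2.2 0 h0p).1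
      hα3 hβ3

end IsCollarMetric

end SmoothingScalar

theorem isInvertible_of_injective {E : Type*} [NormedAddCommGroup E] [NormedSpace ℝ E]
    [FiniteDimensional ℝ E] {P : E →L[ℝ] E} (hP : Function.Injective P) : P.IsInvertible :=
  ⟨(LinearEquiv.ofInjectiveEndo (P : E →ₗ[ℝ] E) hP).toContinuousLinearEquiv, by ext; rfl⟩

/-! ### Coordinate expressions of metrics on manifolds. -/

section Manifold

variable {k : ℕ} {M : Type*} [TopologicalSpace M] [ChartedSpace (ModelProd (Euc k) ℝ) M]

theorem range_mdl : range (mdl k) = univ := (mdl k).range_eq_univ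

theorem extChartAt_target_mem_nhds_of_mem {p : M} {y : Euc k × ℝ}
    (hy : y ∈ (extChartAt (mdl k) p).target) : (extChartAt (mdl k) p).target ∈ 𝓝 y :=
  (isOpen_extChartAt_target p).mem_nhds hy

theorem coordMetric_apply (g : BilinField k M) (p : M) (y u v : Euc k × ℝ) :
    coordMetric g p y u v = g ((extChartAt (mdl k) p).symm y)
      (mfderiv 𝓘(ℝ, Euc k × ℝ) (mdl k) (extChartAt (mdl k) p).symm y u)
      (mfderiv 𝓘(ℝ, Euc k × ℝ) (mdl k) (extChartAt (mdl k) p).symm y v) := rfl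

variable [IsManifold (mdl k) 1 M]

/-- The derivative of the inverse chart is the inverse of the trivialization of the tangent bundle,
so `coordMetric` is the section read in the induced trivialization of the bundle of bilinear forms.
A $C^3$ atlas makes that bundle $C^2$. -/
theorem contMDiffWithinAt_section_iff [IsManifold (mdl k) 3 M] {g : BilinField k M} {s : Set M}
    {p q : M} (hq : q ∈ (extChartAt (mdl k) p).source) :
    ContMDiffWithinAt (mdl k)
      ((mdl k).prod 𝓘(ℝ, (Euc k × ℝ) →L[ℝ] (Euc k × ℝ) →L[ℝ] ℝ)) 2
      (fun p ↦ TotalSpace.mk' ((Euc k × ℝ) →L[ℝ] (Euc k × ℝ) →L[ℝ] ℝ)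
        (E := fun p : M ↦ TangentSpace (mdl k) p →L[ℝ] TangentSpace (mdl k) p →L[ℝ] ℝ) p (g p))
      s q ↔
    ContDiffWithinAt ℝ 2 (coordMetric g p) (coordSet k s p) (extChartAt (mdl k) p q) := by
  have i3 : IsManifold (mdl k) (2 + 1) M := by
    rw [show (2 + 1 : WithTop ℕ∞) = 3 by norm_num]; infer_instance
  have i2 : IsManifold (mdl k) 2 M := IsManifold.of_le (n := 3) (by norm_num)
  have hq' : q ∈ (chartAt (ModelProd (Euc k) ℝ) p).source := by
    rwa [extChartAt_source] at hq
  have := TangentBundle.contMDiffVectorBundle (I := mdl k) (M := M) (n := 2)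
  let e := trivializationAt ((Euc k × ℝ) →L[ℝ] (Euc k × ℝ) →L[ℝ] ℝ)
    (fun p : M ↦ TangentSpace (mdl k) p →L[ℝ] TangentSpace (mdl k) p →L[ℝ] ℝ) p
  have hqe : q ∈ e.baseSet := by
    simp [e, hom_trivializationAt_baseSet, hq']
  rw [e.contMDiffWithinAt_section s hqe]
  rw [contMDiffWithinAt_iff_source_of_mem_source (x := p) hq', contMDiffWithinAt_iff_contDiffWithinAt]
  have hset : ∀ᶠ y in 𝓝 (extChartAt (mdl k) p q),
      y ∈ (extChartAt (mdl k) p).symm ⁻¹' s ∩ range (mdl k) ↔ y ∈ coordSet k s p := by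
    filter_upwards [extChartAt_target_mem_nhds_of_mem ((extChartAt (mdl k) p).map_source hq)]
      with y hy
    rw [range_mdl]
    exact ⟨fun h ↦ ⟨hy, h.1⟩, fun h ↦ ⟨h.2, mem_univ _⟩⟩
  rw [contDiffWithinAt_congr_set (Filter.eventuallyEq_set.2 hset)]
  have key : ∀ y ∈ (extChartAt (mdl k) p).target,
      coordMetric g p y =
        ((fun x ↦ (e ⟨x, g x⟩).2) ∘ (extChartAt (mdl k) p).symm) y := by
    intro y hy
    have h1 := (extChartAt (mdl k) p).map_target hy
    rw [extChartAt_source] at h1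
    have h2 := TangentBundle.symmL_trivializationAt (I := mdl k) h1
    rw [(extChartAt (mdl k) p).right_inv hy, range_mdl, mfderivWithin_univ] at h2
    have hs : ∀ v : Euc k × ℝ, mfderiv 𝓘(ℝ, Euc k × ℝ) (mdl k) (extChartAt (mdl k) p).symm y v =
      (trivializationAt (Euc k × ℝ) (TangentSpace (mdl k)) p).symm
        ((extChartAt (mdl k) p).symm y) v := fun v ↦ by
      refine (DFunLike.congr_fun h2 v).symm.trans ?_
      exact Trivialization.symmL_apply (F := Euc k × ℝ) _ (by simpa using h1) _
    refine ContinuousLinearMap.ext fun u ↦ ContinuousLinearMap.ext fun v ↦ ?_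
    rw [coordMetric_apply, hs, hs]
    symm
    refine (inCoordinates_apply_eq₂ (𝕜 := ℝ) (F₁ := Euc k × ℝ) (E₁ := TangentSpace (mdl k))
      (F₂ := Euc k × ℝ) (E₂ := TangentSpace (mdl k)) (F₃ := ℝ) (E₃ := fun _ : M ↦ ℝ)
      (ϕ := g ((extChartAt (mdl k) p).symm y)) ?_ ?_ ?_).trans ?_
    · simpa using h1
    · simpa using h1
    · simp
    · simp
  have hmem := (extChartAt (mdl k) p).map_source hq
  constructor
  · intro h
    exact h.congr (fun y hy ↦ key y hy.1) (key _ hmem)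
  · intro h
    exact h.congr (fun y hy ↦ (key y hy.1).symm) (key _ hmem).symm

theorem coordMetric_isInner {g : BilinField k M} {p : M} {y : Euc k × ℝ}
    (hy : y ∈ (extChartAt (mdl k) p).target)
    (hs : ∀ v w, g ((extChartAt (mdl k) p).symm y) v w = g ((extChartAt (mdl k) p).symm y) w v)
    (hp : ∀ v, v ≠ 0 → 0 < g ((extChartAt (mdl k) p).symm y) v v) :
    IsInner (coordMetric g p y) := by
  have h := isInvertible_mfderivWithin_extChartAt_symm (I := mdl k) hy
  rw [range_mdl, mfderivWithin_univ] at h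
  refine ⟨fun u v ↦ hs _ _, fun u hu ↦ hp _ fun h0 ↦ hu ?_⟩
  exact h.injective (h0.trans (map_zero _).symm)

/-- The derivative of a map into `M`, read in the chart around `p`. -/
theorem mfderivWithin_eq_symm_comp {E : Type*} [NormedAddCommGroup E] [NormedSpace ℝ E]
    {F : E → M} {H : Set E} {z : E} {p : M}
    (hp : F z ∈ (extChartAt (mdl k) p).source) (hF : MDifferentiableWithinAt 𝓘(ℝ, E) (mdl k) F H z)
    (hH : UniqueDiffWithinAt ℝ H z) (u : E) :
    mfderivWithin 𝓘(ℝ, E) (mdl k) F H z u =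
      mfderiv 𝓘(ℝ, Euc k × ℝ) (mdl k) (extChartAt (mdl k) p).symm (extChartAt (mdl k) p (F z))
        (fderivWithin ℝ (extChartAt (mdl k) p ∘ F) H z u) := by
  have hp' : F z ∈ (chartAt (ModelProd (Euc k) ℝ) p).source := by
    rwa [extChartAt_source] at hp
  have h1 : MDifferentiableWithinAt 𝓘(ℝ, E) 𝓘(ℝ, Euc k × ℝ) (extChartAt (mdl k) p ∘ F) H z :=
    (mdifferentiableAt_extChartAt hp').comp_mdifferentiableWithinAt _ hF
  have h2 : MDifferentiableAt 𝓘(ℝ, Euc k × ℝ) (mdl k) (extChartAt (mdl k) p).symm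
      ((extChartAt (mdl k) p ∘ F) z) := by
    have := mdifferentiableWithinAt_extChartAt_symm (I := mdl k)
      ((extChartAt (mdl k) p).map_source hp)
    rwa [range_mdl, mdifferentiableWithinAt_univ] at this
  have h3 := mfderiv_comp_mfderivWithin z h2 h1 hH.uniqueMDiffWithinAt
  rw [mfderivWithin_eq_fderivWithin (f := extChartAt (mdl k) p ∘ F)] at h3
  have h4 : mfderivWithin 𝓘(ℝ, E) (mdl k) ((extChartAt (mdl k) p).symm ∘ extChartAt (mdl k) p ∘ F)
      H z u = mfderivWithin 𝓘(ℝ, E) (mdl k) F H z u := by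
    congr 1
    refine (Filter.EventuallyEq.mfderivWithin_eq ?_ ?_)
    · have := hF.continuousWithinAt.preimage_mem_nhdsWithin
        ((isOpen_extChartAt_source (I := mdl k) p).mem_nhds hp)
      filter_upwards [this] with w hw
      exact (extChartAt (mdl k) p).left_inv hw
    · exact (extChartAt (mdl k) p).left_inv hp
  rw [← h4, h3]
  rfl

/-- The pull-back of `g` by `F`, with derivatives taken within `H`. -/
def pullback {E : Type*} [NormedAddCommGroup E] [NormedSpace ℝ E]
    (g : BilinField k M) (F : E → M) (H : Set E) (z : E) : E →L[ℝ] E →L[ℝ] ℝ :=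
  ContinuousLinearMap.bilinearComp (E := Euc k × ℝ) (F := Euc k × ℝ) (E' := E) (F' := E) (g (F z))
    (mfderivWithin 𝓘(ℝ, E) (mdl k) F H z) (mfderivWithin 𝓘(ℝ, E) (mdl k) F H z)

theorem pullback_apply {E : Type*} [NormedAddCommGroup E] [NormedSpace ℝ E]
    (g : BilinField k M) (F : E → M) (H : Set E) (z u v : E) :
    pullback g F H z u v = g (F z) (mfderivWithin 𝓘(ℝ, E) (mdl k) F H z u)
      (mfderivWithin 𝓘(ℝ, E) (mdl k) F H z v) := rfl

theorem pullback_eq {E : Type*} [NormedAddCommGroup E] [NormedSpace ℝ E]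
    {g : BilinField k M} {F : E → M} {H : Set E} {z : E} {p : M}
    (hp : F z ∈ (extChartAt (mdl k) p).source) (hF : MDifferentiableWithinAt 𝓘(ℝ, E) (mdl k) F H z)
    (hH : UniqueDiffWithinAt ℝ H z) :
    pullback g F H z = (coordMetric g p (extChartAt (mdl k) p (F z))).bilinearComp
      (fderivWithin ℝ (extChartAt (mdl k) p ∘ F) H z)
      (fderivWithin ℝ (extChartAt (mdl k) p ∘ F) H z) := by
  refine ContinuousLinearMap.ext fun u ↦ ContinuousLinearMap.ext fun v ↦ ?_
  rw [pullback_apply, ContinuousLinearMap.bilinearComp_apply,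
    coordMetric_apply, mfderivWithin_eq_symm_comp hp hF hH, mfderivWithin_eq_symm_comp hp hF hH,
    (extChartAt (mdl k) p).left_inv hp]

theorem contDiffWithinAt_bilinearComp {E E' X : Type*} [NormedAddCommGroup E] [NormedSpace ℝ E]
    [NormedAddCommGroup E'] [NormedSpace ℝ E'] [NormedAddCommGroup X] [NormedSpace ℝ X]
    {A : X → E →L[ℝ] E →L[ℝ] ℝ} {P : X → E' →L[ℝ] E} {n : WithTop ℕ∞} {H : Set X} {z : X}
    (hA : ContDiffWithinAt ℝ n A H z) (hP : ContDiffWithinAt ℝ n P H z) :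
    ContDiffWithinAt ℝ n (fun x ↦ (A x).bilinearComp (P x) (P x)) H z := by
  have h1 : ContDiffWithinAt ℝ n (fun x ↦ (A x).comp (P x)) H z := hA.clm_comp hP
  have h2 : ContDiffWithinAt ℝ n (fun x ↦ ((ContinuousLinearMap.compL ℝ E' E ℝ).flip (P x)).comp
    ((A x).comp (P x))) H z :=
    ((ContinuousLinearMap.contDiff _).comp_contDiffWithinAt hP).clm_comp h1
  exact h2

/-- A $C^3$ map loses one derivative in the pull-back; this is why class $C^3$ for the collar fits
class $C^2$ for the metric. -/
theorem contDiffWithinAt_pullback [IsManifold (mdl k) 3 M]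
    {E : Type*} [NormedAddCommGroup E] [NormedSpace ℝ E]
    {g : BilinField k M} {N : Set M} (hg : IsC2MetricOn g N)
    {F : E → M} {H : Set E} {z : E} (hz : z ∈ H) (hF : ContMDiffOn 𝓘(ℝ, E) (mdl k) 3 F H)
    (hH : UniqueDiffOn ℝ H) (hFN : MapsTo F H N) :
    ContDiffWithinAt ℝ 2 (pullback g F H) H z := by
  set p := F z with hpz
  have hp : F z ∈ (extChartAt (mdl k) p).source := mem_extChartAt_source p
  have hp' : F z ∈ (chartAt (ModelProd (Euc k) ℝ) p).source := mem_chart_source _ _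
  have hcF : ContDiffWithinAt ℝ 3 (extChartAt (mdl k) p ∘ F) H z :=
    ((contMDiffAt_extChartAt' hp').comp_contMDiffWithinAt z (hF z hz)).contDiffWithinAt
  have hcF' : ContDiffWithinAt ℝ 2 (fderivWithin ℝ (extChartAt (mdl k) p ∘ F) H) H z :=
    hcF.fderivWithin_right hH (by norm_num) hz
  have hev : F ⁻¹' (extChartAt (mdl k) p).source ∈ 𝓝[H] z :=
    (hF z hz).continuousWithinAt.preimage_mem_nhdsWithin
      ((isOpen_extChartAt_source (I := mdl k) p).mem_nhds hp)
  have hG := (contMDiffWithinAt_section_iff hp).1 (hg.contMDiffOn _ (hFN hz))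
  have hGF : ContDiffWithinAt ℝ 2 (fun w ↦ coordMetric g p (extChartAt (mdl k) p (F w)))
      (H ∩ F ⁻¹' (extChartAt (mdl k) p).source) z := by
    refine ContDiffWithinAt.comp (g := coordMetric g p) (f := extChartAt (mdl k) p ∘ F)
      (t := coordSet k N p) (n := 2) z hG
      ((hcF.of_le (by norm_num)).mono inter_subset_left) ?_
    rintro w ⟨hw, hw'⟩
    refine ⟨(extChartAt (mdl k) p).map_source hw', ?_⟩
    change (extChartAt (mdl k) p).symm (extChartAt (mdl k) p (F w)) ∈ N
    rw [(extChartAt (mdl k) p).left_inv hw']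
    exact hFN hw
  rw [contDiffWithinAt_inter' hev] at hGF
  refine (contDiffWithinAt_bilinearComp hGF hcF').congr_of_eventuallyEq ?_ ?_
  · filter_upwards [hev, self_mem_nhdsWithin] with w hw hwH
    exact pullback_eq hw ((hF w hwH).mdifferentiableWithinAt (by norm_num)) (hH w hwH)
  · exact pullback_eq hp ((hF z hz).mdifferentiableWithinAt (by norm_num)) (hH z hz)

/-- The tangent space at a point is identified with the model by the preferred chart at that point,
so the derivative of an inverse chart is the derivative of a transition map. -/
theorem mfderiv_extChartAt_symm_apply {p : M} {y : Euc k × ℝ}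
    (hy : y ∈ (extChartAt (mdl k) p).target) (u : Euc k × ℝ) :
    mfderiv 𝓘(ℝ, Euc k × ℝ) (mdl k) (extChartAt (mdl k) p).symm y u =
      fderiv ℝ (extChartAt (mdl k) ((extChartAt (mdl k) p).symm y) ∘ (extChartAt (mdl k) p).symm)
        y u := by
  have h := mdifferentiableWithinAt_extChartAt_symm (I := mdl k) hy
  rw [range_mdl, mdifferentiableWithinAt_univ] at h
  rw [h.mfderiv]
  simp only [modelWithCornersSelf_coe, range_id, fderivWithin_univ]
  rfl

theorem coordMetric_eq_pullback (g : BilinField k M) (p : M) :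
    coordMetric g p = pullback g (extChartAt (mdl k) p).symm univ := by
  ext1 y
  rw [coordMetric, pullback, mfderivWithin_univ]

theorem coordMetric_change {g : BilinField k M} {p p' : M} {y : Euc k × ℝ}
    (hy : y ∈ (extChartAt (mdl k) p).target)
    (hy' : (extChartAt (mdl k) p).symm y ∈ (extChartAt (mdl k) p').source) :
    coordMetric g p y =
      (coordMetric g p' (extChartAt (mdl k) p' ((extChartAt (mdl k) p).symm y))).bilinearComp
        (fderiv ℝ (extChartAt (mdl k) p' ∘ (extChartAt (mdl k) p).symm) y)
        (fderiv ℝ (extChartAt (mdl k) p' ∘ (extChartAt (mdl k) p).symm) y) := by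
  have h := mdifferentiableWithinAt_extChartAt_symm (I := mdl k) hy
  rw [range_mdl] at h
  rw [coordMetric_eq_pullback g p, pullback_eq hy' h uniqueDiffWithinAt_univ, fderivWithin_univ]

/-- The definition uses a different chart at every point. Invariance moves the computation to one
fixed chart, where uniform bounds are available. -/
theorem scalarCurvature_eq [IsManifold (mdl k) 3 M] {g : BilinField k M}
    (hg : IsC2MetricOn g univ) {p p' : M} (hp : p ∈ (extChartAt (mdl k) p').source) :
    scalarCurvature g p = coordScalar (coordMetric g p') (extChartAt (mdl k) p' p) := by
  have hp0 : (extChartAt (mdl k) p).symm (extChartAt (mdl k) p p) = p := extChartAt_to_inv p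
  have hpt := mem_extChartAt_target (I := mdl k) p
  set ψ := extChartAt (mdl k) p' ∘ (extChartAt (mdl k) p).symm with hψ
  have hψz : ψ (extChartAt (mdl k) p p) = extChartAt (mdl k) p' p := by
    rw [hψ, Function.comp_apply, hp0]
  have hψc : ContDiffAt ℝ 3 ψ (extChartAt (mdl k) p p) := by
    have h1 : ContMDiffAt 𝓘(ℝ, Euc k × ℝ) (mdl k) 3 (extChartAt (mdl k) p).symm
      (extChartAt (mdl k) p p) := (contMDiffOn_extChartAt_symm p _ hpt).contMDiffAt
        (extChartAt_target_mem_nhds_of_mem hpt)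
    have h2 : ContMDiffAt (mdl k) 𝓘(ℝ, Euc k × ℝ) 3 (extChartAt (mdl k) p')
      ((extChartAt (mdl k) p).symm (extChartAt (mdl k) p p)) := by
      rw [hp0]; exact contMDiffAt_extChartAt' (by rwa [extChartAt_source] at hp)
    exact (h2.comp _ h1).contDiffAt
  -- A kernel vector of the transition would have length zero for the positive definite form
  -- `coordMetric`.
  have hψi : (fderiv ℝ ψ (extChartAt (mdl k) p p)).IsInvertible := by
    refine isInvertible_of_injective ((injective_iff_map_eq_zero _).2 fun u hu ↦ ?_)
    by_contra hu0
    have h1 := (coordMetric_isInner hpt (g := g) (fun v w ↦ hg.symm _ (mem_univ _) v w)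
      fun v hv ↦ hg.pos _ (mem_univ _) v hv).pos u hu0
    rw [coordMetric_change hpt (by rwa [hp0] : _ ∈ (extChartAt (mdl k) p').source),
      ContinuousLinearMap.bilinearComp_apply, hu] at h1
    simp at h1
  have hcd : ∀ q q' : M, q' ∈ (extChartAt (mdl k) q).source →
      ContDiffAt ℝ 2 (coordMetric g q) (extChartAt (mdl k) q q') := by
    intro q q' hq
    have := (contMDiffWithinAt_section_iff hq).1 (hg.contMDiffOn q' (mem_univ _))
    refine this.contDiffAt ?_
    filter_upwards [extChartAt_target_mem_nhds_of_mem ((extChartAt (mdl k) q).map_source hq)]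
      with y hy using ⟨hy, mem_univ _⟩
  rw [← hψz]
  refine coordScalar_pullback hψc ?_ hψi ?_ ?_ (hcd _ _ (mem_extChartAt_source p))
  · rw [hψz]; exact hcd _ _ hp
  · rw [hψz]
    filter_upwards [extChartAt_target_mem_nhds_of_mem ((extChartAt (mdl k) p').map_source hp)]
      with y hy
    exact coordMetric_isInner hy (fun v w ↦ hg.symm _ (mem_univ _) v w)
      fun v hv ↦ hg.pos _ (mem_univ _) v hv
  · have h1 : ∀ᶠ y in 𝓝 (extChartAt (mdl k) p p),
      (extChartAt (mdl k) p).symm y ∈ (extChartAt (mdl k) p').source := by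
      refine (continuousAt_extChartAt_symm p).preimage_mem_nhds ?_
      rw [hp0]
      exact (isOpen_extChartAt_source (I := mdl k) p').mem_nhds hp
    filter_upwards [h1, extChartAt_target_mem_nhds_of_mem hpt] with y hy hy'
    exact coordMetric_change hy' hy

end Manifold

section Manifold

variable {k : ℕ} {M : Type*} [TopologicalSpace M] [ChartedSpace (ModelProd (Euc k) ℝ) M]
  [IsManifold (mdl k) 1 M]

/-- The transition from the preferred chart at `p` to itself is the identity, so at its own base
point the coordinate expression is the form itself. -/
theorem coordMetric_self_apply (g : BilinField k M) (p : M) (u v : Euc k × ℝ) :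
    coordMetric g p (extChartAt (mdl k) p p) u v = g p u v := by
  have hpt := mem_extChartAt_target (I := mdl k) p
  have h : ∀ w : Euc k × ℝ, mfderiv 𝓘(ℝ, Euc k × ℝ) (mdl k) (extChartAt (mdl k) p).symm
      (extChartAt (mdl k) p p) w = w := by
    intro w
    rw [mfderiv_extChartAt_symm_apply hpt, extChartAt_to_inv]
    have : extChartAt (mdl k) p ∘ (extChartAt (mdl k) p).symm =ᶠ[𝓝 (extChartAt (mdl k) p p)] id := by
      filter_upwards [extChartAt_target_mem_nhds_of_mem hpt] with y hy
      exact (extChartAt (mdl k) p).right_inv hy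
    rw [this.fderiv_eq, fderiv_id]
    rfl
  rw [coordMetric_apply, h, h]
  have key : ∀ q : M, q = p → (g q : (Euc k × ℝ) →L[ℝ] (Euc k × ℝ) →L[ℝ] ℝ) u v = g p u v := by
    rintro q rfl; rfl
  exact key _ (extChartAt_to_inv p)

end Manifold

/-! ### The two sides of the hypersurface and the collar charts of the glued manifold. -/

section Corners

variable {k : ℕ}
  {S : Type*} [TopologicalSpace S] [ChartedSpace (Euc k) S]
  {M : Type*} [TopologicalSpace M] [ChartedSpace (ModelProd (Euc k) ℝ) M]
  [IsManifold (mdl k) ∞ M] {Ω : Set M} {ι : S → M}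
  {G : CornerMetric k Ω ι} (c : GaussianCollar G)

/-- The interval of definition of a collar. -/
abbrev GaussianCollar.int : Set ℝ := Ioo (-(2 * c.ε)) (2 * c.ε)

theorem GaussianCollar.mem_source {x : S} {t : ℝ} : (x, t) ∈ c.Φ.source ↔ t ∈ c.int := by
  rw [c.source_eq]; simp

theorem GaussianCollar.zero_mem_int : (0 : ℝ) ∈ c.int := by
  have := c.ε_pos; constructor <;> linarith

/-- One side of the hypersurface: `N` is `closure Ω` or `Ωᶜ`, described by the coordinates
`t ∈ J` in the collar, and `g` is the metric on this side. -/
structure IsSide (N : Set M) (J : Set ℝ) (g : BilinField k M) : Prop where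
  subset : J ⊆ c.int
  zero_mem : (0 : ℝ) ∈ J
  convex : Convex ℝ J
  nonempty : (interior J).Nonempty
  mem_iff : ∀ x, ∀ t ∈ c.int, c.Φ (x, t) ∈ N ↔ t ∈ J
  isOpen_diff : IsOpen (N \ frontier Ω)
  contMDiffOn : ContMDiffOn (mdl k) (mdl k) 3 c.Φ (univ ×ˢ J)
  contMDiffOn_symm : ContMDiffOn (mdl k) (mdl k) 3 c.Φ.symm (c.Φ.target ∩ N)
  gauss : ∀ x, ∀ t ∈ J, ∀ (v : Euc k) (a : ℝ),
    g (c.Φ (x, t))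
      (mfderivWithin (mdl k) (mdl k) c.Φ (univ ×ˢ J) (x, t) ((0, 1) : Euc k × ℝ))
      (mfderivWithin (mdl k) (mdl k) c.Φ (univ ×ˢ J) (x, t) ((v, a) : Euc k × ℝ)) = a
  isMetric : IsC2MetricOn g N

theorem apply_zero_mem_frontier (x : S) : c.Φ (x, 0) ∈ frontier Ω := by
  rw [c.apply_zero, G.isSmoothBoundary.frontier_eq]; exact mem_range_self _

theorem isSide_neg : IsSide c (closure Ω) (Ioc (-(2 * c.ε)) 0) G.gm := by
  have hε := c.ε_pos
  refine ⟨fun t ht ↦ ⟨ht.1, by linarith [ht.2]⟩, ⟨by linarith, le_rfl⟩, convex_Ioc _ _, ?_, ?_, ?_,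
    c.contMDiffOn_neg, c.contMDiffOn_symm_neg, c.gauss_neg, G.isMetric_gm⟩
  · rw [interior_Ioc]; exact nonempty_Ioo.2 (by linarith)
  · intro x t ht
    rcases lt_trichotomy t 0 with h | rfl | h
    · exact iff_of_true (subset_closure (c.mem_of_neg x t ⟨ht.1, h⟩)) ⟨ht.1, h.le⟩
    · exact iff_of_true (frontier_subset_closure (apply_zero_mem_frontier c x)) ⟨ht.1, le_rfl⟩
    · exact iff_of_false (c.mem_of_pos x t ⟨h, ht.2⟩) (fun h' ↦ h.not_ge h'.2)
  · have : closure Ω \ frontier Ω = interior Ω := closure_sdiff_frontier Ω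
    rw [this]; exact isOpen_interior

theorem isSide_pos : IsSide c Ωᶜ (Ico 0 (2 * c.ε)) G.gp := by
  have hε := c.ε_pos
  refine ⟨fun t ht ↦ ⟨by linarith [ht.1], ht.2⟩, ⟨le_rfl, by linarith⟩, convex_Ico _ _, ?_, ?_, ?_,
    c.contMDiffOn_pos, c.contMDiffOn_symm_pos, c.gauss_pos, G.isMetric_gp⟩
  · rw [interior_Ico]; exact nonempty_Ioo.2 (by linarith)
  · intro x t ht
    rcases lt_trichotomy t 0 with h | rfl | h
    · exact iff_of_false (fun h' ↦ h' (c.mem_of_neg x t ⟨ht.1, h⟩)) (fun h' ↦ h.not_ge h'.1)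
    · refine iff_of_true ?_ ⟨le_rfl, ht.2⟩
      have := apply_zero_mem_frontier c x
      rw [G.isSmoothBoundary.isOpen.frontier_eq] at this
      exact this.2
    · exact iff_of_true (fun h' ↦ c.mem_of_pos x t ⟨h, ht.2⟩ (subset_closure h')) ⟨h.le, ht.2⟩
  · have : Ωᶜ \ frontier Ω = (closure Ω)ᶜ := by
      rw [G.isSmoothBoundary.isOpen.frontier_eq]
      ext q
      simp only [mem_sdiff, mem_compl_iff]
      constructor
      · rintro ⟨h1, h2⟩ h3; exact h2 ⟨h3, h1⟩
      · intro h; exact ⟨fun h' ↦ h (subset_closure h'), fun h' ↦ h h'.1⟩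
    rw [this]; exact isClosed_closure.isOpen_compl

namespace Glued

/-- The point of `M̃` with collar coordinates `(x, t)`. -/
def pt (x : S) (t : ℝ) : Glued c := ofM c (c.Φ (x, t))

theorem chartAt_of_mem {p : Glued c} (hp : toM c p ∈ c.Φ.target) :
    chartAt (ModelProd (Euc k) ℝ) p = collarChart c (chartAt (Euc k) (c.Φ.symm (toM c p)).1) :=
  if_pos hp

theorem chartAt_of_notMem {p : Glued c} (hp : toM c p ∉ c.Φ.target) :
    chartAt (ModelProd (Euc k) ℝ) p = offChart c (chartAt (ModelProd (Euc k) ℝ) (toM c p)) :=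
  if_neg hp

theorem toM_pt_mem {x : S} {t : ℝ} (ht : t ∈ c.int) : toM c (pt c x t) ∈ c.Φ.target :=
  c.Φ.map_source (c.mem_source.2 ht)

theorem symm_toM_pt {x : S} {t : ℝ} (ht : t ∈ c.int) : c.Φ.symm (toM c (pt c x t)) = (x, t) :=
  c.Φ.left_inv (c.mem_source.2 ht)

theorem exists_eq_pt {p : Glued c} (hp : toM c p ∈ c.Φ.target) :
    ∃ x, ∃ t ∈ c.int, p = pt c x t := by
  refine ⟨(c.Φ.symm (toM c p)).1, (c.Φ.symm (toM c p)).2, ?_, ?_⟩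
  · exact c.mem_source.1 (c.Φ.map_target hp)
  · exact (c.Φ.right_inv hp).symm

theorem chartAt_pt {x : S} {t : ℝ} (ht : t ∈ c.int) :
    chartAt (ModelProd (Euc k) ℝ) (pt c x t) = collarChart c (chartAt (Euc k) x) := by
  rw [chartAt_of_mem c (toM_pt_mem c ht), symm_toM_pt c ht]

variable {c} in
theorem extChartAt_pt_apply {x : S} {t : ℝ} (ht : t ∈ c.int) (q : Glued c) :
    extChartAt (mdl k) (pt c x t) q = extChartAt (mdl k) (x, t) (c.Φ.symm (toM c q)) := by
  rw [extChartAt, chartAt_pt c ht]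
  rfl

variable {c} in
theorem extChartAt_pt_symm_apply {x : S} {t : ℝ} (ht : t ∈ c.int) (y : Euc k × ℝ) :
    (extChartAt (mdl k) (pt c x t)).symm y = ofM c (c.Φ ((extChartAt (mdl k) (x, t)).symm y)) := by
  rw [extChartAt, chartAt_pt c ht]
  rfl

variable {c} in
theorem extChartAt_pt_symm_apply' {x : S} {t : ℝ} (ht : t ∈ c.int) (y : Euc k × ℝ) :
    (extChartAt (mdl k) (pt c x t)).symm y = pt c ((chartAt (Euc k) x).symm y.1) y.2 := by
  rw [extChartAt, chartAt_pt c ht]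
  rfl

variable {c} in
theorem extChartAt_pt_pt {x x' : S} {t t' : ℝ} (ht : t ∈ c.int) (ht' : t' ∈ c.int) :
    extChartAt (mdl k) (pt c x t) (pt c x' t') = (chartAt (Euc k) x x', t') := by
  rw [extChartAt_pt_apply ht, symm_toM_pt c ht']
  rfl

variable {c} in
theorem extChartAt_pt_source {x : S} {t : ℝ} (ht : t ∈ c.int) :
    (extChartAt (mdl k) (pt c x t)).source =
      toM c ⁻¹' (c.Φ.target ∩ c.Φ.symm ⁻¹' ((chartAt (Euc k) x).source ×ˢ univ)) := by
  rw [extChartAt_source, chartAt_pt c ht]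
  rfl

variable {c} in
theorem extChartAt_pt_target {x : S} {t : ℝ} (ht : t ∈ c.int) :
    (extChartAt (mdl k) (pt c x t)).target = (chartAt (Euc k) x).target ×ˢ c.int := by
  rw [extChartAt_target, chartAt_pt c ht, range_mdl, inter_univ]
  ext ⟨y, s⟩
  have h1 : (y, s) ∈ (mdl k).symm ⁻¹' (collarChart c (chartAt (Euc k) x)).target ↔
    ((y ∈ (chartAt (Euc k) x).target ∧ s ∈ univ) ∧
      ((chartAt (Euc k) x).symm y, s) ∈ c.Φ.source) := Iff.rfl
  rw [h1, c.mem_source]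
  simp

end Glued
end Corners

/-! ### One-sided smoothness of the identity map to `M` and of the pulled-back metrics. -/

section Corners

variable {k : ℕ}
  {S : Type*} [TopologicalSpace S] [ChartedSpace (Euc k) S] [IsManifold 𝓘(ℝ, Euc k) ∞ S]
  {M : Type*} [TopologicalSpace M] [ChartedSpace (ModelProd (Euc k) ℝ) M]
  [IsManifold (mdl k) ∞ M] {Ω : Set M} {ι : S → M}
  {G : CornerMetric k Ω ι} {c : GaussianCollar G}

namespace Glued

theorem continuous_toM : Continuous (toM c) := continuous_id

theorem extChartAt_off_apply {p : Glued c} (hp : toM c p ∉ c.Φ.target) (q : Glued c) :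
    extChartAt (mdl k) p q = extChartAt (mdl k) (toM c p) (toM c q) := by
  rw [extChartAt, chartAt_of_notMem c hp]
  rfl

theorem extChartAt_off_symm_apply {p : Glued c} (hp : toM c p ∉ c.Φ.target) (y : Euc k × ℝ) :
    (extChartAt (mdl k) p).symm y = ofM c ((extChartAt (mdl k) (toM c p)).symm y) := by
  rw [extChartAt, chartAt_of_notMem c hp]
  rfl

theorem extChartAt_off_source {p : Glued c} (hp : toM c p ∉ c.Φ.target) :
    (extChartAt (mdl k) p).source =
      toM c ⁻¹' ((extChartAt (mdl k) (toM c p)).source ∩ (frontier Ω)ᶜ) := by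
  rw [extChartAt_source, extChartAt_source, chartAt_of_notMem c hp]
  have : (offChart c (chartAt (ModelProd (Euc k) ℝ) (toM c p))).source = toM c ⁻¹'
    ((chartAt (ModelProd (Euc k) ℝ) (toM c p)).source ∩ interior (frontier Ω)ᶜ) := rfl
  rw [this, isClosed_frontier.isOpen_compl.interior_eq]

theorem extChartAt_off_target_subset {p : Glued c} (hp : toM c p ∉ c.Φ.target) :
    (extChartAt (mdl k) p).target ⊆ (extChartAt (mdl k) (toM c p)).target := by
  intro y hy
  have h := (extChartAt (mdl k) p).map_target hy
  rw [extChartAt_off_source hp, extChartAt_off_symm_apply hp] at h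
  have h2 := (extChartAt (mdl k) (toM c p)).map_source h.1
  have h3 := (extChartAt (mdl k) p).right_inv hy
  rw [extChartAt_off_symm_apply hp, extChartAt_off_apply hp] at h3
  exact h3 ▸ h2

/-- The pull-back to `M̃` of the metric `g` on the region `N` of `M`. -/
def sideMetric (c : GaussianCollar G) (N : Set M) (g : BilinField k M) (p : Glued c) :
    TangentSpace (mdl k) p →L[ℝ] TangentSpace (mdl k) p →L[ℝ] ℝ :=
  ContinuousLinearMap.bilinearComp (E := Euc k × ℝ) (F := Euc k × ℝ)
      (E' := Euc k × ℝ) (F' := Euc k × ℝ) (g (toM c p))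
      (mfderivWithin (mdl k) (mdl k) (toM c) (toM c ⁻¹' N) p)
      (mfderivWithin (mdl k) (mdl k) (toM c) (toM c ⁻¹' N) p)

theorem sideMetric_apply (N : Set M) (g : BilinField k M) (p : Glued c) (u v : Euc k × ℝ) :
    sideMetric c N g p u v = g (toM c p)
      (mfderivWithin (mdl k) (mdl k) (toM c) (toM c ⁻¹' N) p u)
      (mfderivWithin (mdl k) (mdl k) (toM c) (toM c ⁻¹' N) p v) := rfl

end Glued

open Glued

namespace IsSide

variable {N : Set M} {J : Set ℝ} {g : BilinField k M} (hs : IsSide c N J g)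

include hs

theorem coordSet_pt {x : S} {t : ℝ} (ht : t ∈ c.int) :
    coordSet k (toM c ⁻¹' N) (pt c x t) = (chartAt (Euc k) x).target ×ˢ J := by
  ext ⟨y, s⟩
  rw [coordSet, extChartAt_pt_target ht]
  constructor
  · rintro ⟨h1, h2⟩
    refine ⟨h1.1, ?_⟩
    rw [mem_preimage, extChartAt_pt_symm_apply' ht] at h2
    exact (hs.mem_iff _ _ h1.2).1 h2
  · rintro ⟨h1, h2⟩
    refine ⟨⟨h1, hs.subset h2⟩, ?_⟩
    rw [mem_preimage, extChartAt_pt_symm_apply' ht]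
    exact (hs.mem_iff _ _ (hs.subset h2)).2 h2

theorem uniqueDiffOn : UniqueDiffOn ℝ J := uniqueDiffOn_convex hs.convex hs.nonempty

/-- Charts centred off the collar avoid the frontier, where a side is open; one-sided derivatives
are ordinary ones there. -/
theorem isOpen_coordSet_of_notMem {p : Glued c} (hp : toM c p ∉ c.Φ.target) :
    IsOpen (coordSet k (toM c ⁻¹' N) p) := by
  have : coordSet k (toM c ⁻¹' N) p =
      (extChartAt (mdl k) p).target ∩ (extChartAt (mdl k) p).symm ⁻¹' (toM c ⁻¹' (N \ frontier Ω)) := by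
    ext y
    refine ⟨fun h ↦ ⟨h.1, h.2, ?_⟩, fun h ↦ ⟨h.1, h.2.1⟩⟩
    have h' := (extChartAt (mdl k) p).map_target h.1
    rw [extChartAt_off_source hp] at h'
    exact h'.2
  rw [this]
  exact (continuousOn_extChartAt_symm p).isOpen_inter_preimage (isOpen_extChartAt_target p)
    (hs.isOpen_diff.preimage continuous_toM)

theorem uniqueDiffOn_coordSet (p : Glued c) : UniqueDiffOn ℝ (coordSet k (toM c ⁻¹' N) p) := by
  by_cases hp : toM c p ∈ c.Φ.target
  · obtain ⟨x, t, ht, rfl⟩ := exists_eq_pt c hp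
    rw [hs.coordSet_pt ht]
    exact (chartAt (Euc k) x).open_target.uniqueDiffOn.prod hs.uniqueDiffOn
  · exact (hs.isOpen_coordSet_of_notMem hp).uniqueDiffOn

/-- The identity from $\tilde M$ to `M` need not be differentiable across $\Sigma$. Restricted to
one side it reads in collar charts as the $C^3$ map $\Phi_\pm$, and elsewhere as the inverse of a
chart of `M`. -/
theorem contMDiffOn_toM_symm (p : Glued c) :
    ContMDiffOn 𝓘(ℝ, Euc k × ℝ) (mdl k) 3 (toM c ∘ (extChartAt (mdl k) p).symm)
      (coordSet k (toM c ⁻¹' N) p) := by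
  by_cases hp : toM c p ∈ c.Φ.target
  · obtain ⟨x, t, ht, rfl⟩ := exists_eq_pt c hp
    rw [hs.coordSet_pt ht]
    have i2 : IsManifold 𝓘(ℝ, Euc k) 3 S := inferInstance
    have h1 := contMDiffOn_extChartAt_symm (I := mdl k) (n := 3) ((x, t) : S × ℝ)
    have h2 := hs.contMDiffOn.comp (h1.mono (t := (chartAt (Euc k) x).target ×ˢ J) ?_) ?_
    · refine h2.congr fun y hy ↦ ?_
      rw [Function.comp_apply, extChartAt_pt_symm_apply ht]
      rfl
    · intro y hy
      rw [extChartAt_target, range_mdl, inter_univ]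
      exact ⟨hy.1, mem_univ _⟩
    · intro y hy
      exact ⟨mem_univ _, hy.2⟩
  · have i2 : IsManifold (mdl k) 3 M := inferInstance
    have h1 := contMDiffOn_extChartAt_symm (I := mdl k) (n := 3) (toM c p)
    refine (h1.mono fun y hy ↦ extChartAt_off_target_subset hp hy.1).congr fun y hy ↦ ?_
    rw [Function.comp_apply, extChartAt_off_symm_apply hp]
    rfl

theorem contMDiffOn_extChartAt_ofM (p : Glued c) :
    ContMDiffOn (mdl k) 𝓘(ℝ, Euc k × ℝ) 3 (extChartAt (mdl k) p ∘ ofM c)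
      (N ∩ ofM c ⁻¹' (extChartAt (mdl k) p).source) := by
  by_cases hp : toM c p ∈ c.Φ.target
  · obtain ⟨x, t, ht, rfl⟩ := exists_eq_pt c hp
    have i2 : IsManifold 𝓘(ℝ, Euc k) 3 S := inferInstance
    have h1 := contMDiffOn_extChartAt (I := mdl k) (n := 3) (x := ((x, t) : S × ℝ))
    rw [extChartAt_pt_source ht]
    have h2 := h1.comp (hs.contMDiffOn_symm.mono
      (t := (N ∩ ofM c ⁻¹' (toM c ⁻¹' (c.Φ.target ∩ c.Φ.symm ⁻¹'
        ((chartAt (Euc k) x).source ×ˢ univ))))) ?_) ?_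
    · exact h2.congr fun q hq ↦ extChartAt_pt_apply ht _
    · intro q hq; exact ⟨hq.2.1, hq.1⟩
    · intro q hq; exact hq.2.2
  · have i2 : IsManifold (mdl k) 3 M := inferInstance
    have h1 := contMDiffOn_extChartAt (I := mdl k) (n := 3) (x := toM c p)
    refine (h1.mono fun q hq ↦ ?_).congr fun q hq ↦ extChartAt_off_apply hp _
    have := hq.2
    rw [extChartAt_off_source hp] at this
    have h := this.1
    rwa [extChartAt_source] at h

theorem contMDiffWithinAt_toM {p : Glued c} (hp : toM c p ∈ N) :
    ContMDiffWithinAt (mdl k) (mdl k) 3 (toM c) (toM c ⁻¹' N) p := by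
  rw [contMDiffWithinAt_iff_source]
  have hy : extChartAt (mdl k) p p ∈ coordSet k (toM c ⁻¹' N) p :=
    ⟨mem_extChartAt_target p, by rwa [mem_preimage, extChartAt_to_inv]⟩
  refine (hs.contMDiffOn_toM_symm p _ hy).mono_of_mem_nhdsWithin ?_
  rw [range_mdl, inter_univ, coordSet, inter_comm]
  exact inter_mem_nhdsWithin _ (extChartAt_target_mem_nhds p)

theorem coordMetric_sideMetric {p : Glued c} {y : Euc k × ℝ}
    (hy : y ∈ coordSet k (toM c ⁻¹' N) p) :
    coordMetric (sideMetric c N g) p y =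
      pullback g (toM c ∘ (extChartAt (mdl k) p).symm) (coordSet k (toM c ⁻¹' N) p) y := by
  have hu := hs.uniqueDiffOn_coordSet p y hy
  have h0 : MDifferentiableAt 𝓘(ℝ, Euc k × ℝ) (mdl k) (extChartAt (mdl k) p).symm y := by
    have := mdifferentiableWithinAt_extChartAt_symm (I := mdl k) hy.1
    rwa [range_mdl, mdifferentiableWithinAt_univ] at this
  have h1 := mfderivWithin_comp y
    ((hs.contMDiffWithinAt_toM (p := (extChartAt (mdl k) p).symm y) hy.2).mdifferentiableWithinAt
      (by norm_num)) h0.mdifferentiableWithinAt (s := coordSet k (toM c ⁻¹' N) p)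
      (fun z hz ↦ hz.2) hu.uniqueMDiffWithinAt
  rw [mfderivWithin_eq_mfderiv hu.uniqueMDiffWithinAt h0] at h1
  refine ContinuousLinearMap.ext fun u ↦ ContinuousLinearMap.ext fun v ↦ ?_
  rw [coordMetric_apply, pullback_apply, h1]
  rfl

theorem contDiffOn_coordMetric_sideMetric (p : Glued c) :
    ContDiffOn ℝ 2 (coordMetric (sideMetric c N g) p) (coordSet k (toM c ⁻¹' N) p) := by
  have i2 : IsManifold (mdl k) 3 M := inferInstance
  have h : ContDiffOn ℝ 2 (pullback g (toM c ∘ (extChartAt (mdl k) p).symm)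
      (coordSet k (toM c ⁻¹' N) p)) (coordSet k (toM c ⁻¹' N) p) := fun z hz ↦
    contDiffWithinAt_pullback hs.isMetric hz (hs.contMDiffOn_toM_symm p)
      (hs.uniqueDiffOn_coordSet p) (fun y hy ↦ hy.2)
  exact h.congr fun y hy ↦ hs.coordMetric_sideMetric hy

/-- The identity is $C^3$ in the opposite direction too on each side, and the chain rule makes its
derivative a left inverse. Injectivity is what preserves positive definiteness. -/
theorem mfderivWithin_toM_symm_injective {p : Glued c} {y : Euc k × ℝ}
    (hy : y ∈ coordSet k (toM c ⁻¹' N) p) :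
    Function.Injective (mfderivWithin 𝓘(ℝ, Euc k × ℝ) (mdl k)
      (toM c ∘ (extChartAt (mdl k) p).symm) (coordSet k (toM c ⁻¹' N) p) y) := by
  set F := toM c ∘ (extChartAt (mdl k) p).symm with hF
  set H := coordSet k (toM c ⁻¹' N) p with hH
  have hu : UniqueMDiffWithinAt 𝓘(ℝ, Euc k × ℝ) H y :=
    (hs.uniqueDiffOn_coordSet p y hy).uniqueMDiffWithinAt
  have hmaps : H ⊆ F ⁻¹' (N ∩ ofM c ⁻¹' (extChartAt (mdl k) p).source) := fun z hz ↦
    ⟨hz.2, (extChartAt (mdl k) p).map_target hz.1⟩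
  have h1 := mfderivWithin_comp y
    ((hs.contMDiffOn_extChartAt_ofM p _ (hmaps hy)).mdifferentiableWithinAt (by norm_num))
    ((hs.contMDiffOn_toM_symm p y hy).mdifferentiableWithinAt (by norm_num)) hmaps hu
  have h2 : mfderivWithin 𝓘(ℝ, Euc k × ℝ) 𝓘(ℝ, Euc k × ℝ) ((extChartAt (mdl k) p ∘ ofM c) ∘ F) H y =
      mfderivWithin 𝓘(ℝ, Euc k × ℝ) 𝓘(ℝ, Euc k × ℝ) id H y := by
    apply mfderivWithin_congr
    · intro z hz; exact (extChartAt (mdl k) p).right_inv hz.1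
    · exact (extChartAt (mdl k) p).right_inv hy.1
  rw [mfderivWithin_id hu] at h2
  intro u v huv
  have h3 : ∀ w, mfderivWithin 𝓘(ℝ, Euc k × ℝ) 𝓘(ℝ, Euc k × ℝ)
    ((extChartAt (mdl k) p ∘ ofM c) ∘ F) H y w = w := fun w ↦ by rw [h2]; rfl
  rw [h1] at h3
  rw [← h3 u, ← h3 v]
  exact congrArg (mfderivWithin (mdl k) 𝓘(ℝ, Euc k × ℝ) (extChartAt (mdl k) p ∘ ofM c)
    (N ∩ ofM c ⁻¹' (extChartAt (mdl k) p).source) (F y)) huv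

theorem isInner_sideMetric {p : Glued c} (hp : toM c p ∈ N) :
    IsInner (E := Euc k × ℝ) (sideMetric c N g p) := by
  have hy : extChartAt (mdl k) p p ∈ coordSet k (toM c ⁻¹' N) p :=
    ⟨mem_extChartAt_target p, by rwa [mem_preimage, extChartAt_to_inv]⟩
  have key : ∀ u v : Euc k × ℝ, sideMetric c N g p u v = pullback g
      (toM c ∘ (extChartAt (mdl k) p).symm) (coordSet k (toM c ⁻¹' N) p) (extChartAt (mdl k) p p) u v :=
    fun u v ↦ by rw [← hs.coordMetric_sideMetric hy, coordMetric_self_apply]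
  refine ⟨fun u v ↦ ?_, fun u hu ↦ ?_⟩
  · exact hs.isMetric.symm _ hp _ _
  · refine (key u u).symm ▸ ?_
    rw [pullback_apply]
    refine hs.isMetric.pos _ hy.2 _ fun h0 ↦ hu ?_
    exact hs.mfderivWithin_toM_symm_injective hy (h0.trans (map_zero _).symm)

end IsSide
end Corners

theorem IsInner.apply_eq_of_normal {F : Type*} [NormedAddCommGroup F] [NormedSpace ℝ F]
    {B : (F × ℝ) →L[ℝ] (F × ℝ) →L[ℝ] ℝ} (hI : IsInner B) (hn : ∀ u, B (0, 1) u = u.2)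
    (v w : F) (a b : ℝ) : B (v, a) (w, b) = B (v, 0) (w, 0) + a * b := by
  have e1 : ((v, a) : F × ℝ) = (v, 0) + a • (0, 1) := by simp
  have e2 : ((w, b) : F × ℝ) = (w, 0) + b • (0, 1) := by simp
  have h1 : B (v, 0) (0, 1) = 0 := by rw [hI.symm, hn]
  rw [e1, e2]
  simp only [map_add, map_smul, add_apply, smul_apply, hn, h1, smul_eq_mul]
  simp [mul_comm]

/-! ### Agreement of the two metrics along the hypersurface. -/

section Corners

variable {k : ℕ}
  {S : Type*} [TopologicalSpace S] [ChartedSpace (Euc k) S] [IsManifold 𝓘(ℝ, Euc k) ∞ S]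
  {M : Type*} [TopologicalSpace M] [ChartedSpace (ModelProd (Euc k) ℝ) M]
  [IsManifold (mdl k) ∞ M] {Ω : Set M} {ι : S → M}
  {G : CornerMetric k Ω ι} {c : GaussianCollar G}

open Glued

namespace IsSide

variable {N : Set M} {J : Set ℝ} {g : BilinField k M} (hs : IsSide c N J g)

include hs

/-- Written in the preferred charts at corresponding points, the identity to `M` and the collar `Φ`
are the same map on sets that agree nearby. This transfers the Gauss condition to $\tilde M$. -/
theorem mfderivWithin_toM_pt {x : S} {t : ℝ} (ht : t ∈ J) (u : Euc k × ℝ) :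
    (mfderivWithin (mdl k) (mdl k) (toM c) (toM c ⁻¹' N) (pt c x t) u : Euc k × ℝ) =
      mfderivWithin (mdl k) (mdl k) c.Φ (univ ×ˢ J) (x, t) u := by
  have ht' := hs.subset ht
  have h1 : MDifferentiableWithinAt (mdl k) (mdl k) (toM c) (toM c ⁻¹' N) (pt c x t) :=
    (hs.contMDiffWithinAt_toM ((hs.mem_iff x t ht').2 ht)).mdifferentiableWithinAt (by norm_num)
  have h2 : MDifferentiableWithinAt (mdl k) (mdl k) c.Φ (univ ×ˢ J) (x, t) :=
    (hs.contMDiffOn (x, t) ⟨mem_univ _, ht⟩).mdifferentiableWithinAt (by norm_num)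
  refine (DFunLike.congr_fun h1.mfderivWithin u).trans ?_
  refine Eq.trans ?_ (DFunLike.congr_fun h2.mfderivWithin u).symm
  have hf : writtenInExtChartAt (mdl k) (mdl k) (pt c x t) (toM c) =
      writtenInExtChartAt (mdl k) (mdl k) (x, t) c.Φ := by
    ext1 y
    simp only [writtenInExtChartAt, Function.comp_apply]
    rw [extChartAt_pt_symm_apply ht']
    rfl
  have hp : extChartAt (mdl k) (pt c x t) (pt c x t) = extChartAt (mdl k) (x, t) (x, t) := by
    rw [extChartAt_pt_apply ht', symm_toM_pt c ht']
  rw [hf, hp]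
  have hset : ∀ᶠ y in 𝓝 (extChartAt (mdl k) (x, t) (x, t)),
      y ∈ (extChartAt (mdl k) (pt c x t)).symm ⁻¹' (toM c ⁻¹' N) ∩ range (mdl k) ↔
      y ∈ (extChartAt (mdl k) (x, t)).symm ⁻¹' (univ ×ˢ J) ∩ range (mdl k) := by
    have h3 : ∀ᶠ y : Euc k × ℝ in 𝓝 (extChartAt (mdl k) (x, t) (x, t)), y.2 ∈ c.int := by
      refine continuous_snd.continuousAt.preimage_mem_nhds ?_
      exact isOpen_Ioo.mem_nhds ht'
    filter_upwards [h3] with y hy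
    rw [range_mdl, inter_univ, inter_univ, mem_preimage, extChartAt_pt_symm_apply' ht']
    refine (hs.mem_iff _ _ hy).trans ?_
    exact ⟨fun h ↦ ⟨mem_univ _, h⟩, fun h ↦ h.2⟩
  rw [fderivWithin_congr_set (Filter.eventuallyEq_set.2 hset)]
  rfl

theorem sideMetric_normal {x : S} {t : ℝ} (ht : t ∈ J) (u : Euc k × ℝ) :
    sideMetric c N g (pt c x t) ((0, 1) : Euc k × ℝ) u = u.2 := by
  rw [sideMetric_apply]
  erw [hs.mfderivWithin_toM_pt ht, hs.mfderivWithin_toM_pt ht]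
  exact hs.gauss x t ht u.1 u.2

theorem mfderivWithin_zero (x : S) (v : Euc k) :
    (mfderivWithin (mdl k) (mdl k) c.Φ (univ ×ˢ J) (x, 0) ((v, 0) : Euc k × ℝ) : Euc k × ℝ) =
      mfderiv 𝓘(ℝ, Euc k) (mdl k) ι x v := by
  have key : ∀ f : S → M, f = ι → (mfderiv 𝓘(ℝ, Euc k) (mdl k) f x v : Euc k × ℝ) =
      mfderiv 𝓘(ℝ, Euc k) (mdl k) ι x v := by rintro f rfl; rfl
  have hf : c.Φ ∘ (fun x : S ↦ (x, (0 : ℝ))) = ι := funext c.apply_zero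
  rw [← key _ hf, ← mfderivWithin_univ]
  have h2 : MDifferentiableWithinAt (mdl k) (mdl k) c.Φ (univ ×ˢ J) (x, (0 : ℝ)) :=
    (hs.contMDiffOn (x, 0) ⟨mem_univ _, hs.zero_mem⟩).mdifferentiableWithinAt (by norm_num)
  have h3 : MDifferentiableAt 𝓘(ℝ, Euc k) (mdl k) (fun x : S ↦ (x, (0 : ℝ))) x :=
    mdifferentiableAt_id.prodMk mdifferentiableAt_const
  rw [mfderivWithin_comp x h2 h3.mdifferentiableWithinAt
    (s := univ) (fun x _ ↦ mk_mem_prod (mem_univ x) hs.zero_mem) (uniqueMDiffWithinAt_univ _), mfderivWithin_univ,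
    mfderiv_prod_left]
  rfl

/-- Along $\Sigma$ the pulled-back metric is the induced metric plus $dt^2$. Only the induced metric
depends on the side, so the two sides agree there. -/
theorem sideMetric_zero (x : S) (v w : Euc k) (a b : ℝ) :
    sideMetric c N g (pt c x 0) ((v, a) : Euc k × ℝ) ((w, b) : Euc k × ℝ) =
      g (ι x) (mfderiv 𝓘(ℝ, Euc k) (mdl k) ι x v) (mfderiv 𝓘(ℝ, Euc k) (mdl k) ι x w) + a * b := by
  have hI : IsInner (E := Euc k × ℝ) (sideMetric c N g (pt c x 0)) :=
    hs.isInner_sideMetric ((hs.mem_iff x 0 c.zero_mem_int).2 hs.zero_mem)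
  have hn : ∀ u : Euc k × ℝ, sideMetric c N g (pt c x 0) ((0, 1) : Euc k × ℝ) u = u.2 :=
    fun u ↦ hs.sideMetric_normal hs.zero_mem u
  have h0 : sideMetric c N g (pt c x 0) ((v, 0) : Euc k × ℝ) ((w, 0) : Euc k × ℝ) =
      g (ι x) (mfderiv 𝓘(ℝ, Euc k) (mdl k) ι x v) (mfderiv 𝓘(ℝ, Euc k) (mdl k) ι x w) := by
    have key : ∀ q : M, q = ι x → ∀ u v : Euc k × ℝ,
      (g q : (Euc k × ℝ) →L[ℝ] (Euc k × ℝ) →L[ℝ] ℝ) u v = g (ι x) u v := by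
      rintro q rfl u v; rfl
    rw [sideMetric_apply]
    erw [hs.mfderivWithin_toM_pt hs.zero_mem, hs.mfderivWithin_toM_pt hs.zero_mem,
      hs.mfderivWithin_zero, hs.mfderivWithin_zero]
    exact key _ (c.apply_zero x) _ _
  rw [← h0]
  exact hI.apply_eq_of_normal hn v w a b

end IsSide

variable (c) in
theorem Glued.sideMetric_neg_eq_pos (x : S) :
    sideMetric c (closure Ω) G.gm (pt c x 0) = sideMetric c Ωᶜ G.gp (pt c x 0) := by
  refine ContinuousLinearMap.ext fun u ↦ ContinuousLinearMap.ext fun v ↦ ?_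
  have h1 := (isSide_neg c).sideMetric_zero x (Prod.fst u) (Prod.fst v) (Prod.snd u) (Prod.snd v)
  have h2 := (isSide_pos c).sideMetric_zero x (Prod.fst u) (Prod.fst v) (Prod.snd u) (Prod.snd v)
  exact h1.trans ((congrArg (· + Prod.snd u * Prod.snd v) (G.induced_eq x _ _)).trans h2.symm)

theorem Glued.metric_of_mem_closure {p : Glued c} (hp : toM c p ∈ closure Ω) :
    metric c p = sideMetric c (closure Ω) G.gm p :=
  if_pos hp

/-- The definition of `metric` prefers the inner metric on the frontier; agreement along $\Sigma$
lets the outer formula hold up to the boundary, and the two sides become interchangeable. -/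
theorem Glued.metric_of_mem_compl {p : Glued c} (hp : toM c p ∈ Ωᶜ) :
    metric c p = sideMetric c Ωᶜ G.gp p := by
  by_cases h : toM c p ∈ closure Ω
  · have hf : toM c p ∈ frontier Ω := by
      rw [G.isSmoothBoundary.isOpen.frontier_eq]; exact ⟨h, hp⟩
    rw [metric_of_mem_closure h]
    have hf' := hf
    rw [G.isSmoothBoundary.frontier_eq] at hf'
    obtain ⟨x, hx⟩ := hf'
    have : p = pt c x 0 := by
      change toM c p = c.Φ (x, 0)
      rw [c.apply_zero, hx]
    rw [this]
    exact sideMetric_neg_eq_pos c x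
  · exact if_neg h

theorem Glued.isInner_metric (p : Glued c) : IsInner (E := Euc k × ℝ) (metric c p) := by
  by_cases h : toM c p ∈ closure Ω
  · rw [metric_of_mem_closure h]; exact (isSide_neg c).isInner_sideMetric h
  · have h' : toM c p ∈ Ωᶜ := fun h' ↦ h (subset_closure h')
    rw [metric_of_mem_compl h']; exact (isSide_pos c).isInner_sideMetric h'

theorem Glued.metric_normal {x : S} {t : ℝ} (ht : t ∈ c.int) (u : Euc k × ℝ) :
    metric c (pt c x t) ((0, 1) : Euc k × ℝ) u = u.2 := by
  rcases le_total t 0 with h | h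
  · have ht' : t ∈ Ioc (-(2 * c.ε)) 0 := ⟨ht.1, h⟩
    have hm : toM c (pt c x t) ∈ closure Ω := ((isSide_neg c).mem_iff x t ht).2 ht'
    rw [metric_of_mem_closure hm]
    exact (isSide_neg c).sideMetric_normal ht' u
  · have ht' : t ∈ Ico 0 (2 * c.ε) := ⟨h, ht.2⟩
    have hm : toM c (pt c x t) ∈ Ωᶜ := ((isSide_pos c).mem_iff x t ht).2 ht'
    rw [metric_of_mem_compl hm]
    exact (isSide_pos c).sideMetric_normal ht' u

end Corners

/-- Composition with a fixed linear map in both variables, as a linear map. -/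
def bilinearCompL {E E' : Type*} [NormedAddCommGroup E] [NormedSpace ℝ E]
    [NormedAddCommGroup E'] [NormedSpace ℝ E'] (T : E' →L[ℝ] E) :
    (E →L[ℝ] E →L[ℝ] ℝ) →L[ℝ] (E' →L[ℝ] E' →L[ℝ] ℝ) :=
  (ContinuousLinearMap.compL ℝ E' (E →L[ℝ] ℝ) (E' →L[ℝ] ℝ)
    ((ContinuousLinearMap.compL ℝ E' E ℝ).flip T)).comp
    ((ContinuousLinearMap.compL ℝ E' E (E →L[ℝ] ℝ)).flip T)

theorem derivWithin_bilinearComp {E E' : Type*} [NormedAddCommGroup E] [NormedSpace ℝ E]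
    [NormedAddCommGroup E'] [NormedSpace ℝ E'] (T : E' →L[ℝ] E) {B : ℝ → E →L[ℝ] E →L[ℝ] ℝ}
    {J : Set ℝ} {t : ℝ} (hB : DifferentiableWithinAt ℝ B J t) (hJ : UniqueDiffWithinAt ℝ J t) :
    derivWithin (fun t ↦ (B t).bilinearComp T T) J t = (derivWithin B J t).bilinearComp T T :=
  ((bilinearCompL T).hasFDerivAt.comp_hasDerivWithinAt t hB.hasDerivWithinAt).derivWithin hJ

theorem fderivWithin_prod_normal {F W : Type*} [NormedAddCommGroup F] [NormedSpace ℝ F]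
    [NormedAddCommGroup W] [NormedSpace ℝ W] {f : F × ℝ → W} {V : Set F} {J : Set ℝ} {y : F} {t : ℝ}
    (hy : y ∈ V) (hf : DifferentiableWithinAt ℝ f (V ×ˢ J) (y, t)) (hJ : UniqueDiffWithinAt ℝ J t) :
    derivWithin (fun s ↦ f (y, s)) J t = fderivWithin ℝ f (V ×ˢ J) (y, t) (0, 1) := by
  have h1 : HasDerivWithinAt (fun s : ℝ ↦ (y, s)) ((0, 1) : F × ℝ) J t :=
    (hasDerivWithinAt_const t J y).prodMk (hasDerivWithinAt_id t J)
  exact (hf.hasFDerivWithinAt.comp_hasDerivWithinAt t h1 fun s hs ↦ ⟨hy, hs⟩).derivWithin hJ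

/-! ### Normal form of the metric in collar charts. -/

section Corners

variable {k : ℕ}
  {S : Type*} [TopologicalSpace S] [ChartedSpace (Euc k) S] [IsManifold 𝓘(ℝ, Euc k) ∞ S]
  {M : Type*} [TopologicalSpace M] [ChartedSpace (ModelProd (Euc k) ℝ) M]
  [IsManifold (mdl k) ∞ M] {Ω : Set M} {ι : S → M}
  {G : CornerMetric k Ω ι} {c : GaussianCollar G}

open Glued

/-- The transition map at `y` from the chart around `x₀` to the chart around the point with
coordinates `y`, differentiated. -/
def transition (k : ℕ) {S : Type*} [TopologicalSpace S] [ChartedSpace (Euc k) S]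
    (x₀ : S) (y : Euc k) : Euc k →L[ℝ] Euc k :=
  fderiv ℝ (chartAt (Euc k) ((chartAt (Euc k) x₀).symm y) ∘ (chartAt (Euc k) x₀).symm) y

theorem hasFDerivAt_transition {x₀ : S} {y : Euc k} (hy : y ∈ (chartAt (Euc k) x₀).target) :
    HasFDerivAt (chartAt (Euc k) ((chartAt (Euc k) x₀).symm y) ∘ (chartAt (Euc k) x₀).symm)
      (transition k x₀ y) y := by
  have i2 : IsManifold 𝓘(ℝ, Euc k) 1 S := inferInstance
  set x := (chartAt (Euc k) x₀).symm y with hx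
  have h1 : ContMDiffAt 𝓘(ℝ, Euc k) 𝓘(ℝ, Euc k) 1 (chartAt (Euc k) x₀).symm y :=
    ((contMDiffOn_chart_symm (I := 𝓘(ℝ, Euc k)) (n := 1) (x := x₀)) y hy).contMDiffAt
      ((chartAt (Euc k) x₀).open_target.mem_nhds hy)
  have h2 : ContMDiffAt 𝓘(ℝ, Euc k) 𝓘(ℝ, Euc k) 1 (chartAt (Euc k) x)
      ((chartAt (Euc k) x₀).symm y) :=
    ((contMDiffOn_chart (I := 𝓘(ℝ, Euc k)) (n := 1) (x := x)) x (mem_chart_source _ _)).contMDiffAt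
      ((chartAt (Euc k) x).open_source.mem_nhds (mem_chart_source _ _))
  exact ((h2.comp y h1).contDiffAt.differentiableAt (by norm_num)).hasFDerivAt

theorem transition_self (x : S) : transition k x (chartAt (Euc k) x x) =
    ContinuousLinearMap.id ℝ (Euc k) := by
  have h : (chartAt (Euc k) x).symm (chartAt (Euc k) x x) = x :=
    (chartAt (Euc k) x).left_inv (mem_chart_source _ _)
  rw [transition, h]
  have : chartAt (Euc k) x ∘ (chartAt (Euc k) x).symm =ᶠ[𝓝 (chartAt (Euc k) x x)] id := by
    filter_upwards [(chartAt (Euc k) x).open_target.mem_nhds (mem_chart_target (Euc k) x)] with y hy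
    exact (chartAt (Euc k) x).right_inv hy
  rw [this.fderiv_eq, fderiv_id]

/-- A field of bilinear forms at the point with collar coordinates `(x, t)`: the tangent spaces
along the normal geodesics are identified by the collar. -/
def radial (g : BilinField k (Glued c)) (x : S) (t : ℝ) : (Euc k × ℝ) →L[ℝ] (Euc k × ℝ) →L[ℝ] ℝ :=
  g (pt c x t)

/-- Collar charts differ by a transition of $\Sigma$ times the identity in $t$. -/
theorem mfderiv_extChartAt_pt_symm {x₀ : S} {t₀ t : ℝ} (ht₀ : t₀ ∈ c.int) (ht : t ∈ c.int)
    {y : Euc k} (hy : y ∈ (chartAt (Euc k) x₀).target) (u : Euc k × ℝ) :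
    (mfderiv 𝓘(ℝ, Euc k × ℝ) (mdl k) (extChartAt (mdl k) (pt c x₀ t₀)).symm (y, t) u : Euc k × ℝ) =
      (transition k x₀ y).prodMap (ContinuousLinearMap.id ℝ ℝ) u := by
  have hyt : (y, t) ∈ (extChartAt (mdl k) (pt c x₀ t₀)).target := by
    rw [extChartAt_pt_target ht₀]; exact ⟨hy, ht⟩
  rw [mfderiv_extChartAt_symm_apply hyt, extChartAt_pt_symm_apply' ht₀]
  have h1 : HasFDerivAt (Prod.map
    (chartAt (Euc k) ((chartAt (Euc k) x₀).symm y) ∘ (chartAt (Euc k) x₀).symm) (id : ℝ → ℝ))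
      ((transition k x₀ y).prodMap (ContinuousLinearMap.id ℝ ℝ)) (y, t) :=
    (hasFDerivAt_transition hy).prodMap (y, t) (hasFDerivAt_id t)
  have h2 : (extChartAt (mdl k) (pt c ((chartAt (Euc k) x₀).symm y) t)) ∘
      (extChartAt (mdl k) (pt c x₀ t₀)).symm =ᶠ[𝓝 (y, t)] Prod.map
    (chartAt (Euc k) ((chartAt (Euc k) x₀).symm y) ∘ (chartAt (Euc k) x₀).symm) (id : ℝ → ℝ) := by
    filter_upwards [extChartAt_target_mem_nhds_of_mem hyt] with z hz
    rw [extChartAt_pt_target ht₀] at hz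
    rw [Function.comp_apply, extChartAt_pt_symm_apply' ht₀, extChartAt_pt_pt ht hz.2]
    rfl
  rw [h2.fderiv_eq, h1.fderiv]

/-- The change of frame does not depend on $t$. Normal derivatives and linear combinations of values
at different times therefore commute with it, which makes the smoothing and the trace condition
chart independent. -/
theorem coordMetric_pt (g : BilinField k (Glued c)) {x₀ : S} {t₀ t : ℝ} (ht₀ : t₀ ∈ c.int)
    (ht : t ∈ c.int) {y : Euc k} (hy : y ∈ (chartAt (Euc k) x₀).target) :
    coordMetric g (pt c x₀ t₀) (y, t) = (radial g ((chartAt (Euc k) x₀).symm y) t).bilinearComp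
      ((transition k x₀ y).prodMap (ContinuousLinearMap.id ℝ ℝ))
      ((transition k x₀ y).prodMap (ContinuousLinearMap.id ℝ ℝ)) := by
  refine ContinuousLinearMap.ext fun u ↦ ContinuousLinearMap.ext fun v ↦ ?_
  rw [coordMetric_apply]
  erw [mfderiv_extChartAt_pt_symm ht₀ ht hy, mfderiv_extChartAt_pt_symm ht₀ ht hy]
  rw [ContinuousLinearMap.bilinearComp_apply]
  have key : ∀ q q' : Glued c, q = q' → ∀ u v : Euc k × ℝ,
      (g q : (Euc k × ℝ) →L[ℝ] (Euc k × ℝ) →L[ℝ] ℝ) u v = g q' u v := by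
      rintro q q' rfl u v; rfl
  exact key _ _ (extChartAt_pt_symm_apply' ht₀ _) _ _

theorem coordMetric_pt_self (g : BilinField k (Glued c)) {x : S} {t₀ t : ℝ} (ht₀ : t₀ ∈ c.int)
    (ht : t ∈ c.int) :
    coordMetric g (pt c x t₀) (chartAt (Euc k) x x, t) = radial g x t := by
  have h : (chartAt (Euc k) x).symm (chartAt (Euc k) x x) = x :=
    (chartAt (Euc k) x).left_inv (mem_chart_source _ _)
  rw [coordMetric_pt g ht₀ ht (mem_chart_target (Euc k) x), h, transition_self]
  rfl

/-- A kernel vector would have length zero for the metric at $t=0$. -/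
theorem injective_transition (c : GaussianCollar G) {x₀ : S} {y : Euc k}
    (hy : y ∈ (chartAt (Euc k) x₀).target) :
    Function.Injective (transition k x₀ y) := by
  rw [injective_iff_map_eq_zero]
  intro v hv
  by_contra h0
  have hyt : (y, 0) ∈ (extChartAt (mdl k) (pt c x₀ 0)).target := by
    rw [extChartAt_pt_target c.zero_mem_int]; exact ⟨hy, c.zero_mem_int⟩
  have h1 := (coordMetric_isInner (g := metric c) hyt (isInner_metric _).symm
    (isInner_metric _).pos).pos (v, 0) (by simpa using h0)
  rw [coordMetric_pt _ c.zero_mem_int c.zero_mem_int hy, ContinuousLinearMap.bilinearComp_apply] at h1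
  have h2 : (transition k x₀ y).prodMap (ContinuousLinearMap.id ℝ ℝ) (v, 0) = 0 := Prod.ext hv rfl
  rw [h2] at h1
  simp at h1

theorem IsSide.contDiffOn_coordMetric {N : Set M} {J : Set ℝ} {g : BilinField k M}
    (hs : IsSide c N J g) (hN : ∀ p : Glued c, toM c p ∈ N → metric c p = sideMetric c N g p)
    (p : Glued c) :
    ContDiffOn ℝ 2 (coordMetric (metric c) p) (coordSet k (toM c ⁻¹' N) p) := by
  refine (hs.contDiffOn_coordMetric_sideMetric p).congr fun y hy ↦ ?_
  rw [coordMetric, coordMetric, hN _ hy.2]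

theorem IsSide.differentiableWithinAt_radial {N : Set M} {J : Set ℝ} {g : BilinField k M}
    (hs : IsSide c N J g)
    (hN : ∀ p : Glued c, toM c p ∈ N → metric c p = sideMetric c N g p) (x : S) :
    DifferentiableWithinAt ℝ (radial (metric c) x) J 0 := by
  have h0 := c.zero_mem_int
  have hcd' := hs.contDiffOn_coordMetric hN (pt c x 0)
  rw [hs.coordSet_pt h0] at hcd'
  have h1 : DifferentiableWithinAt ℝ (fun t : ℝ ↦ (chartAt (Euc k) x x, t)) J 0 :=
    (differentiableWithinAt_const _).prodMk differentiableWithinAt_id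
  have h2 := ((hcd' (chartAt (Euc k) x x, 0)
    ⟨mem_chart_target _ _, hs.zero_mem⟩).differentiableWithinAt (by norm_num)).comp 0 h1
      (fun t ht ↦ ⟨mem_chart_target _ _, ht⟩)
  refine h2.congr (fun t ht ↦ ?_) ?_
  · exact (coordMetric_pt_self _ h0 (hs.subset ht)).symm
  · exact (coordMetric_pt_self _ h0 h0).symm

theorem coordMetric_normal {x₀ : S} {t₀ t : ℝ} (ht₀ : t₀ ∈ c.int) (ht : t ∈ c.int) {y : Euc k}
    (hy : y ∈ (chartAt (Euc k) x₀).target) (v : Euc k × ℝ) :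
    coordMetric (metric c) (pt c x₀ t₀) (y, t) (0, 1) v = v.2 := by
  rw [coordMetric_pt _ ht₀ ht hy, ContinuousLinearMap.bilinearComp_apply]
  have e : (transition k x₀ y).prodMap (ContinuousLinearMap.id ℝ ℝ) (0, 1) = (0, 1) :=
    Prod.ext (map_zero (transition k x₀ y)) rfl
  rw [e]
  exact metric_normal ht (x := (chartAt (Euc k) x₀).symm y)
    ((transition k x₀ y).prodMap (ContinuousLinearMap.id ℝ ℝ) v)

theorem isInner_coordMetric (p : Glued c) {y : Euc k × ℝ}
    (hy : y ∈ (extChartAt (mdl k) p).target) : IsInner (coordMetric (metric c) p y) :=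
  coordMetric_isInner (g := metric c) hy (isInner_metric _).symm (isInner_metric _).pos

/-- The trace condition is assumed for `radial`, in the frame of the preferred charts, and carried
to the chart around `x₀` by naturality of the trace. -/
theorem isCollarMetric (x₀ : S)
    (htr : ∀ x : S, traceWrt (radial (metric c) x 0) (fun u v ↦
      (derivWithin (radial (metric c) x) (Ico 0 (2 * c.ε)) 0 -
        derivWithin (radial (metric c) x) (Ioc (-(2 * c.ε)) 0) 0) u v) = 0) :
    IsCollarMetric c.ε (chartAt (Euc k) x₀).target (coordMetric (metric c) (pt c x₀ 0)) := by
  have h0 := c.zero_mem_int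
  have hneg := (isSide_neg c).contDiffOn_coordMetric (fun p hp ↦ metric_of_mem_closure hp) (pt c x₀ 0)
  have hpos := (isSide_pos c).contDiffOn_coordMetric (fun p hp ↦ metric_of_mem_compl hp) (pt c x₀ 0)
  rw [(isSide_neg c).coordSet_pt h0] at hneg
  rw [(isSide_pos c).coordSet_pt h0] at hpos
  refine ⟨c.ε_pos, (chartAt (Euc k) x₀).open_target, hneg, hpos, ?_, ?_, ?_⟩
  · intro y hy t ht
    refine isInner_coordMetric _ ?_
    rw [extChartAt_pt_target h0]; exact ⟨hy, ht⟩
  · exact fun y hy t ht ↦ coordMetric_normal h0 ht hy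
  · intro y hy
    -- The frame change is constant in $t$, so it comes out of the normal derivative.
    have hd : ∀ {N : Set M} {J : Set ℝ} {g : BilinField k M} (hs : IsSide c N J g),
        ContDiffOn ℝ 2 (coordMetric (metric c) (pt c x₀ 0)) ((chartAt (Euc k) x₀).target ×ˢ J) →
        (∀ p : Glued c, toM c p ∈ N → metric c p = sideMetric c N g p) →
        fderivWithin ℝ (coordMetric (metric c) (pt c x₀ 0)) ((chartAt (Euc k) x₀).target ×ˢ J)
          (y, 0) (0, 1) =
        (derivWithin (radial (metric c) ((chartAt (Euc k) x₀).symm y)) J 0).bilinearComp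
          ((transition k x₀ y).prodMap (ContinuousLinearMap.id ℝ ℝ))
          ((transition k x₀ y).prodMap (ContinuousLinearMap.id ℝ ℝ)) := by
      intro N J g hs hcd hN
      set x := (chartAt (Euc k) x₀).symm y
      have hJ := hs.uniqueDiffOn 0 hs.zero_mem
      rw [← fderivWithin_prod_normal hy
        ((hcd (y, 0) ⟨hy, hs.zero_mem⟩).differentiableWithinAt (by norm_num)) hJ]
      rw [← derivWithin_bilinearComp _ (hs.differentiableWithinAt_radial hN x) hJ]
      refine derivWithin_congr (fun t ht ↦ ?_) ?_
      · exact coordMetric_pt _ h0 (hs.subset ht) hy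
      · exact coordMetric_pt _ h0 h0 hy
    rw [hd (isSide_pos c) hpos (fun p hp ↦ metric_of_mem_compl hp),
      hd (isSide_neg c) hneg (fun p hp ↦ metric_of_mem_closure hp)]
    have hinj : Function.Injective
        ((transition k x₀ y).prodMap (ContinuousLinearMap.id ℝ ℝ)) :=
      (injective_transition c hy).prodMap Function.injective_id
    obtain ⟨T, hT⟩ := isInvertible_of_injective hinj
    rw [coordMetric_pt _ h0 h0 hy, ← hT]
    exact (traceWrt_comp (isInner_metric _) T _).trans (htr ((chartAt (Euc k) x₀).symm y))

end Corners

/-- The difference quotients of the curve, with scaling factors $1/r$ as $r\to0^+$, exhibit the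
tangent vector. -/
theorem mem_posTangentConeAt_of_hasDerivWithinAt {E : Type*} [NormedAddCommGroup E]
    [NormedSpace ℝ E] {s : Set E} {f : ℝ → E} {w : E} (hf : HasDerivWithinAt f w (Ioi 0) 0)
    (hs : ∀ᶠ r in 𝓝[>] (0 : ℝ), f r ∈ s) : w ∈ posTangentConeAt s (f 0) := by
  refine mem_tangentConeAt_of_seq (𝓝[>] (0 : ℝ)) (fun r ↦ Real.toNNReal r⁻¹) (fun r ↦ f r - f 0)
    ?_ ?_ ?_
  · have := hf.continuousWithinAt.tendsto.sub_const (f 0)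
    rwa [sub_self] at this
  · filter_upwards [hs] with r hr
    simpa using hr
  · rw [hasDerivWithinAt_iff_tendsto_slope' (by simp)] at hf
    refine hf.congr' ?_
    filter_upwards [self_mem_nhdsWithin] with r hr
    have hr' : (0 : ℝ) < r := hr
    rw [slope_def_module, NNReal.smul_def, Real.coe_toNNReal _ (inv_nonneg.2 hr'.le), sub_zero]

/-- The formula of Koszul for a pulled back metric, with one-sided derivatives. -/
theorem christoffelWithin_pullback {E : Type*} [NormedAddCommGroup E] [NormedSpace ℝ E]
    [FiniteDimensional ℝ E] {A A' : E → E →L[ℝ] E →L[ℝ] ℝ} {ψ : E → E} {H s : Set E} {z : E}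
    (hψ : ContDiffWithinAt ℝ 2 ψ H z) (hH : UniqueDiffOn ℝ H) (hz : z ∈ H)
    (hz' : z ∈ closure (interior H))
    (hA : DifferentiableWithinAt ℝ A s (ψ z)) (hψs : ∀ᶠ x in 𝓝[H] z, ψ x ∈ s)
    (hAi : IsInner (A (ψ z)))
    (h : ∀ᶠ x in 𝓝[H] z,
      A' x = (A (ψ x)).bilinearComp (fderivWithin ℝ ψ H x) (fderivWithin ℝ ψ H x))
    (hd : DifferentiableWithinAt ℝ A' H z) (u v w : E) :
    A (ψ z) (fderivWithin ℝ (fderivWithin ℝ ψ H) H z u v +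
      christoffelWithin A s (ψ z) (fderivWithin ℝ ψ H z u) (fderivWithin ℝ ψ H z v))
      (fderivWithin ℝ ψ H z w) =
    (1 / 2 : ℝ) * (fderivWithin ℝ A' H z u v w + fderivWithin ℝ A' H z v u w
      - fderivWithin ℝ A' H z w u v) := by
  -- One-sided second derivatives are symmetric because `z` is a limit of interior points of `H`.
  have hQ : IsSymmSndFDerivWithinAt ℝ ψ H z :=
    hψ.isSymmSndFDerivWithinAt (by simp) hH hz' hz
  have hP : HasFDerivWithinAt (fderivWithin ℝ ψ H) (fderivWithin ℝ (fderivWithin ℝ ψ H) H z) H z :=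
    ((hψ.fderivWithin_right (m := 1) hH (by norm_num) hz).differentiableWithinAt
      one_ne_zero).hasFDerivWithinAt
  have hAψ : HasFDerivWithinAt (fun x ↦ A (ψ x))
      (fderivWithin ℝ A s (ψ z) ∘L fderivWithin ℝ ψ H z) H z :=
    hA.hasFDerivWithinAt.comp_of_tendsto z (hψ.differentiableWithinAt (by norm_num)).hasFDerivWithinAt
      (tendsto_nhdsWithin_iff.2 ⟨hψ.continuousWithinAt, hψs⟩)
  have hPv := fun v : E ↦ hP.clm_apply (hasFDerivWithinAt_const v z H)
  have key : ∀ u v w : E, fderivWithin ℝ A' H z u v w =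
      fderivWithin ℝ A s (ψ z) (fderivWithin ℝ ψ H z u) (fderivWithin ℝ ψ H z v)
        (fderivWithin ℝ ψ H z w) +
      A (ψ z) (fderivWithin ℝ (fderivWithin ℝ ψ H) H z u v) (fderivWithin ℝ ψ H z w) +
      A (ψ z) (fderivWithin ℝ ψ H z v) (fderivWithin ℝ (fderivWithin ℝ ψ H) H z u w) := by
    intro u v w
    have h1 := (hAψ.clm_apply (hPv v)).clm_apply (hPv w)
    have h2 := (hd.hasFDerivWithinAt.clm_apply (hasFDerivWithinAt_const v z H)).clm_apply
      (hasFDerivWithinAt_const w z H)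
    have h3 : (fun x ↦ A' x v w) =ᶠ[𝓝[H] z]
        fun x ↦ A (ψ x) (fderivWithin ℝ ψ H x v) (fderivWithin ℝ ψ H x w) :=
      h.mono fun x hx ↦ congrArg (fun A ↦ A v w) hx
    have h4 := congrArg (fun l ↦ l u)
      ((hH z hz).eq (h1.congr_of_eventuallyEq h3 (h3.self_of_nhdsWithin hz)) h2)
    simp at h4
    linarith
  have h2 := congrArg (fun l ↦ l (fderivWithin ℝ ψ H z w))
    (hAi.isInvertible.self_apply_inverse
      (koszul (fderivWithin ℝ A s (ψ z)) (fderivWithin ℝ ψ H z u) (fderivWithin ℝ ψ H z v)))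
  simp only [koszul_apply] at h2
  rw [map_add, add_apply, christoffelWithin_eq, gammaJet, h2, key, key, key,
    hQ v u, hQ w u, hQ w v, hAi.symm (fderivWithin ℝ ψ H z v)]
  ring

section Slice

variable {F W : Type*} [NormedAddCommGroup F] [NormedSpace ℝ F]
  [NormedAddCommGroup W] [NormedSpace ℝ W] {ψ : F × ℝ → W} {f : F → W} {V : Set F} {J : Set ℝ}
  {y : F}

/-- The slice $t=0$ is open in the remaining variables, so a derivative from one side of the collar
restricts to a full derivative along it. -/
theorem hasFDerivAt_slice (hV : IsOpen V) (h0 : (0 : ℝ) ∈ J) (hy : y ∈ V)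
    (hf : ∀ y ∈ V, f y = ψ (y, 0)) (hψ : DifferentiableWithinAt ℝ ψ (V ×ˢ J) (y, 0)) :
    HasFDerivAt f (fderivWithin ℝ ψ (V ×ˢ J) (y, 0) ∘L ContinuousLinearMap.inl ℝ F ℝ) y := by
  have h1 : HasFDerivAt (fun y : F ↦ (y, (0 : ℝ))) (ContinuousLinearMap.inl ℝ F ℝ) y :=
    (hasFDerivAt_id y).prodMk (hasFDerivAt_const 0 y)
  have h2 := hψ.hasFDerivWithinAt.comp y (h1.hasFDerivWithinAt (s := V)) fun y hy ↦ mk_mem_prod hy h0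
  refine (h2.hasFDerivAt (hV.mem_nhds hy)).congr_of_eventuallyEq ?_
  filter_upwards [hV.mem_nhds hy] with y hy using hf y hy

/-- The second fundamental form uses ordinary second derivatives of the embedding; this expresses
them by one-sided second derivatives of the collar. -/
theorem fderiv_fderiv_slice (hV : IsOpen V) (h0 : (0 : ℝ) ∈ J) (hJ : UniqueDiffOn ℝ J) (hy : y ∈ V)
    (hf : ∀ y ∈ V, f y = ψ (y, 0)) (hψ : ContDiffWithinAt ℝ 2 ψ (V ×ˢ J) (y, 0)) (u v : F) :
    fderiv ℝ (fderiv ℝ f) y u v =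
      fderivWithin ℝ (fderivWithin ℝ ψ (V ×ˢ J)) (V ×ˢ J) (y, 0) (u, 0) (v, 0) := by
  have hu : UniqueDiffOn ℝ (V ×ˢ J) := hV.uniqueDiffOn.prod hJ
  have hmem : (y, (0 : ℝ)) ∈ V ×ˢ J := ⟨hy, h0⟩
  have hev : ∀ᶠ y' in 𝓝 y, ContDiffWithinAt ℝ 2 ψ (V ×ˢ J) (y', 0) := by
    have h1 := hψ.eventually (by simp)
    rw [insert_eq_of_mem hmem] at h1
    have h2 : Filter.Tendsto (fun y : F ↦ (y, (0 : ℝ))) (𝓝 y) (𝓝[V ×ˢ J] (y, 0)) := by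
      refine tendsto_nhdsWithin_iff.2 ⟨?_, ?_⟩
      · exact (continuous_id.prodMk continuous_const).tendsto y
      · filter_upwards [hV.mem_nhds hy] with y hy using ⟨hy, h0⟩
    exact h2.eventually h1
  have h1 : fderiv ℝ f =ᶠ[𝓝 y]
      fun y ↦ fderivWithin ℝ ψ (V ×ˢ J) (y, 0) ∘L ContinuousLinearMap.inl ℝ F ℝ := by
    filter_upwards [hev, hV.mem_nhds hy] with y' h' hy'
    exact (hasFDerivAt_slice hV h0 hy' hf (h'.differentiableWithinAt (by norm_num))).fderiv
  have hP : DifferentiableWithinAt ℝ (fderivWithin ℝ ψ (V ×ˢ J)) (V ×ˢ J) (y, 0) :=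
    (hψ.fderivWithin_right (m := 1) hu (by norm_num) hmem).differentiableWithinAt one_ne_zero
  have h2 := hasFDerivAt_slice (f := fun y ↦ fderivWithin ℝ ψ (V ×ˢ J) (y, 0)) hV h0 hy
    (fun _ _ ↦ rfl) hP
  rw [h1.fderiv_eq, (h2.clm_comp (hasFDerivAt_const (ContinuousLinearMap.inl ℝ F ℝ) y)).fderiv]
  simp

end Slice

/-! ### The collar read in the charts of the original manifold. -/

section Corners

variable {k : ℕ}
  {S : Type*} [TopologicalSpace S] [ChartedSpace (Euc k) S] [IsManifold 𝓘(ℝ, Euc k) ∞ S]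
  {M : Type*} [TopologicalSpace M] [ChartedSpace (ModelProd (Euc k) ℝ) M]
  [IsManifold (mdl k) ∞ M] {Ω : Set M} {ι : S → M}
  {G : CornerMetric k Ω ι} {c : GaussianCollar G}

open Glued

/-- The collar in the charts around `x` and around the point of `M` on the hypersurface. -/
def collarMap (c : GaussianCollar G) (x : S) : Euc k × ℝ → Euc k × ℝ :=
  extChartAt (mdl k) (ι x) ∘ toM c ∘ (extChartAt (mdl k) (pt c x 0)).symm

theorem toM_extChartAt_symm_center (c : GaussianCollar G) (x : S) :
    toM c ((extChartAt (mdl k) (pt c x 0)).symm (chartAt (Euc k) x x, 0)) = ι x := by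
  rw [extChartAt_pt_symm_apply' c.zero_mem_int, ← c.apply_zero x,
    (chartAt (Euc k) x).left_inv (mem_chart_source _ _)]
  rfl

theorem collarMap_center (c : GaussianCollar G) (x : S) :
    collarMap c x (chartAt (Euc k) x x, 0) = extChartAt (mdl k) (ι x) (ι x) :=
  congrArg (extChartAt (mdl k) (ι x)) (toM_extChartAt_symm_center c x)

theorem coordMap_eq (c : GaussianCollar G) (x : S) (y : Euc k) :
    coordMap ι x y = collarMap c x (y, 0) := by
  rw [collarMap, Function.comp_apply, Function.comp_apply,
    extChartAt_pt_symm_apply' c.zero_mem_int]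
  have : toM c (pt c ((chartAt (Euc k) x).symm (y, (0 : ℝ)).1) (y, (0 : ℝ)).2) =
    ι ((chartAt (Euc k) x).symm y) := c.apply_zero _
  rw [this]
  rfl

namespace IsSide

variable {N : Set M} {J : Set ℝ} {g : BilinField k M} (hs : IsSide c N J g)

include hs

theorem center_mem (x : S) : (chartAt (Euc k) x x, (0 : ℝ)) ∈ (chartAt (Euc k) x).target ×ˢ J :=
  ⟨mem_chart_target _ _, hs.zero_mem⟩

theorem uniqueDiffOn_prod (x : S) : UniqueDiffOn ℝ ((chartAt (Euc k) x).target ×ˢ J) :=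
  (chartAt (Euc k) x).open_target.uniqueDiffOn.prod hs.uniqueDiffOn

theorem contMDiffOn_toM_symm_pt (x : S) :
    ContMDiffOn 𝓘(ℝ, Euc k × ℝ) (mdl k) 3 (toM c ∘ (extChartAt (mdl k) (pt c x 0)).symm)
      ((chartAt (Euc k) x).target ×ˢ J) := by
  rw [← hs.coordSet_pt c.zero_mem_int]; exact hs.contMDiffOn_toM_symm (pt c x 0)

theorem eventually_mem_source (x : S) :
    ∀ᶠ z in 𝓝[(chartAt (Euc k) x).target ×ˢ J] (chartAt (Euc k) x x, 0),
      toM c ((extChartAt (mdl k) (pt c x 0)).symm z) ∈ (extChartAt (mdl k) (ι x)).source := by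
  refine (hs.contMDiffOn_toM_symm_pt x _ (hs.center_mem x)).continuousWithinAt ?_
  refine (isOpen_extChartAt_source (I := mdl k) (ι x)).mem_nhds ?_
  rw [Function.comp_apply, toM_extChartAt_symm_center]
  exact mem_extChartAt_source (ι x)

theorem contDiffWithinAt_collarMap (x : S) :
    ContDiffWithinAt ℝ 3 (collarMap c x) ((chartAt (Euc k) x).target ×ˢ J)
      (chartAt (Euc k) x x, 0) := by
  have i3 : IsManifold (mdl k) 3 M := inferInstance
  have h1 : ContMDiffAt (mdl k) 𝓘(ℝ, Euc k × ℝ) 3 (extChartAt (mdl k) (ι x))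
      ((toM c ∘ (extChartAt (mdl k) (pt c x 0)).symm) (chartAt (Euc k) x x, 0)) := by
    rw [Function.comp_apply, toM_extChartAt_symm_center]
    exact contMDiffAt_extChartAt
  exact (h1.comp_contMDiffWithinAt _ (hs.contMDiffOn_toM_symm_pt x _ (hs.center_mem x))).contDiffWithinAt

theorem eventually_collarMap_mem (x : S) :
    ∀ᶠ z in 𝓝[(chartAt (Euc k) x).target ×ˢ J] (chartAt (Euc k) x x, 0),
      collarMap c x z ∈ coordSet k N (ι x) := by
  filter_upwards [hs.eventually_mem_source x, self_mem_nhdsWithin] with z hz hzH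
  refine ⟨(extChartAt (mdl k) (ι x)).map_source hz, ?_⟩
  rw [mem_preimage, collarMap, Function.comp_apply, Function.comp_apply,
    (extChartAt (mdl k) (ι x)).left_inv hz]
  rw [← hs.coordSet_pt c.zero_mem_int] at hzH
  exact hzH.2

theorem pullback_collarMap {x : S} {z : Euc k × ℝ} (hz : z ∈ (chartAt (Euc k) x).target ×ˢ J)
    (hz' : toM c ((extChartAt (mdl k) (pt c x 0)).symm z) ∈ (extChartAt (mdl k) (ι x)).source) :
    coordMetric (sideMetric c N g) (pt c x 0) z =
      (coordMetric g (ι x) (collarMap c x z)).bilinearComp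
        (fderivWithin ℝ (collarMap c x) ((chartAt (Euc k) x).target ×ˢ J) z)
        (fderivWithin ℝ (collarMap c x) ((chartAt (Euc k) x).target ×ˢ J) z) := by
  have hz2 := hz
  rw [← hs.coordSet_pt c.zero_mem_int] at hz2
  rw [hs.coordMetric_sideMetric hz2, hs.coordSet_pt c.zero_mem_int]
  exact pullback_eq (F := toM c ∘ (extChartAt (mdl k) (pt c x 0)).symm) hz'
    ((hs.contMDiffOn_toM_symm_pt x z hz).mdifferentiableWithinAt (by norm_num))
    (hs.uniqueDiffOn_prod x z hz)

/-- The pulled-back form is positive definite, hence the derivative along which it is pulled back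
has no kernel. -/
theorem injective_fderivWithin_collarMap (x : S) :
    Function.Injective (fderivWithin ℝ (collarMap c x) ((chartAt (Euc k) x).target ×ˢ J)
      (chartAt (Euc k) x x, 0)) := by
  have hm := hs.center_mem x
  have hI : IsInner (coordMetric (sideMetric c N g) (pt c x 0) (chartAt (Euc k) x x, 0)) := by
    have hN : toM c ((extChartAt (mdl k) (pt c x 0)).symm (chartAt (Euc k) x x, 0)) ∈ N := by
      rw [← hs.coordSet_pt c.zero_mem_int] at hm; exact hm.2
    refine coordMetric_isInner (g := sideMetric c N g) ?_ (hs.isInner_sideMetric hN).symm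
      (hs.isInner_sideMetric hN).pos
    rw [extChartAt_pt_target c.zero_mem_int]
    exact ⟨hm.1, c.zero_mem_int⟩
  rw [hs.pullback_collarMap hm (by rw [toM_extChartAt_symm_center]; exact mem_extChartAt_source _)]
    at hI
  refine (injective_iff_map_eq_zero _).2 fun u hu ↦ ?_
  by_contra h0
  have := hI.pos u h0
  rw [ContinuousLinearMap.bilinearComp_apply, hu] at this
  simp at this

end IsSide
end Corners

/-! ### Identification of the inward unit normal. -/

section Corners

variable {k : ℕ}
  {S : Type*} [TopologicalSpace S] [ChartedSpace (Euc k) S] [IsManifold 𝓘(ℝ, Euc k) ∞ S]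
  {M : Type*} [TopologicalSpace M] [ChartedSpace (ModelProd (Euc k) ℝ) M]
  [IsManifold (mdl k) ∞ M] {Ω : Set M} {ι : S → M}
  {G : CornerMetric k Ω ι} {c : GaussianCollar G}

open Glued

/-- The derivative of the collar at a point of the hypersurface, from the side `J`. -/
def collarDeriv (c : GaussianCollar G) (J : Set ℝ) (x : S) : (Euc k × ℝ) →L[ℝ] (Euc k × ℝ) :=
  fderivWithin ℝ (collarMap c x) ((chartAt (Euc k) x).target ×ˢ J) (chartAt (Euc k) x x, 0)

namespace IsSide

variable {N : Set M} {J : Set ℝ} {g : BilinField k M} (hs : IsSide c N J g)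

include hs

theorem hasFDerivWithinAt_collarMap (x : S) :
    HasFDerivWithinAt (collarMap c x) (collarDeriv c J x) ((chartAt (Euc k) x).target ×ˢ J)
      (chartAt (Euc k) x x, 0) :=
  ((hs.contDiffWithinAt_collarMap x).differentiableWithinAt (by norm_num)).hasFDerivWithinAt

theorem coordMetric_collarDeriv (hN : ∀ p : Glued c, toM c p ∈ N → metric c p = sideMetric c N g p)
    (x : S) (u v : Euc k × ℝ) :
    coordMetric g (ι x) (extChartAt (mdl k) (ι x) (ι x)) (collarDeriv c J x u)
      (collarDeriv c J x v) = radial (metric c) x 0 u v := by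
  have h0 := c.zero_mem_int
  have hm := hs.center_mem x
  have h1 := hs.pullback_collarMap hm
    (by rw [toM_extChartAt_symm_center]; exact mem_extChartAt_source _)
  rw [coordMetric_pt_self _ h0 h0, collarMap_center] at h1
  have h2 : radial (metric c) x 0 = radial (sideMetric c N g) x 0 :=
    hN _ ((hs.mem_iff x 0 h0).2 hs.zero_mem)
  rw [h2, h1]
  rfl

theorem hasFDerivAt_coordMap (x : S) :
    HasFDerivAt (coordMap ι x) (collarDeriv c J x ∘L ContinuousLinearMap.inl ℝ (Euc k) ℝ)
      (extChartAt 𝓘(ℝ, Euc k) x x) :=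
  hasFDerivAt_slice (chartAt (Euc k) x).open_target hs.zero_mem (mem_chart_target _ _)
    (fun y _ ↦ coordMap_eq c x y)
    ((hs.contDiffWithinAt_collarMap x).differentiableWithinAt (by norm_num))

theorem mfderiv_eq_collarDeriv (x : S) (v : Euc k) :
    (mfderiv 𝓘(ℝ, Euc k) (mdl k) ι x v : Euc k × ℝ) = collarDeriv c J x (v, 0) := by
  have h : MDifferentiableAt 𝓘(ℝ, Euc k) (mdl k) ι x :=
    G.isSmoothBoundary.isSmoothEmbedding.contMDiff.contMDiffAt.mdifferentiableAt (by simp)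
  refine (DFunLike.congr_fun h.mfderiv v).trans ?_
  rw [modelWithCornersSelf_coe, range_id, fderivWithin_univ]
  exact DFunLike.congr_fun (hs.hasFDerivAt_coordMap x).fderiv v

/-- The vector is the velocity of the normal line $r\mapsto(x,\sigma r)$, which stays in `N` for
small positive $r$. -/
theorem collarDeriv_mem_posTangentConeAt (x : S) {σ : ℝ} (hσ : ∀ᶠ r in 𝓝[>] (0 : ℝ), σ * r ∈ J) :
    collarDeriv c J x (0, σ) ∈
      posTangentConeAt (coordSet k N (ι x)) (extChartAt (mdl k) (ι x) (ι x)) := by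
  have hcurve : HasDerivWithinAt (fun r : ℝ ↦ (chartAt (Euc k) x x, σ * r)) ((0, σ) : Euc k × ℝ)
      (Ioi 0) 0 := by
    refine (hasDerivWithinAt_const _ _ _).prodMk ?_
    simpa using (hasDerivWithinAt_id (0 : ℝ) (Ioi 0)).const_mul σ
  have ht : Filter.Tendsto (fun r : ℝ ↦ (chartAt (Euc k) x x, σ * r)) (𝓝[>] 0)
      (𝓝[(chartAt (Euc k) x).target ×ˢ J] (chartAt (Euc k) x x, 0)) := by
    refine tendsto_nhdsWithin_iff.2 ⟨?_, ?_⟩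
    · have := hcurve.continuousWithinAt.tendsto
      simpa using this
    · filter_upwards [hσ] with r hr using ⟨mem_chart_target _ _, hr⟩
  have h1 := hs.hasFDerivWithinAt_collarMap x
  have h2 : HasDerivWithinAt (fun r : ℝ ↦ collarMap c x (chartAt (Euc k) x x, σ * r))
      (collarDeriv c J x (0, σ)) (Ioi 0) 0 := by
    have h3 := HasFDerivWithinAt.comp_of_tendsto (0 : ℝ) (g := collarMap c x)
      (f := fun r : ℝ ↦ (chartAt (Euc k) x x, σ * r)) (g' := collarDeriv c J x)
      (t := (chartAt (Euc k) x).target ×ˢ J) (by simpa using h1) hcurve.hasFDerivWithinAt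
      (by simpa using ht)
    have h4 := h3.hasDerivWithinAt
    simpa using! h4
  have h5 := mem_posTangentConeAt_of_hasDerivWithinAt h2 (s := coordSet k N (ι x))
    (ht.eventually (hs.eventually_collarMap_mem x))
  rwa [mul_zero, collarMap_center] at h5

/-- The collar coordinate times $\sigma$ is nonnegative on `N` and zero on $\Sigma$, so it has a
local minimum there and its derivative is nonnegative on the tangent cone. On the image of `u` that
derivative is $\sigma u_2$. -/
theorem nonneg_of_mem_posTangentConeAt {x : S} {σ : ℝ} (hσ : ∀ t ∈ J, 0 ≤ σ * t)
    {u : Euc k × ℝ} (hu : collarDeriv c J x u ∈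
      posTangentConeAt (coordSet k N (ι x)) (extChartAt (mdl k) (ι x) (ι x))) : 0 ≤ σ * u.2 := by
  have i3 : IsManifold (mdl k) 3 M := inferInstance
  set X := extChartAt (mdl k) (ι x) with hX
  have hy0 : X (ι x) ∈ X.target := mem_extChartAt_target (ι x)
  have hinv : X.symm (X (ι x)) = ι x := extChartAt_to_inv (ι x)
  have hιT : ι x ∈ c.Φ.target := by
    rw [← c.apply_zero x]; exact c.Φ.map_source (c.mem_source.2 c.zero_mem_int)
  have hιN : ι x ∈ N := by
    rw [← c.apply_zero x]; exact (hs.mem_iff x 0 c.zero_mem_int).2 hs.zero_mem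
  have hΦι : c.Φ.symm (ι x) = (x, 0) := by
    rw [← c.apply_zero x]; exact c.Φ.left_inv (c.mem_source.2 c.zero_mem_int)
  have hXs : ContMDiffAt 𝓘(ℝ, Euc k × ℝ) (mdl k) 3 X.symm (X (ι x)) :=
    (contMDiffOn_extChartAt_symm (ι x) _ hy0).contMDiffAt (extChartAt_target_mem_nhds (ι x))
  have hT : ∀ᶠ y in 𝓝 (X (ι x)), X.symm y ∈ c.Φ.target := by
    refine hXs.continuousAt.preimage_mem_nhds (c.Φ.open_target.mem_nhds ?_)
    rwa [hinv]
  let τ : Euc k × ℝ → ℝ := fun y ↦ (c.Φ.symm (X.symm y)).2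
  have hτ : ContDiffWithinAt ℝ 3 τ (coordSet k N (ι x)) (X (ι x)) := by
    have h1 : ContMDiffWithinAt (mdl k) (mdl k) 3 c.Φ.symm (c.Φ.target ∩ N) (X.symm (X (ι x))) := by
      rw [hinv]; exact hs.contMDiffOn_symm _ ⟨hιT, hιN⟩
    have h2 : ContMDiffWithinAt 𝓘(ℝ, Euc k × ℝ) (mdl k) 3 (c.Φ.symm ∘ X.symm)
        (coordSet k N (ι x)) (X (ι x)) := by
      refine (ContMDiffWithinAt.comp' (s := coordSet k N (ι x)) _ h1
        hXs.contMDiffWithinAt).mono_of_mem_nhdsWithin ?_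
      filter_upwards [mem_nhdsWithin_of_mem_nhds hT, self_mem_nhdsWithin] with y hy hy'
      exact ⟨hy', hy, hy'.2⟩
    have h3 : ContMDiffAt (mdl k) 𝓘(ℝ, ℝ) 3 (Prod.snd : S × ℝ → ℝ)
      ((c.Φ.symm ∘ X.symm) (X (ι x))) := contMDiffAt_snd
    exact (h3.comp_contMDiffWithinAt _ h2).contDiffWithinAt
  have hτ' := (hτ.differentiableWithinAt (by norm_num)).hasFDerivWithinAt
  have hmin : IsLocalMinOn (fun y ↦ σ * τ y) (coordSet k N (ι x)) (X (ι x)) := by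
    change ∀ᶠ y in 𝓝[coordSet k N (ι x)] (X (ι x)), σ * τ (X (ι x)) ≤ σ * τ y
    filter_upwards [mem_nhdsWithin_of_mem_nhds hT, self_mem_nhdsWithin] with y hy hy'
    have e0 : τ (X (ι x)) = 0 := by
      change (c.Φ.symm (X.symm (X (ι x)))).2 = 0
      rw [hinv, hΦι]
    rw [e0, mul_zero]
    apply hσ
    have h4 := c.Φ.map_target hy
    have h5 := (hs.mem_iff (c.Φ.symm (X.symm y)).1 (c.Φ.symm (X.symm y)).2 (c.mem_source.1 h4)).1
    apply h5
    rw [Prod.mk.eta, c.Φ.right_inv hy]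
    exact hy'.2
  have hge := hmin.hasFDerivWithinAt_nonneg (hτ'.const_mul σ) hu
  have hcomp : HasFDerivWithinAt (fun z ↦ τ (collarMap c x z))
      (fderivWithin ℝ τ (coordSet k N (ι x)) (X (ι x)) ∘L collarDeriv c J x)
      ((chartAt (Euc k) x).target ×ˢ J) (chartAt (Euc k) x x, 0) := by
    refine HasFDerivWithinAt.comp_of_tendsto (g := τ) (t := coordSet k N (ι x)) _ ?_
      (hs.hasFDerivWithinAt_collarMap x)
      (tendsto_nhdsWithin_iff.2 ⟨(hs.hasFDerivWithinAt_collarMap x).continuousWithinAt,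
        hs.eventually_collarMap_mem x⟩)
    rw [collarMap_center]; exact hτ'
  have hsnd : HasFDerivWithinAt (fun z ↦ τ (collarMap c x z)) (ContinuousLinearMap.snd ℝ (Euc k) ℝ)
      ((chartAt (Euc k) x).target ×ˢ J) (chartAt (Euc k) x x, 0) := by
    have heq : ∀ᶠ z in 𝓝[(chartAt (Euc k) x).target ×ˢ J] (chartAt (Euc k) x x, 0),
        τ (collarMap c x z) = z.2 := by
      filter_upwards [hs.eventually_mem_source x, self_mem_nhdsWithin] with z hz hzH
      change (c.Φ.symm (X.symm (X (toM c ((extChartAt (mdl k) (pt c x 0)).symm z))))).2 = z.2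
      rw [X.left_inv hz, extChartAt_pt_symm_apply' c.zero_mem_int,
        symm_toM_pt c (hs.subset hzH.2)]
    exact (hasFDerivWithinAt_snd).congr_of_eventuallyEq heq
      (heq.self_of_nhdsWithin (hs.center_mem x))
  have huniq := (hs.uniqueDiffOn_prod x _ (hs.center_mem x)).eq hcomp hsnd
  have h6 := DFunLike.congr_fun huniq u
  change fderivWithin ℝ τ (coordSet k N (ι x)) (X (ι x)) (collarDeriv c J x u) = u.2 at h6
  rw [smul_apply, h6, smul_eq_mul] at hge
  exact hge

/-- Orthogonality to $\Sigma$ kills the tangential part, unit length leaves $\pm\partial_t$, and the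
tangent cone fixes the sign. Uniqueness determines the vector selected by `Classical.epsilon`. -/
theorem isInwardUnitNormal_iff (hN : ∀ p : Glued c, toM c p ∈ N → metric c p = sideMetric c N g p)
    {x : S} {σ : ℝ} (hσ1 : σ * σ = 1) (hσ : ∀ t ∈ J, 0 ≤ σ * t)
    (hσ' : ∀ᶠ r in 𝓝[>] (0 : ℝ), σ * r ∈ J) (ν : Euc k × ℝ) :
    IsInwardUnitNormal g N ι x ν ↔ ν = collarDeriv c J x (0, σ) := by
  have hβn : ∀ u : Euc k × ℝ, radial (metric c) x 0 (0, 1) u = u.2 :=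
    fun u ↦ metric_normal c.zero_mem_int u
  have hβ : IsInner (radial (metric c) x 0) := isInner_metric _
  have key : ∀ u v : Euc k × ℝ, g (ι x) (collarDeriv c J x u) (collarDeriv c J x v) =
      radial (metric c) x 0 u v := fun u v ↦ by
    rw [← hs.coordMetric_collarDeriv hN, coordMetric_self_apply]
  have hsplit := fun (v w : Euc k) (a b : ℝ) ↦ hβ.apply_eq_of_normal hβn v w a b
  have h00 : ∀ (v w : Euc k), radial (metric c) x 0 ((0, 0) : Euc k × ℝ) (w, 0) = 0 := fun v w ↦ by
    have : ((0, 0) : Euc k × ℝ) = 0 := rfl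
    rw [this]; simp
  have hmf := hs.mfderiv_eq_collarDeriv x
  constructor
  · rintro ⟨h1, h2, h3⟩
    obtain ⟨⟨w, a⟩, rfl⟩ :=
      (isInvertible_of_injective (hs.injective_fderivWithin_collarMap x)).surjective ν
    change g (ι x) (collarDeriv c J x (w, a)) (collarDeriv c J x (w, a)) = 1 at h1
    have h2' := h2 w
    have hmw := hmf w
    change g (ι x) (collarDeriv c J x (w, a)) (mfderiv 𝓘(ℝ, Euc k) (mdl k) ι x w : Euc k × ℝ) = 0
      at h2'
    rw [hmw, key, hsplit, mul_zero, add_zero] at h2'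
    have hw : w = 0 := by
      by_contra hw
      exact (hβ.pos (w, 0) (fun h ↦ hw (congrArg Prod.fst h))).ne' h2'
    subst hw
    rw [key, hsplit, h00 0, zero_add] at h1
    have h4 := hs.nonneg_of_mem_posTangentConeAt hσ h3
    have h5 : a = σ := by
      change 0 ≤ σ * a at h4
      have h6 : (σ * a) * (σ * a) = 1 := by rw [mul_mul_mul_comm, hσ1, h1, one_mul]
      rcases mul_self_eq_one_iff.1 h6 with h7 | h7
      · calc a = (σ * σ) * a := by rw [hσ1, one_mul]
          _ = σ := by rw [mul_assoc, h7, mul_one]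
      · linarith
    rw [h5]
    rfl
  · rintro rfl
    refine ⟨?_, fun (v : Euc k) ↦ ?_, hs.collarDeriv_mem_posTangentConeAt x hσ'⟩
    · rw [key, hsplit, h00 0, hσ1, zero_add]
    · rw [hmf v, key, hsplit, h00 0, mul_zero, add_zero]

theorem inwardUnitNormal_eq (hN : ∀ p : Glued c, toM c p ∈ N → metric c p = sideMetric c N g p)
    (x : S) {σ : ℝ} (hσ1 : σ * σ = 1) (hσ : ∀ t ∈ J, 0 ≤ σ * t)
    (hσ' : ∀ᶠ r in 𝓝[>] (0 : ℝ), σ * r ∈ J) :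
    inwardUnitNormal g N ι x = collarDeriv c J x (0, σ) :=
  (hs.isInwardUnitNormal_iff hN hσ1 hσ hσ' _).1
    (Classical.epsilon_spec ⟨_, (hs.isInwardUnitNormal_iff hN hσ1 hσ hσ' _).2 rfl⟩)

end IsSide
end Corners

/-! ### Mean curvature as the trace of the normal derivative. -/

section Corners

variable {k : ℕ}
  {S : Type*} [TopologicalSpace S] [ChartedSpace (Euc k) S] [IsManifold 𝓘(ℝ, Euc k) ∞ S]
  {M : Type*} [TopologicalSpace M] [ChartedSpace (ModelProd (Euc k) ℝ) M]
  [IsManifold (mdl k) ∞ M] {Ω : Set M} {ι : S → M}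
  {G : CornerMetric k Ω ι} {c : GaussianCollar G}

open Glued

namespace IsSide

variable {N : Set M} {J : Set ℝ} {g : BilinField k M} (hs : IsSide c N J g)

include hs

theorem derivWithin_radial (hN : ∀ p : Glued c, toM c p ∈ N → metric c p = sideMetric c N g p)
    (x : S) :
    derivWithin (radial (metric c) x) J 0 =
      fderivWithin ℝ (coordMetric (metric c) (pt c x 0)) ((chartAt (Euc k) x).target ×ˢ J)
        (chartAt (Euc k) x x, 0) (0, 1) := by
  have h0 := c.zero_mem_int
  have hcd' := hs.contDiffOn_coordMetric hN (pt c x 0)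
  rw [hs.coordSet_pt h0] at hcd'
  rw [← fderivWithin_prod_normal (mem_chart_target (Euc k) x)
    ((hcd' _ (hs.center_mem x)).differentiableWithinAt (by norm_num))
    (hs.uniqueDiffOn 0 hs.zero_mem)]
  refine derivWithin_congr (fun t ht ↦ ?_) ?_
  · exact (coordMetric_pt_self _ h0 (hs.subset ht)).symm
  · exact (coordMetric_pt_self _ h0 h0).symm

/-- The second fundamental form is half of the normal derivative of the metric. -/
theorem secondFundamentalForm_eq
    (hN : ∀ p : Glued c, toM c p ∈ N → metric c p = sideMetric c N g p) (x : S) (u v : Euc k) :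
    secondFundamentalForm g N ι x (collarDeriv c J x (0, 1)) u v =
      (1 / 2 : ℝ) * derivWithin (radial (metric c) x) J 0 (u, 0) (v, 0) := by
  have h0 := c.zero_mem_int
  have i3 : IsManifold (mdl k) 3 M := inferInstance
  have hιN : ι x ∈ N := by
    rw [← c.apply_zero x]; exact (hs.mem_iff x 0 c.zero_mem_int).2 hs.zero_mem
  have hcd := hs.contDiffOn_coordMetric hN (pt c x 0)
  rw [hs.coordSet_pt h0] at hcd
  have hcd0 := hcd _ (hs.center_mem x)
  have hd : DifferentiableWithinAt ℝ (coordMetric (metric c) (pt c x 0))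
    ((chartAt (Euc k) x).target ×ˢ J) (chartAt (Euc k) x x, 0) :=
    hcd0.differentiableWithinAt (by norm_num)
  have hA : DifferentiableWithinAt ℝ (coordMetric g (ι x)) (coordSet k N (ι x))
      (collarMap c x (chartAt (Euc k) x x, 0)) := by
    rw [collarMap_center]
    exact ((contMDiffWithinAt_section_iff (mem_extChartAt_source (ι x))).1
      (hs.isMetric.contMDiffOn _ hιN)).differentiableWithinAt (by norm_num)
  have hAi : IsInner (coordMetric g (ι x) (collarMap c x (chartAt (Euc k) x x, 0))) := by
    have hinv : (extChartAt (mdl k) (ι x)).symm (extChartAt (mdl k) (ι x) (ι x)) ∈ N := by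
      rwa [extChartAt_to_inv]
    rw [collarMap_center]
    exact coordMetric_isInner (mem_extChartAt_target (ι x)) (hs.isMetric.symm _ hinv)
      (hs.isMetric.pos _ hinv)
  have hint : (chartAt (Euc k) x x, (0 : ℝ)) ∈
      closure (interior ((chartAt (Euc k) x).target ×ˢ J)) := by
    rw [interior_prod_eq, closure_prod_eq]
    refine ⟨subset_closure ?_, ?_⟩
    · rw [(chartAt (Euc k) x).open_target.interior_eq]; exact mem_chart_target _ _
    · rw [hs.convex.closure_interior_eq_closure_of_nonempty_interior hs.nonempty]
      exact subset_closure hs.zero_mem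
  have hev : ∀ᶠ z in 𝓝[(chartAt (Euc k) x).target ×ˢ J] (chartAt (Euc k) x x, 0),
      coordMetric (metric c) (pt c x 0) z = (coordMetric g (ι x) (collarMap c x z)).bilinearComp
        (fderivWithin ℝ (collarMap c x) ((chartAt (Euc k) x).target ×ˢ J) z)
        (fderivWithin ℝ (collarMap c x) ((chartAt (Euc k) x).target ×ˢ J) z) := by
    filter_upwards [hs.eventually_mem_source x, self_mem_nhdsWithin] with z hz hzH
    rw [← hs.pullback_collarMap hzH hz, coordMetric, coordMetric, hN]
    rw [← hs.coordSet_pt h0] at hzH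
    exact hzH.2
  -- Koszul formula for two tangential vectors tested on $\partial_t$.
  have hK := christoffelWithin_pullback ((hs.contDiffWithinAt_collarMap x).of_le (by norm_num))
    (hs.uniqueDiffOn_prod x) (hs.center_mem x) hint hA (hs.eventually_collarMap_mem x) hAi hev hd
    (u, 0) (v, 0) (0, 1)
  -- Tangential vectors stay orthogonal to $\partial_t$ at all points of the collar, so two of the
  -- three Koszul terms vanish. What remains is $-\frac12\partial_tg(u,v)$, and the sign convention
  -- of the second fundamental form removes the minus.
  have hconst : ∀ u v : Euc k, fderivWithin ℝ (coordMetric (metric c) (pt c x 0))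
      ((chartAt (Euc k) x).target ×ˢ J) (chartAt (Euc k) x x, 0) (u, 0) (v, 0) (0, 1) = 0 := by
    intro u v
    refine fderivWithin_apply_eq_of_eqOn (hs.uniqueDiffOn_prod x _ (hs.center_mem x))
      (hs.center_mem x) hd ((ContinuousLinearMap.apply ℝ ℝ ((0, 1) : Euc k × ℝ)) ∘L
        (ContinuousLinearMap.apply ℝ ((Euc k × ℝ) →L[ℝ] ℝ) ((v, 0) : Euc k × ℝ))) (w := 0) ?_ (u, 0)
    intro z hz
    have hI := isInner_coordMetric (pt c x 0) (y := z)
      (by rw [extChartAt_pt_target h0]; exact ⟨hz.1, hs.subset hz.2⟩)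
    change coordMetric (metric c) (pt c x 0) z (v, 0) (0, 1) = 0
    rw [hI.symm]
    exact coordMetric_normal h0 (hs.subset hz.2) hz.1 _
  have hf1 := hs.hasFDerivAt_coordMap x
  have hf2 := fderiv_fderiv_slice (f := coordMap ι x) (ψ := collarMap c x)
    (chartAt (Euc k) x).open_target hs.zero_mem
    hs.uniqueDiffOn (mem_chart_target (Euc k) x) (fun y _ ↦ coordMap_eq c x y)
    ((hs.contDiffWithinAt_collarMap x).of_le (by norm_num)) u v
  rw [hconst, hconst, ← hs.derivWithin_radial hN] at hK
  rw [collarMap_center] at hK hAi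
  change -(coordMetric g (ι x) (extChartAt (mdl k) (ι x) (ι x)) (collarDeriv c J x (0, 1))
    (fderiv ℝ (fderiv ℝ (coordMap ι x)) (chartAt (Euc k) x x) u v +
      christoffelWithin (coordMetric g (ι x)) (coordSet k N (ι x))
        (extChartAt (mdl k) (ι x) (ι x))
        (fderiv ℝ (coordMap ι x) (extChartAt 𝓘(ℝ, Euc k) x x) u)
        (fderiv ℝ (coordMap ι x) (extChartAt 𝓘(ℝ, Euc k) x x) v))) = _
  rw [hf1.fderiv, hf2, hAi.symm]
  refine (congrArg Neg.neg hK).trans ?_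
  ring

theorem meanCurvature_eq
    (hN : ∀ p : Glued c, toM c p ∈ N → metric c p = sideMetric c N g p) (x : S) :
    meanCurvature g N ι x (collarDeriv c J x (0, 1)) =
      (1 / 2 : ℝ) * traceWrt ((radial (metric c) x 0).bilinearComp
        (ContinuousLinearMap.inl ℝ (Euc k) ℝ) (ContinuousLinearMap.inl ℝ (Euc k) ℝ))
        (fun u v ↦ derivWithin (radial (metric c) x) J 0 (u, 0) (v, 0)) := by
  have hf1 := (hs.hasFDerivAt_coordMap x).fderiv
  have h2 : secondFundamentalForm g N ι x (collarDeriv c J x (0, 1)) =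
    fun u v ↦ (1 / 2 : ℝ) * derivWithin (radial (metric c) x) J 0 (u, 0) (v, 0) := by
    ext u v; exact hs.secondFundamentalForm_eq hN x u v
  have h3 : (coordMetric g (ι x) (extChartAt (mdl k) (ι x) (ι x))).bilinearComp
      (fderiv ℝ (coordMap ι x) (extChartAt 𝓘(ℝ, Euc k) x x))
      (fderiv ℝ (coordMap ι x) (extChartAt 𝓘(ℝ, Euc k) x x)) =
      (radial (metric c) x 0).bilinearComp
        (ContinuousLinearMap.inl ℝ (Euc k) ℝ) (ContinuousLinearMap.inl ℝ (Euc k) ℝ) := by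
    rw [hf1]
    refine ContinuousLinearMap.ext fun u ↦ ContinuousLinearMap.ext fun v ↦ ?_
    exact hs.coordMetric_collarDeriv hN x (u, 0) (v, 0)
  unfold meanCurvature
  simp only []
  rw [h2, h3, traceWrt, traceWrt, Finset.mul_sum]

/-- The components of the metric in the direction $\partial_t$ are constant in $t$; the jump
therefore has tangential components only. -/
theorem derivWithin_radial_normal
    (hN : ∀ p : Glued c, toM c p ∈ N → metric c p = sideMetric c N g p) (x : S) (v : Euc k × ℝ) :
    derivWithin (radial (metric c) x) J 0 (0, 1) v = 0 ∧
      derivWithin (radial (metric c) x) J 0 v (0, 1) = 0 := by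
  have hr := (hs.differentiableWithinAt_radial hN x).hasDerivWithinAt
  have hu := hs.uniqueDiffOn 0 hs.zero_mem
  have key : ∀ (L : ((Euc k × ℝ) →L[ℝ] (Euc k × ℝ) →L[ℝ] ℝ) →L[ℝ] ℝ) (a : ℝ),
      (∀ t ∈ J, L (radial (metric c) x t) = a) → L (derivWithin (radial (metric c) x) J 0) = 0 := by
    intro L a hL
    have h1 := L.hasFDerivAt.comp_hasDerivWithinAt 0 hr
    have h2 : HasDerivWithinAt (L ∘ radial (metric c) x) 0 J 0 :=
      (hasDerivWithinAt_const (0 : ℝ) J a).congr hL (hL 0 hs.zero_mem)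
    exact hu.eq_deriv _ h1 h2
  constructor
  · exact key ((ContinuousLinearMap.apply ℝ ℝ v) ∘L (ContinuousLinearMap.apply ℝ
      ((Euc k × ℝ) →L[ℝ] ℝ) ((0, 1) : Euc k × ℝ))) v.2
      (fun t ht ↦ metric_normal (hs.subset ht) v)
  · exact key ((ContinuousLinearMap.apply ℝ ℝ ((0, 1) : Euc k × ℝ)) ∘L (ContinuousLinearMap.apply ℝ
      ((Euc k × ℝ) →L[ℝ] ℝ) v)) v.2
      (fun t ht ↦ ((isInner_metric (pt c x t)).symm v ((0, 1) : Euc k × ℝ)).trans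
        (metric_normal (hs.subset ht) v))

end IsSide

theorem traceWrt_sub {E : Type*} [NormedAddCommGroup E] [NormedSpace ℝ E] [FiniteDimensional ℝ E]
    (A : E →L[ℝ] E →L[ℝ] ℝ) (B B' : E → E → ℝ) :
    traceWrt A (fun u v ↦ B u v - B' u v) = traceWrt A B - traceWrt A B' := by
  simp only [traceWrt, Finset.sum_sub_distrib]

/-- If the mean curvatures agree, then the jump of the normal derivative of the metric is trace
free. -/
theorem trace_jump_eq_zero (hH : ∀ x : S, G.meanCurvatureMinus x = G.meanCurvaturePlus x) (x : S) :
    traceWrt (radial (metric c) x 0) (fun u v ↦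
      (derivWithin (radial (metric c) x) (Ico 0 (2 * c.ε)) 0 -
        derivWithin (radial (metric c) x) (Ioc (-(2 * c.ε)) 0) 0) u v) = 0 := by
  have hε := c.ε_pos
  have hN := isSide_neg c
  have hP := isSide_pos c
  have hNm : ∀ p : Glued c, toM c p ∈ closure Ω → metric c p = sideMetric c (closure Ω) G.gm p :=
    fun p hp ↦ metric_of_mem_closure hp
  have hPm : ∀ p : Glued c, toM c p ∈ Ωᶜ → metric c p = sideMetric c Ωᶜ G.gp p :=
    fun p hp ↦ metric_of_mem_compl hp
  have h1 := hH x
  have hlt : ∀ᶠ r in 𝓝[>] (0 : ℝ), r < 2 * c.ε :=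
    mem_nhdsWithin_of_mem_nhds (Iio_mem_nhds (by linarith))
  rw [CornerMetric.meanCurvatureMinus, CornerMetric.meanCurvaturePlus,
    hN.inwardUnitNormal_eq hNm x (σ := -1) (by norm_num) (fun t ht ↦ by linarith [ht.2]) (by
      filter_upwards [hlt, self_mem_nhdsWithin] with r hr hr0
      have : (0 : ℝ) < r := hr0
      constructor <;> linarith),
    hP.inwardUnitNormal_eq hPm x (σ := 1) (by norm_num) (fun t ht ↦ by linarith [ht.1]) (by
      filter_upwards [hlt, self_mem_nhdsWithin] with r hr hr0
      have : (0 : ℝ) < r := hr0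
      constructor <;> linarith)] at h1
  -- The normal into the closure of `Ω` is $-\partial_t$, and the sign in `meanCurvatureMinus` turns
  -- it into $+\partial_t$, as on the other side.
  have hneg : (-(collarDeriv c (Ioc (-(2 * c.ε)) 0) x (0, -1)) : Euc k × ℝ) =
      collarDeriv c (Ioc (-(2 * c.ε)) 0) x (0, 1) := by
    rw [← map_neg]; simp
  have h2 : meanCurvature G.gm (closure Ω) ι x (collarDeriv c (Ioc (-(2 * c.ε)) 0) x (0, 1)) =
      meanCurvature G.gp Ωᶜ ι x (collarDeriv c (Ico 0 (2 * c.ε)) x (0, 1)) := by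
    rw [← hneg]; exact h1
  rw [hN.meanCurvature_eq hNm, hP.meanCurvature_eq hPm] at h2
  have hnn := hN.derivWithin_radial_normal hNm x
  have hpn := hP.derivWithin_radial_normal hPm x
  have hI : IsInner (radial (metric c) x 0) := isInner_metric _
  -- Without normal components the trace over $\Sigma\times\mathbb R$ is the trace over $\Sigma$,
  -- where the mean curvatures live.
  rw [traceWrt_prod hI (fun v ↦ metric_normal c.zero_mem_int v)
    (fun v ↦ by rw [sub_apply, sub_apply, (hnn v).1, (hpn v).1, sub_zero])
    (fun v ↦ by rw [sub_apply, sub_apply, (hnn v).2, (hpn v).2, sub_zero])]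
  simp only [sub_apply]
  rw [traceWrt_sub]
  linarith

end Corners

/-! ### Locality of the scalar curvature, bounded unit balls and a finite cover by convex sets. -/

theorem coordScalar_congr {E : Type*} [NormedAddCommGroup E] [NormedSpace ℝ E]
    [FiniteDimensional ℝ E] {A B : E → E →L[ℝ] E →L[ℝ] ℝ} {y : E} (h : A =ᶠ[𝓝 y] B)
    (hA : ContDiffAt ℝ 2 A y) (hinv : ∀ᶠ z in 𝓝 y, (A z).IsInvertible) :
    coordScalar A y = coordScalar B y := by
  have hinv' : ∀ᶠ z in 𝓝 y, (B z).IsInvertible := by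
    filter_upwards [h, hinv] with z hz hz'
    rwa [← hz]
  rw [coordScalar_eq_scalJet hA hinv, coordScalar_eq_scalJet (hA.congr_of_eventuallyEq h.symm) hinv',
    h.eq_of_nhds, h.fderiv_eq, (h.fderiv).fderiv_eq]

theorem IsInner.nonneg {E : Type*} [NormedAddCommGroup E] [NormedSpace ℝ E]
    {A : E →L[ℝ] E →L[ℝ] ℝ} (hA : IsInner A) (v : E) : 0 ≤ A v v := by
  by_cases hv : v = 0
  · simp [hv]
  · exact (hA.pos v hv).le

theorem IsInner.isVonNBounded {E : Type*} [NormedAddCommGroup E] [NormedSpace ℝ E]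
    [FiniteDimensional ℝ E] {A : E →L[ℝ] E →L[ℝ] ℝ} (hA : IsInner A) :
    Bornology.IsVonNBounded ℝ {v : E | A v v < 1} := by
  obtain ⟨a, ha, hc⟩ := exists_coercive (X := Unit) (A := fun _ ↦ A) isCompact_univ
    continuousOn_const (fun _ _ ↦ hA)
  rw [NormedSpace.isVonNBounded_iff, isBounded_iff_forall_norm_le]
  refine ⟨1 + 1 / a, fun v hv ↦ ?_⟩
  have h1 := hc () (mem_univ _) v
  have h2 : A v v < 1 := hv
  have h3 : ‖v‖ ^ 2 ≤ 1 / a := by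
    rw [le_div_iff₀ ha]; linarith
  nlinarith [sq_nonneg (‖v‖ - 1), norm_nonneg v]

/-- A compact manifold is covered by finitely many compact convex sets in charts. -/
theorem exists_finite_convex_cover (k : ℕ) (S : Type*) [TopologicalSpace S] [CompactSpace S]
    [ChartedSpace (Euc k) S] :
    ∃ (T : Finset S) (K : S → Set (Euc k)),
      (∀ x, IsCompact (K x) ∧ Convex ℝ (K x) ∧ K x ⊆ (chartAt (Euc k) x).target) ∧
      ∀ x, ∃ j ∈ T, x ∈ (chartAt (Euc k) j).source ∧ chartAt (Euc k) j x ∈ K j := by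
  have h1 : ∀ x : S, ∃ r > 0, Metric.closedBall (chartAt (Euc k) x x) r ⊆ (chartAt (Euc k) x).target :=
    fun x ↦ Metric.nhds_basis_closedBall.mem_iff.1
      ((chartAt (Euc k) x).open_target.mem_nhds (mem_chart_target _ x))
  choose r hr hrt using h1
  have h2 : ∀ x : S, (chartAt (Euc k) x).source ∩
      chartAt (Euc k) x ⁻¹' Metric.closedBall (chartAt (Euc k) x x) (r x) ∈ 𝓝 x := fun x ↦
    Filter.inter_mem ((chartAt (Euc k) x).open_source.mem_nhds (mem_chart_source _ x))
      (((chartAt (Euc k) x).continuousAt (mem_chart_source _ x)).preimage_mem_nhds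
        (Metric.closedBall_mem_nhds _ (hr x)))
  obtain ⟨T, -, hT⟩ := isCompact_univ.elim_nhds_subcover _ (fun x _ ↦ h2 x)
  refine ⟨T, fun x ↦ Metric.closedBall (chartAt (Euc k) x x) (r x),
    fun x ↦ ⟨isCompact_closedBall _ _, convex_closedBall _ _, hrt x⟩, fun x ↦ ?_⟩
  obtain ⟨j, hj, hx⟩ := mem_iUnion₂.1 (hT (mem_univ x))
  exact ⟨j, hj, hx.1, hx.2⟩

/-! ### The smoothed metric on the glued manifold. -/

section Corners

variable {k : ℕ}
  {S : Type*} [TopologicalSpace S] [ChartedSpace (Euc k) S] [IsManifold 𝓘(ℝ, Euc k) ∞ S]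
  {M : Type*} [TopologicalSpace M] [ChartedSpace (ModelProd (Euc k) ℝ) M]
  [IsManifold (mdl k) ∞ M] {Ω : Set M} {ι : S → M}
  {G : CornerMetric k Ω ι} {c : GaussianCollar G}

open Glued

open Classical in
/-- The metric of `M̃`, smoothed in the strip `Σ × (-h, h)`. -/
def smoothMetric (c : GaussianCollar G) (h : ℝ) : BilinField k (Glued c) := fun p ↦
  if toM c p ∈ c.Φ.target then
    radial (metric c) (c.Φ.symm (toM c p)).1
        ((c.Φ.symm (toM c p)).2 - ramp h (c.Φ.symm (toM c p)).2) +
      radial (metric c) (c.Φ.symm (toM c p)).1 (ramp h (c.Φ.symm (toM c p)).2) -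
      radial (metric c) (c.Φ.symm (toM c p)).1 0
  else metric c p

theorem radial_smoothMetric {h t : ℝ} (ht : t ∈ c.int) (x : S) :
    radial (smoothMetric c h) x t = radial (metric c) x (t - ramp h t) +
      radial (metric c) x (ramp h t) - radial (metric c) x 0 := by
  have : radial (smoothMetric c h) x t = radial (metric c) (c.Φ.symm (toM c (pt c x t))).1
        ((c.Φ.symm (toM c (pt c x t))).2 - ramp h (c.Φ.symm (toM c (pt c x t))).2) +
      radial (metric c) (c.Φ.symm (toM c (pt c x t))).1 (ramp h (c.Φ.symm (toM c (pt c x t))).2) -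
      radial (metric c) (c.Φ.symm (toM c (pt c x t))).1 0 := if_pos (toM_pt_mem c ht)
  rw [this, symm_toM_pt c ht]

theorem radial_smoothMetric_of_notMem {h t : ℝ} (hh : 0 < h) (ht : t ∈ c.int) (hth : t ∉ Ioo (-h) h)
    (x : S) : radial (smoothMetric c h) x t = radial (metric c) x t := by
  rw [radial_smoothMetric ht]
  by_cases h1 : t ≤ -h
  · rw [ramp_of_le hh h1]; simp
  · have h2 : h ≤ t := by
      by_contra h2
      exact hth ⟨not_le.1 h1, not_le.1 h2⟩
    rw [ramp_of_ge hh h2]; simp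

theorem smoothMetric_of_notMem_strip {h : ℝ} (hh : 0 < h) {p : Glued c}
    (hp : p ∉ strip c (Ioo (-h) h)) : smoothMetric c h p = metric c p := by
  by_cases hT : toM c p ∈ c.Φ.target
  · obtain ⟨x, t, ht, rfl⟩ := exists_eq_pt c hT
    refine radial_smoothMetric_of_notMem hh ht (fun h' ↦ hp ?_) x
    exact ⟨(x, t), ⟨mem_univ _, h'⟩, rfl⟩
  · exact if_neg hT

/-- Since frame changes do not depend on $t$, the global definition coincides in every collar chart
with the smoothing of the coordinate expression. -/
theorem coordMetric_smoothMetric {h : ℝ} (hh : 0 < h) (hε : h < 2 * c.ε) {x₀ : S} {t₀ : ℝ}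
    (ht₀ : t₀ ∈ c.int) {z : Euc k × ℝ} (hz : z ∈ (chartAt (Euc k) x₀).target ×ˢ c.int) :
    coordMetric (smoothMetric c h) (pt c x₀ t₀) z =
      smoothed h (coordMetric (metric c) (pt c x₀ 0)) z := by
  obtain ⟨y, t⟩ := z
  have ht : t ∈ c.int := hz.2
  have hε0 := c.ε_pos
  have h1 : t - ramp h t ∈ c.int :=
    ⟨lt_sub_ramp hh hε ht.1, (sub_ramp_nonpos hh t).trans_lt (by linarith)⟩
  have h2 : ramp h t ∈ c.int :=
    ⟨lt_of_lt_of_le (by linarith) (ramp_nonneg hh t), ramp_lt hh hε ht.2⟩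
  rw [coordMetric_pt _ ht₀ ht hz.1, radial_smoothMetric ht, smoothed,
    coordMetric_pt _ c.zero_mem_int h1 hz.1, coordMetric_pt _ c.zero_mem_int h2 hz.1,
    coordMetric_pt _ c.zero_mem_int c.zero_mem_int hz.1]
  rfl

theorem smoothMetric_symm (h : ℝ) (p : Glued c) (u v : Euc k × ℝ) :
    smoothMetric c h p u v = smoothMetric c h p v u := by
  by_cases hT : toM c p ∈ c.Φ.target
  · obtain ⟨x, t, ht, rfl⟩ := exists_eq_pt c hT
    change radial (smoothMetric c h) x t u v = radial (smoothMetric c h) x t v u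
    have hI : ∀ s, IsInner (radial (metric c) x s) := fun s ↦ isInner_metric _
    rw [radial_smoothMetric ht]
    simp only [add_apply, sub_apply]
    rw [(hI _).symm u v, (hI (ramp h t)).symm u v, (hI 0).symm u v]
  · rw [show smoothMetric c h p = metric c p from if_neg hT]
    exact (isInner_metric p).symm u v

/-- The estimate is intrinsic, so it may be checked in the finitely many collar charts that cover
$\Sigma$; outside the strip both metrics agree. -/
theorem exists_smoothMetric_close [CompactSpace S]
    (hH : ∀ x : S, G.meanCurvatureMinus x = G.meanCurvaturePlus x) {η : ℝ} (hη : 0 < η) :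
    ∃ h₁ : ℝ, 0 < h₁ ∧ ∀ h : ℝ, 0 < h → h ≤ c.ε / 2 → h ≤ h₁ →
      ∀ (p : Glued c) (v : Euc k × ℝ),
        |smoothMetric c h p v v - metric c p v v| ≤ η * metric c p v v := by
  obtain ⟨T, K, hK, hcov⟩ := exists_finite_convex_cover k S
  have hε0 := c.ε_pos
  have hev : ∀ᶠ h₁ in 𝓝[>] (0 : ℝ), ∀ j ∈ T, ∀ h : ℝ, 0 < h → h ≤ c.ε / 2 → h ≤ h₁ →
      ∀ y ∈ K j, ∀ t ∈ Icc (-h) h, ∀ v, |smoothed h (coordMetric (metric c) (pt c j 0)) (y, t) v v -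
        coordMetric (metric c) (pt c j 0) (y, t) v v| ≤
          η * coordMetric (metric c) (pt c j 0) (y, t) v v := by
    -- Each chart admits all sufficiently small thresholds; phrasing this with a filter replaces a
    -- minimum over `T`.
    refine (Filter.eventually_all_finset T).2 fun j _ ↦ ?_
    obtain ⟨h₁, hpos, hcl⟩ := (isCollarMetric j (trace_jump_eq_zero (c := c) hH)).exists_smoothed_close
      (hK j).1 (hK j).2.1 (hK j).2.2 hη
    filter_upwards [Ioc_mem_nhdsGT hpos] with h' hh' h hh hhε hhh
    exact hcl h hh hhε (hhh.trans hh'.2)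
  obtain ⟨h₁, hcl, hpos⟩ := (hev.and self_mem_nhdsWithin).exists
  refine ⟨h₁, hpos, fun h hh hhε hh1 p v ↦ ?_⟩
  have hmet : 0 ≤ metric c p v v := (isInner_metric p).nonneg v
  by_cases hp : p ∈ strip c (Ioo (-h) h)
  · obtain ⟨⟨x, t⟩, ⟨-, ht⟩, hxt⟩ := hp
    have ht' : t ∈ c.int := ⟨by linarith [ht.1], by linarith [ht.2]⟩
    have hpx : p = pt c x t := hxt.symm
    subst hpx
    obtain ⟨j, hj, hxj, hKj⟩ := hcov x
    have hyT := (hK j).2.2 hKj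
    have h1 := hcl j hj h hh hhε hh1 _ hKj t ⟨ht.1.le, ht.2.le⟩
    have hinj : Function.Injective ((transition k j (chartAt (Euc k) j x)).prodMap
        (ContinuousLinearMap.id ℝ ℝ)) :=
      (injective_transition c hyT).prodMap Function.injective_id
    -- Every tangent vector comes from a coordinate vector of the chart around `j`, so the
    -- coordinate estimate covers all of them.
    obtain ⟨u, rfl⟩ := (isInvertible_of_injective hinj).surjective v
    have h2 := h1 u
    rw [← coordMetric_smoothMetric (t₀ := 0) hh (by linarith) c.zero_mem_int ⟨hyT, ht'⟩,
      coordMetric_pt _ c.zero_mem_int ht' hyT, coordMetric_pt _ c.zero_mem_int ht' hyT,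
      (chartAt (Euc k) j).left_inv hxj] at h2
    exact h2
  · rw [smoothMetric_of_notMem_strip hh hp, sub_self, abs_zero]
    positivity

theorem contDiffAt_coordMetric_metric {p : Glued c} (hp : toM c p ∉ c.Φ.target) :
    ContDiffAt ℝ 2 (coordMetric (metric c) p) (extChartAt (mdl k) p p) := by
  have hmem : ∀ {N : Set M}, toM c p ∈ N →
      extChartAt (mdl k) p p ∈ coordSet k (toM c ⁻¹' N) p := fun hN ↦
    ⟨mem_extChartAt_target p, by rwa [mem_preimage, extChartAt_to_inv]⟩
  by_cases h : toM c p ∈ closure Ω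
  · exact ((isSide_neg c).contDiffOn_coordMetric (fun p hp ↦ metric_of_mem_closure hp) p).contDiffAt
      (((isSide_neg c).isOpen_coordSet_of_notMem hp).mem_nhds (hmem h))
  · have h' : toM c p ∈ Ωᶜ := fun h' ↦ h (subset_closure h')
    exact ((isSide_pos c).contDiffOn_coordMetric (fun p hp ↦ metric_of_mem_compl hp) p).contDiffAt
      (((isSide_pos c).isOpen_coordSet_of_notMem hp).mem_nhds (hmem h'))

/-- The strip is the image of a compact set in a Hausdorff space. Hence it does not accumulate at
points outside the collar, and gluing the smoothing with the unchanged metric creates no singularity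
there. -/
theorem isClosed_strip [CompactSpace S] [T2Space M] {h : ℝ} (hε : h < 2 * c.ε) :
    IsClosed (strip c (Icc (-h) h)) := by
  refine IsClosed.preimage continuous_toM (IsCompact.isClosed ?_)
  refine (isCompact_univ.prod isCompact_Icc).image_of_continuousOn (c.Φ.continuousOn.mono ?_)
  rintro ⟨x, t⟩ ⟨-, ht⟩
  exact c.mem_source.2 ⟨by linarith [ht.1], by linarith [ht.2]⟩

theorem contMDiff_smoothMetric [CompactSpace S] [T2Space M]
    (hH : ∀ x : S, G.meanCurvatureMinus x = G.meanCurvaturePlus x) {h : ℝ} (hh : 0 < h)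
    (hε : h < 2 * c.ε) :
    ContMDiff (mdl k) ((mdl k).prod 𝓘(ℝ, (Euc k × ℝ) →L[ℝ] (Euc k × ℝ) →L[ℝ] ℝ)) 2
      (fun p ↦ TotalSpace.mk' ((Euc k × ℝ) →L[ℝ] (Euc k × ℝ) →L[ℝ] ℝ)
        (E := fun p : Glued c ↦ TangentSpace (mdl k) p →L[ℝ] TangentSpace (mdl k) p →L[ℝ] ℝ) p
        (smoothMetric c h p)) := by
  intro p
  rw [← contMDiffWithinAt_univ, contMDiffWithinAt_section_iff (mem_extChartAt_source p)]
  apply ContDiffAt.contDiffWithinAt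
  by_cases hT : toM c p ∈ c.Φ.target
  · obtain ⟨x, t, ht, rfl⟩ := exists_eq_pt c hT
    have hG := (isCollarMetric x (trace_jump_eq_zero (c := c) hH)).contDiffOn_smoothed hh hε
    have hmem : extChartAt (mdl k) (pt c x t) (pt c x t) ∈ (chartAt (Euc k) x).target ×ˢ c.int := by
      rw [extChartAt_pt_pt ht ht]; exact ⟨mem_chart_target _ _, ht⟩
    have hnh : (chartAt (Euc k) x).target ×ˢ c.int ∈
        𝓝 (extChartAt (mdl k) (pt c x t) (pt c x t)) :=
      ((chartAt (Euc k) x).open_target.prod isOpen_Ioo).mem_nhds hmem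
    refine (hG.contDiffAt hnh).congr_of_eventuallyEq ?_
    filter_upwards [hnh] with z hz using coordMetric_smoothMetric hh hε ht hz
  · refine (contDiffAt_coordMetric_metric hT).congr_of_eventuallyEq ?_
    -- A point off the collar has a neighbourhood that misses the closed strip; there the metric is
    -- unchanged.
    have hpS : p ∉ strip c (Icc (-h) h) := by
      rintro ⟨⟨x, t⟩, ⟨-, ht⟩, hxt⟩
      apply hT
      rw [← hxt]
      exact c.Φ.map_source (c.mem_source.2 ⟨by linarith [ht.1], by linarith [ht.2]⟩)
    have hnh : (extChartAt (mdl k) p).symm ⁻¹' (strip c (Icc (-h) h))ᶜ ∈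
        𝓝 (extChartAt (mdl k) p p) := by
      refine (continuousAt_extChartAt_symm p).preimage_mem_nhds ?_
      rw [extChartAt_to_inv]
      exact (isClosed_strip hε).isOpen_compl.mem_nhds hpS
    filter_upwards [hnh] with z hz
    rw [coordMetric, coordMetric, smoothMetric_of_notMem_strip hh]
    rintro ⟨q, ⟨hq1, hq2⟩, hq3⟩
    exact hz ⟨q, ⟨hq1, hq2.1.le, hq2.2.le⟩, hq3⟩

end Corners

theorem half_le_of_abs_sub_le {a b : ℝ} (h : |a - b| ≤ 1 / 2 * b) : 1 / 2 * b ≤ a := by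
  linarith [(abs_le.1 h).1]

/-! ### Uniform bound for the scalar curvature on the strip. -/

section Corners

variable {k : ℕ}
  {S : Type*} [TopologicalSpace S] [ChartedSpace (Euc k) S] [IsManifold 𝓘(ℝ, Euc k) ∞ S]
  {M : Type*} [TopologicalSpace M] [ChartedSpace (ModelProd (Euc k) ℝ) M]
  [IsManifold (mdl k) ∞ M] {Ω : Set M} {ι : S → M}
  {G : CornerMetric k Ω ι} {c : GaussianCollar G}

open Glued

theorem isInner_smoothMetric {h : ℝ}
    (hlow : ∀ (p : Glued c) (v : Euc k × ℝ),
      |smoothMetric c h p v v - metric c p v v| ≤ 1 / 2 * metric c p v v) (p : Glued c) :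
    IsInner (E := Euc k × ℝ) (smoothMetric c h p) := by
  refine ⟨smoothMetric_symm h p, fun v hv ↦ ?_⟩
  exact (mul_pos one_half_pos ((isInner_metric p).pos v hv)).trans_le
    (half_le_of_abs_sub_le (hlow p v))

/-- The smoothed metric as a `C²` Riemannian metric. -/
def smoothC2Metric (c : GaussianCollar G) (h : ℝ)
    (hI : ∀ p : Glued c, IsInner (E := Euc k × ℝ) (smoothMetric c h p))
    (hc : ContMDiff (mdl k) ((mdl k).prod 𝓘(ℝ, (Euc k × ℝ) →L[ℝ] (Euc k × ℝ) →L[ℝ] ℝ)) 2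
      (fun p ↦ TotalSpace.mk' ((Euc k × ℝ) →L[ℝ] (Euc k × ℝ) →L[ℝ] ℝ)
        (E := fun p : Glued c ↦ TangentSpace (mdl k) p →L[ℝ] TangentSpace (mdl k) p →L[ℝ] ℝ) p
        (smoothMetric c h p))) : C2Metric c where
  inner := smoothMetric c h
  symm p := (hI p).symm
  pos p := (hI p).pos
  isVonNBounded p := (hI p).isVonNBounded
  contMDiff := hc

/-- The intrinsic lower bound on the metric becomes the coordinate lower bound needed in each chart;
invariance then transfers the chart bounds to the scalar curvature of $\tilde M$. -/
theorem exists_abs_scalarCurvature_le [CompactSpace S] [T2Space M]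
    (hH : ∀ x : S, G.meanCurvatureMinus x = G.meanCurvaturePlus x) {h₀ : ℝ} (hε : h₀ ≤ c.ε / 2)
    (hlow : ∀ h, 0 < h → h ≤ h₀ → ∀ (p : Glued c) (v : Euc k × ℝ),
      |smoothMetric c h p v v - metric c p v v| ≤ 1 / 2 * metric c p v v) :
    ∃ C : ℝ, ∀ h, 0 < h → h ≤ h₀ → ∀ p ∈ strip c (Icc (-h) h),
      |scalarCurvature (smoothMetric c h) p| ≤ C := by
  obtain ⟨T, K, hK, hcov⟩ := exists_finite_convex_cover k S
  have hε0 := c.ε_pos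
  have hz := c.zero_mem_int
  have hex : ∀ j : S, ∃ C : ℝ, ∀ h, 0 < h → h ≤ h₀ → ∀ y ∈ K j, ∀ t ∈ Icc (-h) h,
      |coordScalar (smoothed h (coordMetric (metric c) (pt c j 0))) (y, t)| ≤ C := by
    intro j
    refine (isCollarMetric j (trace_jump_eq_zero (c := c) hH)).exists_abs_coordScalar_smoothed_le
      (hK j).1 (hK j).2.1 (hK j).2.2 hε fun h hh hh0 y hy t ht v ↦ ?_
    have hyT := (hK j).2.2 hy
    have ht' : t ∈ c.int := ⟨by linarith [ht.1], by linarith [ht.2]⟩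
    rw [← coordMetric_smoothMetric (t₀ := 0) hh (by linarith) hz ⟨hyT, ht'⟩,
      coordMetric_pt _ hz ht' hyT, coordMetric_pt _ hz ht' hyT]
    exact half_le_of_abs_sub_le (hlow h hh hh0 (pt c ((chartAt (Euc k) j).symm y) t)
      ((transition k j y).prodMap (ContinuousLinearMap.id ℝ ℝ) v))
  choose C hC using hex
  -- The sum of absolute values dominates the constant of each of the finitely many charts.
  refine ⟨∑ j ∈ T, |C j|, fun h hh hh0 p hp ↦ ?_⟩
  obtain ⟨⟨x, t⟩, ⟨-, ht⟩, hxt⟩ := hp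
  have hpx : p = pt c x t := hxt.symm
  subst hpx
  have ht' : t ∈ c.int := ⟨by linarith [ht.1], by linarith [ht.2]⟩
  obtain ⟨j, hj, hxj, hKj⟩ := hcov x
  have hyT := (hK j).2.2 hKj
  have hhε : h < 2 * c.ε := by linarith
  have hI := isInner_smoothMetric (hlow h hh hh0)
  have hM : IsC2MetricOn (smoothMetric c h) univ :=
    ⟨fun p _ ↦ (hI p).symm, fun p _ ↦ (hI p).pos, (contMDiff_smoothMetric hH hh hhε).contMDiffOn⟩
  have hsrc : pt c x t ∈ (extChartAt (mdl k) (pt c j 0)).source := by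
    rw [extChartAt_pt_source hz]
    refine ⟨toM_pt_mem c ht', ?_⟩
    rw [mem_preimage, symm_toM_pt c ht']
    exact ⟨hxj, mem_univ _⟩
  rw [scalarCurvature_eq hM hsrc, extChartAt_pt_pt hz ht']
  have hmem : (chartAt (Euc k) j x, t) ∈ (chartAt (Euc k) j).target ×ˢ c.int := ⟨hyT, ht'⟩
  have hnh := ((chartAt (Euc k) j).open_target.prod (isOpen_Ioo (a := -(2 * c.ε))
    (b := 2 * c.ε))).mem_nhds hmem
  have heq : smoothed h (coordMetric (metric c) (pt c j 0)) =ᶠ[𝓝 (chartAt (Euc k) j x, t)]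
      coordMetric (smoothMetric c h) (pt c j 0) := by
    filter_upwards [hnh] with z hzz using (coordMetric_smoothMetric hh hhε hz hzz).symm
  have hcd : ContDiffAt ℝ 2 (smoothed h (coordMetric (metric c) (pt c j 0)))
      (chartAt (Euc k) j x, t) :=
    ((isCollarMetric j (trace_jump_eq_zero (c := c) hH)).contDiffOn_smoothed hh hhε).contDiffAt hnh
  have hinv : ∀ᶠ z in 𝓝 (chartAt (Euc k) j x, t),
      (smoothed h (coordMetric (metric c) (pt c j 0)) z).IsInvertible := by
    filter_upwards [hnh] with z hzz
    rw [← coordMetric_smoothMetric (t₀ := 0) hh hhε hz hzz]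
    refine (coordMetric_isInner (g := smoothMetric c h) ?_ (hI _).symm (hI _).pos).isInvertible
    rw [extChartAt_pt_target hz]; exact hzz
  rw [← coordScalar_congr heq hcd hinv]
  calc _ ≤ C j := hC j h hh hh0 _ hKj t ht
    _ ≤ |C j| := le_abs_self _
    _ ≤ _ := Finset.single_le_sum (f := fun j ↦ |C j|) (fun _ _ ↦ abs_nonneg _) hj

end Corners

end Corner

end

theorem mainTheorem7 {k : ℕ}
    {S : Type*} [TopologicalSpace S] [CompactSpace S] [ChartedSpace (Corner.Euc k) S]
    [IsManifold 𝓘(ℝ, Corner.Euc k) ∞ S]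
    {M : Type*} [TopologicalSpace M] [T2Space M]
    [ChartedSpace (ModelProd (Corner.Euc k) ℝ) M] [IsManifold (Corner.mdl k) ∞ M]
    {Ω : Set M} {ι : S → M}
    (G : Corner.CornerMetric k Ω ι) (c : Corner.GaussianCollar G)
    (hH : ∀ x : S, G.meanCurvatureMinus x = G.meanCurvaturePlus x) :
    ∃ δ₀ : ℝ, 0 < δ₀ ∧ δ₀ ≤ c.ε ∧ ∃ gδ : ℝ → Corner.Glued.C2Metric c,
      (∀ η : ℝ, 0 < η → ∃ δ₁ : ℝ, 0 < δ₁ ∧ ∀ δ : ℝ, 0 < δ → δ ≤ δ₀ → δ ≤ δ₁ →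
        ∀ (p : Corner.Glued c) (v : TangentSpace (Corner.mdl k) p),
          |(gδ δ).inner p v v - Corner.Glued.metric c p v v| ≤ η * Corner.Glued.metric c p v v) ∧
      (∀ δ : ℝ, 0 < δ → δ ≤ δ₀ →
        ∀ p : Corner.Glued c, p ∉ Corner.Glued.strip c (Ioo (-(δ / 2)) (δ / 2)) →
          (gδ δ).inner p = Corner.Glued.metric c p) ∧
      (∃ C : ℝ, ∀ δ : ℝ, 0 < δ → δ ≤ δ₀ →
        ∀ p ∈ Corner.Glued.strip c (Icc (-(δ / 2)) (δ / 2)),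
          |Corner.scalarCurvature (gδ δ).inner p| ≤ C) := by
  have hε := c.ε_pos
  -- Closeness with $\eta=1/2$ serves twice: for positivity of the smoothed metrics and for the
  -- coercivity behind the curvature bound.
  obtain ⟨h₁, hh₁, hcl⟩ := Corner.exists_smoothMetric_close (c := c) hH (η := 1 / 2) (by norm_num)
  let h₀ := min (c.ε / 2) h₁
  have hh₀ : 0 < h₀ := lt_min (by linarith) hh₁
  have hh₀ε : h₀ ≤ c.ε / 2 := min_le_left _ _
  have hlow : ∀ h, 0 < h → h ≤ h₀ → ∀ (p : Corner.Glued c) (v : Corner.Euc k × ℝ),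
      |Corner.smoothMetric c h p v v - Corner.Glued.metric c p v v| ≤
        1 / 2 * Corner.Glued.metric c p v v := fun h hh hhh ↦
    hcl h hh (hhh.trans (min_le_left _ _)) (hhh.trans (min_le_right _ _))
  classical
  -- The family is indexed by all real numbers, so every $\delta$ needs an admissible width:
  -- $\delta/2$ in the relevant range, and the default `h₀` elsewhere.
  let w : ℝ → ℝ := fun δ ↦ if 0 < δ ∧ δ ≤ 2 * h₀ then δ / 2 else h₀
  have hw : ∀ δ, 0 < w δ ∧ w δ ≤ h₀ := by
    intro δ
    by_cases hδ : 0 < δ ∧ δ ≤ 2 * h₀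
    · simp only [w, if_pos hδ]; constructor <;> linarith [hδ.1, hδ.2]
    · simp only [w, if_neg hδ]; exact ⟨hh₀, le_rfl⟩
  have hw' : ∀ δ, 0 < δ → δ ≤ 2 * h₀ → w δ = δ / 2 := fun δ h1 h2 ↦ if_pos ⟨h1, h2⟩
  obtain ⟨C, hC⟩ := Corner.exists_abs_scalarCurvature_le hH hh₀ε hlow
  refine ⟨2 * h₀, by linarith, by linarith, fun δ ↦ Corner.smoothC2Metric c (w δ)
    (Corner.isInner_smoothMetric (hlow _ (hw δ).1 (hw δ).2))
    (Corner.contMDiff_smoothMetric hH (hw δ).1 (by linarith [(hw δ).2])), ?_, ?_, C, ?_⟩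
  · intro η hη
    obtain ⟨h₂, hh₂, hcl₂⟩ := Corner.exists_smoothMetric_close (c := c) hH hη
    -- The width is $\delta/2\le\delta\le h_2$, so the threshold for the width also serves for
    -- $\delta$.
    refine ⟨h₂, hh₂, fun δ h1 h2 h3 p v ↦ ?_⟩
    have := hw' δ h1 h2
    exact hcl₂ (w δ) (hw δ).1 ((hw δ).2.trans hh₀ε) (by linarith) p v
  · intro δ h1 h2 p hp
    rw [← hw' δ h1 h2] at hp
    exact Corner.smoothMetric_of_notMem_strip (hw δ).1 hp
  · intro δ h1 h2 p hp
    rw [← hw' δ h1 h2] at hp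
    exact hC (w δ) (hw δ).1 (hw δ).2 p hp
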